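/- Let $\gamma\in(0,3)$ and $R\ge 1$. Write $V_\gamma(x)=|x|^{-\gamma}$ on $\mathbb R^3$, let $*$ be convolution in $x$, and consider the damped problem $$\partial_t^2v-\Delta v+\tfrac{2}{1+t}\partial_tv=(V_\gamma*v^2)v,\qquad v(\cdot,0)=v_0,\quad \partial_tv(\cdot,0)=v_1, \tag{1}$$ and, for $u=(1+t)v$, the transformed problem $$\partial_t^2u-\Delta u=\frac{(V_\gamma*u^2)u}{(1+t)^2},\qquad u(\cdot,0)=v_0,\quad \partial_tu(\cdot,0)=v_0+v_1. \tag{2}$$ Let $W(\phi|x,t)=\frac{|t|}{4\pi}\int_{|\omega|=1}\phi(x+|t|\omega)\,dS_\omega$. For $T\in(0,\infty]$, a solution of (2) on $\mathbb R^3\times[0,T)$ is a function $u\in C(\mathbb R^3\times[0,T))$ for which $V_\gamma*u^2$ converges at every point of $\mathbb R^3\times[0,T)$ and is bounded on its compact subsets, and which satisfies, for all $(x,t)\in\mathbb R^3\times[0,T)$, $$u(x,t)=\partial_tW(v_0|x,t)+W(v_0+v_1|x,t)+\int_0^tW\Big(\frac{\big((V_\gamma*u^2)u\big)(\cdot,s)}{(1+s)^2}\Big|x,t-s\Big)ds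 ,$$ where $\partial_t$ at $t=0$ is the derivative from the right. A solution of (1) is a function $v$ such that $(1+t)v$ is a solution of (2). The lifespan $T(v_0,v_1)$ is the supremum of all $T\in(0,\infty]$ such that (2) has one and only one solution on $\mathbb R^3\times[0,T)$. Put $\tau_\pm(r,t)=\frac{t\pm r+2R}{R}$, and $N_\gamma(\varrho)=\varrho^{\gamma+1}$ if $\gamma<2$, $N_\gamma(\varrho)=\varrho^3/\log(1+\varrho)$ if $\gamma=2$, $N_\gamma(\varrho)=\varrho^3$ if $\gamma>2$. Let $X(\infty)$ be the space of all $u\in C(\mathbb R^3\times[0,\infty))$ with support in $\{|x|\le t+R\}$ and $\sup_{x,t}\tau_+(|x|,t)N_\gamma(\tau_-(|x|,t))|u(x,t)|<\infty$. Then there are constants $\varepsilon_0>0$ and $C_*>0$, depending only on $\gamma$ and $R$, such that for every $\varepsilon\in(0,\varepsilon_0]$ and all $(v_0,v_1)\in C^2(\mathbb R^3)\times C^1(\mathbb R^3)$ with support in $\{|x|\le R\}$ and $\|(v_0,v_1)\|_{C^2\times C^1}\le\varepsilon$ the following hold. 1. $T(v_0,v_1)=\infty$, and (2) has a solution $u$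 on $\mathbb R^3\times[0,\infty)$, which belongs to $X(\infty)$. It is unique: for every $T\in(0,\infty]$, every solution of (2) on $\mathbb R^3\times[0,T)$ coincides with $u$ there. 2. There is $u^+\in C(\mathbb R^3\times[0,\infty))$ with $\partial_t^2u^+-\Delta u^+=0$ in the sense of distributions on $\mathbb R^3\times(0,\infty)$ and $$\lim_{t\to\infty}\sup_{x\in\mathbb R^3}(1+t+|x|)\,|u(x,t)-u^+(x,t)|=0 .$$ 3. The function $v=\frac{1}{1+t}u$ is a solution of (1), and for all $t\ge0$ $$\sup_{x\in\mathbb R^3}(1+t+|x|)\,|v(x,t)|\le C_*\,\varepsilon\,(1+t)^{-1}.$$ -/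

import Mathlib

open MeasureTheory Set Filter Topology
open scoped ENNReal

noncomputable section

namespace CubicConvWave

/-- Three-dimensional Euclidean space. -/
abbrev E3 : Type := EuclideanSpace ℝ (Fin 3)

/-- The space-time slab of all `(x, t)` with `0 ≤ t < T`, where `T ∈ [0, ∞]`. -/
def slab (T : ℝ≥0∞) : Set (E3 × ℝ) := {z | 0 ≤ z.2 ∧ ENNReal.ofReal z.2 < T}

/-- The solution operator of the free wave equation,
`W(φ | x, t) = |t| / (4π) ∫_{|ω| = 1} φ (x + |t| ω) dS_ω`. The measure `toSphere` of the Lebesgue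
measure is the surface measure of the unit sphere, of total mass `4π`. -/
def W (φ : E3 → ℝ) (x : E3) (t : ℝ) : ℝ :=
  |t| / (4 * Real.pi) *
    ∫ ω : Metric.sphere (0 : E3) 1, φ (x + |t| • (ω : E3)) ∂((volume : Measure E3).toSphere)

/-- The free part `u⁰ = ∂ₜ W(v₀) + W(v₀ + v₁)`, used for `t ≥ 0`; at `t = 0` the time derivative
is the one from the right (`W` contains the factor `|t|`). -/
def freePart (v₀ v₁ : E3 → ℝ) (x : E3) (t : ℝ) : ℝ :=
  derivWithin (fun τ => W v₀ x τ) (Ici 0) t + W (fun y => v₀ y + v₁ y) x t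

/-- The Duhamel operator `L(F)(x, t) = ∫₀ᵗ W(F(·, s) / (1 + s)² | x, t - s) ds`. -/
def duhamel (F : E3 → ℝ → ℝ) (x : E3) (t : ℝ) : ℝ :=
  ∫ s in (0 : ℝ)..t, W (fun y => F y s / (1 + s) ^ 2) x (t - s)

/-- The convolution `(V_γ * u²)(x, t) = ∫ |x - y|^{-γ} u(y, t)² dy`. -/
def conv (γ : ℝ) (u : E3 → ℝ → ℝ) (x : E3) (t : ℝ) : ℝ :=
  ∫ y : E3, ‖x - y‖ ^ (-γ) * u y t ^ 2

/-- `u` is a solution on `ℝ³ × [0, T)` of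
`∂ₜ²u - Δu = (V_γ * u²) u / (1 + t)²`, `u(0) = v₀`, `∂ₜu(0) = v₀ + v₁`:
a continuous function that satisfies the associated integral equation
`u = u⁰ + L((V_γ * u²) u)`. For this equation to be meaningful, the convolution integral
has to converge at every point and to be bounded on compact subsets of `ℝ³ × [0, T)`. -/
structure IsSolution (γ : ℝ) (v₀ v₁ : E3 → ℝ) (T : ℝ≥0∞) (u : E3 → ℝ → ℝ) : Prop where
  continuousOn : ContinuousOn (fun z : E3 × ℝ => u z.1 z.2) (slab T)
  integrable : ∀ z ∈ slab T, Integrable (fun y : E3 => ‖z.1 - y‖ ^ (-γ) * u y z.2 ^ 2)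
  locallyBounded : ∀ K : Set (E3 × ℝ), IsCompact K → K ⊆ slab T →
    ∃ C : ℝ, ∀ z ∈ K, conv γ u z.1 z.2 ≤ C
  equation : ∀ z ∈ slab T,
    u z.1 z.2 = freePart v₀ v₁ z.1 z.2 + duhamel (fun y s => conv γ u y s * u y s) z.1 z.2

/-- `v` is a solution on `ℝ³ × [0, T)` of the original damped problem
`∂ₜ²v - Δv + 2 / (1 + t) ∂ₜv = (V_γ * v²) v`, `v(0) = v₀`, `∂ₜv(0) = v₁`: its Liouville transform
`u = (1 + t) v` is a solution of the transformed problem. -/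
def IsOriginalSolution (γ : ℝ) (v₀ v₁ : E3 → ℝ) (T : ℝ≥0∞) (v : E3 → ℝ → ℝ) : Prop :=
  IsSolution γ v₀ v₁ T (fun x t => (1 + t) * v x t)

/-- The lifespan: the supremum of all `T ∈ (0, ∞]` such that there is one and only one solution
on `ℝ³ × [0, T)`. -/
def lifespan (γ : ℝ) (v₀ v₁ : E3 → ℝ) : ℝ≥0∞ :=
  sSup {T : ℝ≥0∞ | 0 < T ∧ ∃ u : E3 → ℝ → ℝ, IsSolution γ v₀ v₁ T u ∧
    ∀ w : E3 → ℝ → ℝ, IsSolution γ v₀ v₁ T w → ∀ z ∈ slab T, w z.1 z.2 = u z.1 z.2}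

/-- The weight `τ₊(r, t) = (t + r + 2R) / R`. -/
def tauPlus (R r t : ℝ) : ℝ := (t + r + 2 * R) / R

/-- The weight `τ₋(r, t) = (t - r + 2R) / R`. -/
def tauMinus (R r t : ℝ) : ℝ := (t - r + 2 * R) / R

/-- The weight function `N_γ`. -/
def weightN (γ ρ : ℝ) : ℝ :=
  if γ < 2 then ρ ^ (γ + 1) else if γ = 2 then ρ ^ 3 / Real.log (1 + ρ) else ρ ^ 3

/-- The norm of `X(T) = X(T, R)`, with values in `[0, ∞]`:
the supremum over `ℝ³ × [0, T)` of `τ₊(|x|, t) N_γ(τ₋(|x|, t)) |u(x, t)|`. -/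
def normX (γ R : ℝ) (T : ℝ≥0∞) (u : E3 → ℝ → ℝ) : ℝ≥0∞ :=
  ⨆ z ∈ slab T,
    ENNReal.ofReal (tauPlus R ‖z.1‖ z.2 * weightN γ (tauMinus R ‖z.1‖ z.2) * |u z.1 z.2|)

/-- Membership in the space `X(T) = X(T, R)`: continuous functions on `ℝ³ × [0, T)` with finite
norm and with support in `|x| ≤ t + R` (a relatively closed set). -/
structure MemX (γ R : ℝ) (T : ℝ≥0∞) (u : E3 → ℝ → ℝ) : Prop where
  continuousOn : ContinuousOn (fun z : E3 × ℝ => u z.1 z.2) (slab T)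
  norm_lt_top : normX γ R T u < ⊤
  support : ∀ z ∈ slab T, u z.1 z.2 ≠ 0 → ‖z.1‖ ≤ z.2 + R

/-- The norm of `C²(ℝ³) × C¹(ℝ³)`, with values in `[0, ∞]`. -/
def dataNorm (v₀ v₁ : E3 → ℝ) : ℝ≥0∞ :=
  ⨆ x : E3, ((∑ k ∈ Finset.range 3, ‖iteratedFDeriv ℝ k v₀ x‖ₑ) +
    ∑ k ∈ Finset.range 2, ‖iteratedFDeriv ℝ k v₁ x‖ₑ)

/-- `w ∈ C(ℝ³ × [0, ∞))` solves the free wave equation `∂ₜ²w - Δw = 0` on `ℝ³ × (0, ∞)`,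
in the sense of distributions. -/
def IsFreeWave (w : E3 → ℝ → ℝ) : Prop :=
  ContinuousOn (fun z : E3 × ℝ => w z.1 z.2) (slab ⊤) ∧
  ∀ φ : E3 × ℝ → ℝ, ContDiff ℝ ((⊤ : ℕ∞) : WithTop ℕ∞) φ → HasCompactSupport φ →
    tsupport φ ⊆ {z | 0 < z.2} →
    ∫ z : E3 × ℝ, w z.1 z.2 *
      (iteratedDeriv 2 (fun s => φ (z.1, s)) z.2 -
        Laplacian.laplacian (fun y : E3 => φ (y, z.2)) z.1) = 0

end CubicConvWave

end

/-! The integral equation `u = u⁰ + L((V_γ * u²) u)` is solved by contraction in `X(∞)`. The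
estimates rest on one explicit formula, `surf_lintegral_radial`: the mean of a radial function over
a sphere centred at `x` is a one-dimensional integral with density `l dl`. It follows from
Archimedes' theorem and the law of cosines. A Duhamel integral with a radial majorant thus becomes a
planar integral in `(s, l)`, which splits in the characteristic variables `s + l` and `s - l`.

Nonlinear estimate: if `u` is bounded in `X(∞)` and `p = s + 2R`, then `u²` is at most a constant
times `p⁻² (p - |y|)⁻²`. Its convolution with `|x|^{-γ}` is at most a constant times `p⁻² (1 + ∫₁ᵖ
σ^{1-γ} dσ)`, uniformly in `x` (`kernel_bound`). The weight `N_γ` is `p³` divided by the growth of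
this integral. Together with the factor `(1 + s)⁻²` the source is therefore bounded by `τ₊⁻² N(τ₊)⁻¹
N(τ₋)⁻¹` (`nonlinear_bound`).

Linear estimate: on the backward cone `τ₊` is at least the value `a` of `τ₋` at the vertex, and
`N(ρ)/ρ` is increasing up to a constant. This extracts `a / N(a)` from the source and leaves a
product of integrable functions of `s + l` and `s - l` (`duhamel_weight_bound`). The free part lies
in `X(∞)` by Huygens' principle, and for small data the map contracts a ball whose radius is
proportional to `ε` (`exists_fixedPoint`).

Uniqueness needs no smallness of the solutions. On a compact backward cone the nonlocal factor is a
bounded potential, and a Gronwall argument gives finite speed of propagation. Solutions then have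
compact support in space at each time, the nonlinearity is Lipschitz on them, and the same Gronwall
argument applies to differences.

Scattering: extended oddly in time, each slice of the source generates a free wave on all of
space-time. The superposition of these waves over all `s > 0`, added to the free part, is `u⁺`; the
difference `u - u⁺` is the wave generated after time `t`, an integrable tail. That spherical means
give distributional solutions comes from the Euler–Poisson–Darboux identity, which is obtained by
differentiating the rotation invariance of the surface measure. -/

noncomputable section

namespace CubicConvWave

/-! ### Surface measure of the sphere and spherical means of radial functions. -/

/-- The unit sphere of `ℝ³`. -/
abbrev S2 : Type := Metric.sphere (0 : E3) 1

/-- The surface measure of the unit sphere. -/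
abbrev surf : Measure S2 := (volume : Measure E3).toSphere

theorem lintegral_polar (f : E3 → ℝ≥0∞) (hf : Measurable f) :
    ∫⁻ y, f y = ∫⁻ ρ in Ioi (0 : ℝ), ENNReal.ofReal (ρ ^ 2) * ∫⁻ ω, f (ρ • (ω : E3)) ∂surf := by
  have h1 : ∫⁻ y, f y = ∫⁻ y : ({0}ᶜ : Set E3), f y ∂(volume.comap Subtype.val) := by
    rw [lintegral_subtype_comap (MeasurableSet.compl (measurableSet_singleton _)),
      restrict_compl_singleton]
  have h2 : ∫⁻ y : ({0}ᶜ : Set E3), f y ∂(volume.comap Subtype.val) =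
      ∫⁻ p : S2 × Ioi (0 : ℝ), f ((p.2 : ℝ) • (p.1 : E3))
        ∂(surf.prod (Measure.volumeIoiPow 2)) := by
    have h := (volume : Measure E3).measurePreserving_homeomorphUnitSphereProd.lintegral_comp_emb
      (Homeomorph.measurableEmbedding _) (fun p => f ((p.2 : ℝ) • (p.1 : E3)))
    have hd : Module.finrank ℝ E3 - 1 = 2 := by simp
    rw [hd] at h
    rw [← h]
    refine lintegral_congr fun y => ?_
    rw [← homeomorphUnitSphereProd_symm_apply_coe, Homeomorph.symm_apply_apply]
  have hm : Measurable fun p : S2 × Ioi (0 : ℝ) => f ((p.2 : ℝ) • (p.1 : E3)) :=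
    hf.comp (by fun_prop)
  rw [h1, h2, lintegral_prod_symm _ hm.aemeasurable, Measure.volumeIoiPow,
    lintegral_withDensity_eq_lintegral_mul _ (by fun_prop) hm.lintegral_prod_left',
    ← lintegral_subtype_comap measurableSet_Ioi]
  rfl

theorem surf_univ : surf univ = ENNReal.ofReal (4 * Real.pi) := by
  rw [Measure.toSphere_apply_univ, EuclideanSpace.volume_ball_fin_three]
  simp only [finrank_euclideanSpace, Fintype.card_fin, Nat.cast_ofNat, one_pow, ENNReal.ofReal_one,
    one_mul]
  rw [show (3 : ℝ≥0∞) = ENNReal.ofReal 3 by simp, ← ENNReal.ofReal_mul (by norm_num)]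
  congr 1; ring

theorem surf_real_univ : surf.real univ = 4 * Real.pi := by
  rw [measureReal_def, surf_univ, ENNReal.toReal_ofReal (by positivity)]

/-- Polar coordinates for the extension that is homogeneous of degree zero: the radial factor is
`∫₀¹ ρ² dρ = 1/3`. In this form the symmetries of Lebesgue measure pass to the surface measure. -/
theorem surf_lintegral_eq (f : E3 → ℝ≥0∞) (hf : Measurable f) :
    ∫⁻ ω : S2, f ω ∂surf = 3 * ∫⁻ y in Metric.ball (0 : E3) 1, f (‖y‖⁻¹ • y) := by
  have hn : Measurable fun y : E3 => f (‖y‖⁻¹ • y) := hf.comp (by fun_prop)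
  rw [← lintegral_indicator measurableSet_ball, lintegral_polar _ (hn.indicator measurableSet_ball)]
  have h : ∀ ρ ∈ Ioi (0 : ℝ), ENNReal.ofReal (ρ ^ 2) *
      ∫⁻ ω : S2, (Metric.ball (0 : E3) 1).indicator (fun y => f (‖y‖⁻¹ • y)) (ρ • (ω : E3)) ∂surf
      = (Ioo (0 : ℝ) 1).indicator (fun ρ => ENNReal.ofReal (ρ ^ 2)) ρ *
        ∫⁻ ω : S2, f ω ∂surf := by
    intro ρ hρ
    have hρ' : 0 < ρ := hρ
    by_cases h1 : ρ < 1
    · rw [indicator_of_mem (show ρ ∈ Ioo (0 : ℝ) 1 from ⟨hρ, h1⟩)]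
      congr 1
      refine lintegral_congr fun ω => ?_
      have hω : ‖(ω : E3)‖ = 1 := by simp
      rw [indicator_of_mem (by simp [norm_smul, hω, abs_of_pos hρ', h1])]
      rw [norm_smul, hω, Real.norm_of_nonneg hρ'.le, mul_one, smul_smul, inv_mul_cancel₀ hρ'.ne',
        one_smul]
    · rw [indicator_of_notMem (show ρ ∉ Ioo (0 : ℝ) 1 from fun h => h1 h.2)]
      have : ∀ ω : S2, (Metric.ball (0 : E3) 1).indicator (fun y => f (‖y‖⁻¹ • y)) (ρ • (ω : E3))
          = 0 := by
        intro ω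
        have hω : ‖(ω : E3)‖ = 1 := by simp
        rw [indicator_of_notMem (by simp [norm_smul, hω, abs_of_pos hρ']; linarith)]
      simp [this]
  rw [setLIntegral_congr_fun measurableSet_Ioi h, lintegral_mul_const _
    (Measurable.indicator (by fun_prop) measurableSet_Ioo), ← mul_assoc]
  have : ∫⁻ ρ in Ioi (0 : ℝ), (Ioo (0 : ℝ) 1).indicator (fun ρ => ENNReal.ofReal (ρ ^ 2)) ρ
      = ENNReal.ofReal (1 / 3) := by
    rw [setLIntegral_indicator measurableSet_Ioo,
      show Ioo (0 : ℝ) 1 ∩ Ioi 0 = Ioo 0 1 by ext; simp +contextual,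
      Measure.restrict_congr_set Ioo_ae_eq_Ioc, ← ofReal_integral_eq_lintegral_ofReal
      (intervalIntegral.intervalIntegrable_pow 2).1 (.of_forall fun x => sq_nonneg x),
      ← intervalIntegral.integral_of_le zero_le_one]
    norm_num
  rw [this, show (3 : ℝ≥0∞) = ENNReal.ofReal 3 by simp, ← ENNReal.ofReal_mul (by norm_num)]
  norm_num

theorem surf_lintegral_isometry (L : E3 ≃ₗᵢ[ℝ] E3) (f : E3 → ℝ≥0∞) (hf : Measurable f) :
    ∫⁻ ω : S2, f (L ω) ∂surf = ∫⁻ ω : S2, f ω ∂surf := by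
  rw [surf_lintegral_eq (fun y => f (L y)) (hf.comp L.continuous.measurable),
    surf_lintegral_eq f hf]
  congr 1
  have h := L.measurePreserving.setLIntegral_comp_preimage_emb L.toHomeomorph.measurableEmbedding
    (fun y => f (‖y‖⁻¹ • y)) (Metric.ball 0 1)
  have : L ⁻¹' Metric.ball 0 1 = Metric.ball 0 1 := by
    ext y; simp
  rw [← h, this]
  simp

/-- The map of the sphere to itself induced by a linear isometry. -/
def sphereMap (L : E3 ≃ₗᵢ[ℝ] E3) (ω : S2) : S2 := ⟨L ω, by simp⟩

theorem continuous_sphereMap (L : E3 ≃ₗᵢ[ℝ] E3) : Continuous (sphereMap L) :=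
  Continuous.subtype_mk (L.continuous.comp continuous_subtype_val) _

theorem measurePreserving_sphereMap (L : E3 ≃ₗᵢ[ℝ] E3) :
    MeasurePreserving (sphereMap L) surf surf := by
  refine ⟨(continuous_sphereMap L).measurable, Measure.ext fun s hs => ?_⟩
  rw [Measure.map_apply (continuous_sphereMap L).measurable hs]
  have hemb : MeasurableEmbedding (Subtype.val : S2 → E3) :=
    MeasurableEmbedding.subtype_coe Metric.isClosed_sphere.measurableSet
  have hs' : MeasurableSet (Subtype.val '' s : Set E3) := hemb.measurableSet_image.2 hs
  have h := surf_lintegral_isometry L ((Subtype.val '' s).indicator 1)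
    (measurable_one.indicator hs')
  rw [← lintegral_indicator_one hs, ← lintegral_indicator_one
    ((continuous_sphereMap L).measurable hs)]
  convert h using 2
  · funext ω
    simp only [indicator]
    congr 1
    simp [sphereMap]
  · funext ω
    have : ((ω : E3) ∈ Subtype.val '' s) ↔ ω ∈ s := Subtype.val_injective.mem_set_image
    by_cases h : ω ∈ s
    · rw [indicator_of_mem h, indicator_of_mem (this.2 h)]; rfl
    · rw [indicator_of_notMem h, indicator_of_notMem (mt this.1 h)]

theorem surf_integral_isometry (L : E3 ≃ₗᵢ[ℝ] E3) (f : E3 → ℝ) (hf : Continuous f) :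
    ∫ ω : S2, f (L ω) ∂surf = ∫ ω : S2, f ω ∂surf := by
  conv_rhs => rw [← (measurePreserving_sphereMap L).map_eq]
  exact (integral_map (continuous_sphereMap L).aemeasurable
    (hf.comp continuous_subtype_val).aestronglyMeasurable).symm

theorem lintegral_comp_sq (f : ℝ → ℝ≥0∞) {a b : ℝ} (ha : 0 ≤ a) :
    ∫⁻ p in Ioo (a ^ 2) (b ^ 2), f p =
      ∫⁻ l in Ioo a |b|, ENNReal.ofReal (2 * l) * f (l ^ 2) := by
  have himg : (fun l : ℝ => l ^ 2) '' Ioo a |b| = Ioo (a ^ 2) (b ^ 2) := by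
    ext p
    constructor
    · rintro ⟨l, hl, rfl⟩
      refine ⟨by have := hl.1; dsimp; gcongr, ?_⟩
      rw [← sq_abs b]
      have := hl.2
      have : 0 ≤ l := ha.trans hl.1.le
      dsimp; gcongr
    · rintro ⟨h1, h2⟩
      have hp : 0 ≤ p := (sq_nonneg a).trans h1.le
      refine ⟨√p, ⟨Real.lt_sqrt_of_sq_lt h1, ?_⟩, Real.sq_sqrt hp⟩
      rw [Real.sqrt_lt' (by
        rw [abs_pos]; rintro rfl; nlinarith [sq_nonneg a])]
      rwa [sq_abs]
  have h := lintegral_image_eq_lintegral_abs_deriv_mul (s := Ioo a |b|) (f := fun l => l ^ 2)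
    (f' := fun l => 2 * l) measurableSet_Ioo
    (fun x _ => by simpa using (hasDerivAt_pow 2 x).hasDerivWithinAt)
    (fun x hx y hy hxy => by
      have h1 : 0 ≤ x := ha.trans hx.1.le
      have h2 : 0 ≤ y := ha.trans hy.1.le
      exact (pow_left_inj₀ h1 h2 two_ne_zero).1 hxy) f
  rw [himg] at h
  have h3 : ∀ l ∈ Ioo a |b|, ENNReal.ofReal |2 * l| * f (l ^ 2) =
      ENNReal.ofReal (2 * l) * f (l ^ 2) := by
    intro l hl
    rw [abs_of_nonneg (by linarith [hl.1])]
  rw [h, setLIntegral_congr_fun measurableSet_Ioo h3]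

theorem lintegral_sq_Ioi (f : ℝ → ℝ≥0∞) :
    ∫⁻ l in Ioi (0 : ℝ), ENNReal.ofReal (2 * l) * f (l ^ 2) = ∫⁻ p in Ioi (0 : ℝ), f p := by
  have himg : (fun l : ℝ => l ^ 2) '' Ioi 0 = Ioi 0 := by
    ext p
    constructor
    · rintro ⟨l, hl, rfl⟩
      exact pow_pos (mem_Ioi.1 hl) 2
    · intro hp
      exact ⟨√p, Real.sqrt_pos.2 hp, Real.sq_sqrt (le_of_lt hp)⟩
  have h := lintegral_image_eq_lintegral_abs_deriv_mul (s := Ioi 0) (f := fun l => l ^ 2)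
    (f' := fun l => 2 * l) measurableSet_Ioi
    (fun x _ => by simpa using (hasDerivAt_pow 2 x).hasDerivWithinAt)
    (fun x hx y hy hxy => (pow_left_inj₀ (le_of_lt hx) (le_of_lt hy) two_ne_zero).1 hxy) f
  rw [himg] at h
  rw [h]
  refine setLIntegral_congr_fun measurableSet_Ioi fun l hl => ?_
  rw [abs_of_nonneg (by have : 0 < l := hl; linarith)]

theorem lintegral_affine (f : ℝ → ℝ≥0∞) {m : ℝ} (hm : 0 < m) (k a b : ℝ) :
    ∫⁻ x in Ioo (k + m * a) (k + m * b), f x =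
      ENNReal.ofReal m * ∫⁻ x in Ioo a b, f (k + m * x) := by
  have himg : (fun x : ℝ => k + m * x) '' Ioo a b = Ioo (k + m * a) (k + m * b) := by
    ext p
    constructor
    · rintro ⟨l, hl, rfl⟩
      exact ⟨by have := hl.1; dsimp; gcongr, by have := hl.2; dsimp; gcongr⟩
    · rintro ⟨h1, h2⟩
      refine ⟨(p - k) / m, ⟨?_, ?_⟩, by field_simp; ring⟩
      · rw [lt_div_iff₀ hm]; linarith
      · rw [div_lt_iff₀ hm]; linarith
  have h := lintegral_image_eq_lintegral_abs_deriv_mul (s := Ioo a b) (f := fun x => k + m * x)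
    (f' := fun _ => m) measurableSet_Ioo
    (fun x _ => by simpa using (((hasDerivAt_id x).const_mul m).const_add k).hasDerivWithinAt)
    (fun x hx y hy hxy => by simpa [hm.ne'] using hxy) f
  rw [himg, abs_of_pos hm, lintegral_const_mul' _ _ ENNReal.ofReal_ne_top] at h
  exact h

theorem lintegral_plane (f : ℝ → ℝ≥0∞) (hf : Measurable f) :
    ∫⁻ z : ℝ × ℝ, f (z.1 ^ 2 + z.2 ^ 2) = ENNReal.ofReal Real.pi * ∫⁻ q in Ioi (0 : ℝ), f q := by
  rw [← lintegral_comp_polarCoord_symm, ← lintegral_sq_Ioi, polarCoord_target]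
  have h : ∀ p : ℝ × ℝ, ENNReal.ofReal p.1 • f ((polarCoord.symm p).1 ^ 2 +
      (polarCoord.symm p).2 ^ 2) = ENNReal.ofReal p.1 * f (p.1 ^ 2) := by
    intro p
    rw [polarCoord_symm_apply, smul_eq_mul]
    congr 2
    simp only
    linear_combination p.1 ^ 2 * Real.sin_sq_add_cos_sq p.2
  simp only [h]
  rw [Measure.volume_eq_prod, ← Measure.prod_restrict,
    lintegral_prod (fun p : ℝ × ℝ => ENNReal.ofReal p.1 * f (p.1 ^ 2)) (by fun_prop)]
  simp only [lintegral_const, Measure.restrict_apply MeasurableSet.univ, univ_inter,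
    Real.volume_Ioo]
  rw [lintegral_mul_const _ (by fun_prop), mul_comm, show Real.pi - -Real.pi = Real.pi * 2 by ring,
    ENNReal.ofReal_mul Real.pi_pos.le, mul_assoc, ← lintegral_const_mul _ (by fun_prop)]
  congr 1
  refine lintegral_congr fun l => ?_
  rw [ENNReal.ofReal_mul zero_le_two, mul_assoc]

theorem lintegral_coords (f : ℝ → ℝ → ℝ≥0∞) (hf : Measurable (fun p : ℝ × ℝ => f p.1 p.2)) :
    ∫⁻ y : E3, f (y 0) (y 1 ^ 2 + y 2 ^ 2) =
      ∫⁻ a : ℝ, ENNReal.ofReal Real.pi * ∫⁻ q in Ioi (0 : ℝ), f a q := by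
  have h1 := (EuclideanSpace.volume_preserving_symm_measurableEquiv_toLp (Fin 3)).lintegral_comp_emb
    (MeasurableEquiv.measurableEmbedding _)
    (fun y : Fin 3 → ℝ => f (y 0) (y 1 ^ 2 + y 2 ^ 2))
  have h2 := (volume_preserving_piFinSuccAbove (fun _ : Fin 3 => ℝ) 0).lintegral_comp_emb
    (MeasurableEquiv.measurableEmbedding _)
    (fun z : ℝ × (Fin 2 → ℝ) => f z.1 (z.2 0 ^ 2 + z.2 1 ^ 2))
  have h3 : ∀ a, ∫⁻ z : Fin 2 → ℝ, f a (z 0 ^ 2 + z 1 ^ 2) =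
      ∫⁻ z : ℝ × ℝ, f a (z.1 ^ 2 + z.2 ^ 2) := fun a =>
    (volume_preserving_finTwoArrow ℝ).lintegral_comp_emb
    (MeasurableEquiv.measurableEmbedding _) (fun z : ℝ × ℝ => f a (z.1 ^ 2 + z.2 ^ 2))
  have hm : Measurable fun z : ℝ × (Fin 2 → ℝ) => f z.1 (z.2 0 ^ 2 + z.2 1 ^ 2) :=
    hf.comp (f := fun z : ℝ × (Fin 2 → ℝ) => (z.1, z.2 0 ^ 2 + z.2 1 ^ 2)) (by fun_prop)
  refine h1.trans (h2.trans ?_)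
  rw [Measure.volume_eq_prod, lintegral_prod _ hm.aemeasurable]
  refine lintegral_congr fun a => ?_
  rw [h3, lintegral_plane (f a) (hf.comp measurable_prodMk_left)]

theorem norm_sq_coords (y : E3) : ‖y‖ ^ 2 = y 0 ^ 2 + (y 1 ^ 2 + y 2 ^ 2) := by
  rw [EuclideanSpace.norm_sq_eq, Fin.sum_univ_three]
  simp [add_assoc]

/-- Archimedes' theorem: the coordinate on the unit sphere is uniformly distributed. -/
theorem surf_lintegral_coord (g : ℝ → ℝ≥0∞) (hg : Measurable g) :
    ∫⁻ ω : S2, g ((ω : E3) 0) ∂surf = ENNReal.ofReal (2 * Real.pi) * ∫⁻ c in Ioo (-1) 1, g c := by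
  rw [surf_lintegral_eq (fun y => g (y 0)) (hg.comp (by fun_prop)), ← lintegral_indicator
    measurableSet_ball]
  let F : ℝ → ℝ → ℝ≥0∞ := fun a q => (Iio (1 : ℝ)).indicator (fun p => g (a / √p)) (a ^ 2 + q)
  have hF : Measurable (fun p : ℝ × ℝ => F p.1 p.2) := by
    have : (fun p : ℝ × ℝ => F p.1 p.2) =
        {p : ℝ × ℝ | p.1 ^ 2 + p.2 < 1}.indicator (fun p => g (p.1 / √(p.1 ^ 2 + p.2))) := rfl
    rw [this]
    exact (hg.comp (by fun_prop)).indicator (measurableSet_lt (by fun_prop) (by fun_prop))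
  have h1 : ∀ y : E3, (Metric.ball (0 : E3) 1).indicator (fun y => g ((‖y‖⁻¹ • y) 0)) y =
      F (y 0) (y 1 ^ 2 + y 2 ^ 2) := by
    intro y
    simp only [F]
    rw [← norm_sq_coords]
    simp only [indicator, mem_ball_zero_iff, mem_Iio, sq_lt_one_iff₀ (norm_nonneg y),
      Real.sqrt_sq (norm_nonneg y)]
    simp [div_eq_inv_mul]
  simp only [h1]
  rw [lintegral_coords F hF]
  -- With `p = a² + q`, the squared norm, the pair `(a, p)` ranges over `a² < p < 1`.
  have h2 : ∀ a : ℝ, ∫⁻ q in Ioi (0 : ℝ), F a q =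
      ∫⁻ p, (Ioo (a ^ 2) 1).indicator (fun p => g (a / √p)) p := by
    intro a
    rw [← lintegral_indicator measurableSet_Ioi,
      ← lintegral_add_left_eq_self (fun p => (Ioo (a ^ 2) 1).indicator _ p) (a ^ 2)]
    refine lintegral_congr fun q => ?_
    simp [F, indicator, ite_and]
  simp only [h2]
  rw [lintegral_const_mul' _ _ ENNReal.ofReal_ne_top, lintegral_lintegral_swap]
  swap
  · have : Function.uncurry (fun (a p : ℝ) => (Ioo (a ^ 2) 1).indicator (fun p => g (a / √p)) p) =
        {z : ℝ × ℝ | z.1 ^ 2 < z.2 ∧ z.2 < 1}.indicator (fun z => g (z.1 / √z.2)) := rfl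
    rw [this]
    have h4 : MeasurableSet {z : ℝ × ℝ | z.1 ^ 2 < z.2 ∧ z.2 < 1} :=
      (measurableSet_lt (f := fun z : ℝ × ℝ => z.1 ^ 2) (g := fun z => z.2) (by fun_prop)
        (by fun_prop)).inter (measurableSet_lt (f := fun z : ℝ × ℝ => z.2) (g := fun _ => 1)
        (by fun_prop) (by fun_prop))
    have h5 : Measurable fun z : ℝ × ℝ => z.1 / √z.2 := by fun_prop
    exact ((hg.comp h5).indicator h4).aemeasurable
  -- Scaling `a = √p c` separates the variables: `c` ranges over `(-1, 1)` for every `p`, with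
  -- Jacobian `√p`. The total factor is `3 π ∫₀¹ √p dp = 2π`.
  have h3 : ∀ p : ℝ, ∫⁻ a : ℝ, (Ioo (a ^ 2) 1).indicator (fun p => g (a / √p)) p =
      (Ioo (0 : ℝ) 1).indicator (fun p => ENNReal.ofReal √p) p * ∫⁻ c in Ioo (-1) 1, g c := by
    intro p
    by_cases hp : p ∈ Ioo (0 : ℝ) 1
    · rw [indicator_of_mem hp]
      have hs : 0 < √p := Real.sqrt_pos.2 hp.1
      have h4 : ∀ a, (Ioo (a ^ 2) 1).indicator (fun p => g (a / √p)) p =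
          (Ioo (0 + √p * (-1)) (0 + √p * 1)).indicator (fun a => g (a / √p)) a := by
        intro a
        have : a ∈ Ioo (0 + √p * (-1)) (0 + √p * 1) ↔ p ∈ Ioo (a ^ 2) 1 := by
          simp only [mem_Ioo, hp.2, and_true, zero_add, mul_neg, mul_one]
          rw [← abs_lt, Real.lt_sqrt (abs_nonneg a), sq_abs]
        simp only [indicator, this]
      simp only [h4]
      rw [lintegral_indicator measurableSet_Ioo, lintegral_affine _ hs]
      congr 1
      refine lintegral_congr fun c => ?_
      congr 1
      field_simp
      ring
    · rw [indicator_of_notMem hp, zero_mul]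
      have : ∀ a, (Ioo (a ^ 2) 1).indicator (fun p => g (a / √p)) p = 0 := by
        intro a
        refine indicator_of_notMem (fun h => hp ⟨(sq_nonneg a).trans_lt h.1, h.2⟩) _
      simp [this]
  simp only [h3]
  rw [lintegral_mul_const _ (Measurable.indicator (by fun_prop) measurableSet_Ioo)]
  have h5 : ∫⁻ p : ℝ, (Ioo (0 : ℝ) 1).indicator (fun p => ENNReal.ofReal √p) p =
      ENNReal.ofReal (2 / 3) := by
    rw [lintegral_indicator measurableSet_Ioo, Measure.restrict_congr_set Ioo_ae_eq_Ioc,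
      ← ofReal_integral_eq_lintegral_ofReal _ (.of_forall fun x => Real.sqrt_nonneg x),
      ← intervalIntegral.integral_of_le zero_le_one]
    · simp only [Real.sqrt_eq_rpow]
      rw [integral_rpow (by norm_num)]
      norm_num
    · exact (Real.continuous_sqrt.intervalIntegrable 0 1).1
  rw [h5, ← mul_assoc, ← mul_assoc, show (3 : ℝ≥0∞) = ENNReal.ofReal 3 by simp,
    ← ENNReal.ofReal_mul (by norm_num), ← ENNReal.ofReal_mul (by positivity)]
  congr 2
  ring

theorem exists_isometry_single (e : E3) (he : ‖e‖ = 1) :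
    ∃ L : E3 ≃ₗᵢ[ℝ] E3, L (EuclideanSpace.single 0 1) = e :=
  ⟨_, Submodule.reflection_sub (by simp [he])⟩

theorem surf_lintegral_inner (e : E3) (he : ‖e‖ = 1) (g : ℝ → ℝ≥0∞) (hg : Measurable g) :
    ∫⁻ ω : S2, g (inner ℝ e (ω : E3)) ∂surf =
      ENNReal.ofReal (2 * Real.pi) * ∫⁻ c in Ioo (-1) 1, g c := by
  obtain ⟨L, hL⟩ := exists_isometry_single e he
  rw [← surf_lintegral_isometry L (fun y => g (inner ℝ e y)) (hg.comp (by fun_prop)), ← hL,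
    ← surf_lintegral_coord g hg]
  refine lintegral_congr fun ω => ?_
  rw [L.inner_map_map, EuclideanSpace.inner_single_left]
  simp

/-- The spherical mean of a radial function. -/
theorem surf_lintegral_radial (x : E3) (hx : x ≠ 0) {τ : ℝ} (hτ : 0 < τ) (f : ℝ → ℝ≥0∞)
    (hf : Measurable f) :
    ∫⁻ ω : S2, f ‖x + τ • (ω : E3)‖ ∂surf = ENNReal.ofReal (2 * Real.pi / (‖x‖ * τ)) *
      ∫⁻ l in Ioo |‖x‖ - τ| (‖x‖ + τ), ENNReal.ofReal l * f l := by
  have hr : 0 < ‖x‖ := norm_pos_iff.2 hx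
  have he : ‖(‖x‖⁻¹ • x)‖ = 1 := by
    rw [norm_smul, norm_inv, norm_norm, inv_mul_cancel₀ hr.ne']
  -- Law of cosines: `‖x + τω‖²` is affine in the cosine of the angle between `x` and `ω`, which is
  -- uniformly distributed. Passing from the square to `l` itself produces the density `l dl`.
  have h1 : ∀ ω : S2, f ‖x + τ • (ω : E3)‖ =
      (fun c => f √(‖x‖ ^ 2 + τ ^ 2 + 2 * ‖x‖ * τ * c)) (inner ℝ (‖x‖⁻¹ • x) (ω : E3)) := by
    intro ω
    have hω : ‖(ω : E3)‖ = 1 := by simp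
    simp only
    congr 1
    rw [← Real.sqrt_sq (norm_nonneg (x + τ • (ω : E3))), norm_add_sq_real, norm_smul, hω,
      inner_smul_right, inner_smul_left, Real.norm_of_nonneg hτ.le]
    congr 1
    simp only [map_inv₀, conj_trivial]
    field_simp
    ring
  have hm : 0 < 2 * ‖x‖ * τ := by positivity
  have h2 := lintegral_affine (fun p => f √p) hm (‖x‖ ^ 2 + τ ^ 2) (-1) 1
  have h3 := lintegral_comp_sq (fun p => f √p) (a := |‖x‖ - τ|) (b := ‖x‖ + τ) (abs_nonneg _)
  rw [abs_of_pos (show 0 < ‖x‖ + τ by positivity), sq_abs] at h3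
  rw [show ‖x‖ ^ 2 + τ ^ 2 + 2 * ‖x‖ * τ * (-1) = (‖x‖ - τ) ^ 2 by ring,
    show ‖x‖ ^ 2 + τ ^ 2 + 2 * ‖x‖ * τ * 1 = (‖x‖ + τ) ^ 2 by ring] at h2
  have h4 := h3
  rw [h2] at h4
  have h5 : ∫⁻ l in Ioo |‖x‖ - τ| (‖x‖ + τ), ENNReal.ofReal (2 * l) * f √(l ^ 2) =
      2 * ∫⁻ l in Ioo |‖x‖ - τ| (‖x‖ + τ), ENNReal.ofReal l * f l := by
    rw [← lintegral_const_mul' _ _ ENNReal.ofNat_ne_top]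
    refine setLIntegral_congr_fun measurableSet_Ioo fun l hl => ?_
    have : 0 ≤ l := (abs_nonneg _).trans hl.1.le
    rw [Real.sqrt_sq this, ENNReal.ofReal_mul zero_le_two, mul_assoc]
    simp
  rw [h5] at h4
  simp only [h1]
  rw [surf_lintegral_inner _ he (fun c => f √(‖x‖ ^ 2 + τ ^ 2 + 2 * ‖x‖ * τ * c))
    (hf.comp (by fun_prop))]
  have h6 : ENNReal.ofReal (2 * Real.pi) = ENNReal.ofReal (2 * Real.pi / (‖x‖ * τ)) *
      (ENNReal.ofReal (2 * ‖x‖ * τ) * ENNReal.ofReal (1 / 2)) := by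
    rw [← ENNReal.ofReal_mul (by positivity), ← ENNReal.ofReal_mul (by positivity)]
    congr 1
    field_simp
  have h7 : ENNReal.ofReal (1 / 2) * 2 = 1 := by
    rw [show (2 : ℝ≥0∞) = ENNReal.ofReal 2 by simp, ← ENNReal.ofReal_mul (by norm_num)]
    norm_num
  calc _ = ENNReal.ofReal (2 * Real.pi / (‖x‖ * τ)) * (ENNReal.ofReal (1 / 2) *
        (ENNReal.ofReal (2 * ‖x‖ * τ) * ∫⁻ c in Ioo (-1) 1,
          f √(‖x‖ ^ 2 + τ ^ 2 + 2 * ‖x‖ * τ * c))) := by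
        rw [h6]; ring
    _ = _ := by
        rw [h4, ← mul_assoc (ENNReal.ofReal (1 / 2)), h7, one_mul]

/-! ### The kernel `|x - y|^{-γ}` against a radial profile. -/

theorem lintegral_Ioi_rpow_neg {q : ℝ} (hq : 1 < q) :
    ∫⁻ u in Ici (1 : ℝ), ENNReal.ofReal (u ^ (-q)) = ENNReal.ofReal (1 / (q - 1)) := by
  rw [Measure.restrict_congr_set Ioi_ae_eq_Ici.symm, ← ofReal_integral_eq_lintegral_ofReal
    (integrableOn_Ioi_rpow_of_lt (by linarith) one_pos), integral_Ioi_rpow_of_lt (by linarith)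
    one_pos]
  · congr 1
    rw [Real.one_rpow, show -q + 1 = -(q - 1) by ring, neg_div_neg_eq]
  · filter_upwards [ae_restrict_mem measurableSet_Ioi] with u hu
    exact Real.rpow_nonneg (zero_le_one.trans (le_of_lt hu)) _

theorem lintegral_Ioc_rpow {a b s : ℝ} (ha : 0 ≤ a) (hab : a ≤ b)
    (h : IntervalIntegrable (fun u : ℝ => u ^ s) volume a b) :
    ∫⁻ u in Ioc a b, ENNReal.ofReal (u ^ s) = ENNReal.ofReal (∫ u in a..b, u ^ s) := by
  rw [← ofReal_integral_eq_lintegral_ofReal h.1, ← intervalIntegral.integral_of_le hab]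
  filter_upwards [ae_restrict_mem measurableSet_Ioc] with u hu
  exact Real.rpow_nonneg (ha.trans hu.1.le) _

theorem lintegral_ball_rpow {γ : ℝ} (hγ : γ < 3) {a : ℝ} (ha : 0 < a) :
    ∫⁻ z in Metric.ball (0 : E3) a, ENNReal.ofReal (‖z‖ ^ (-γ)) ≤
      ENNReal.ofReal (4 * Real.pi * (a ^ (3 - γ) / (3 - γ))) := by
  rw [← lintegral_indicator measurableSet_ball, lintegral_polar _
    (Measurable.indicator (by fun_prop) measurableSet_ball)]
  have h : ∀ ρ ∈ Ioi (0 : ℝ), ENNReal.ofReal (ρ ^ 2) * ∫⁻ ω : S2, (Metric.ball (0 : E3) a).indicator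
      (fun z => ENNReal.ofReal (‖z‖ ^ (-γ))) (ρ • (ω : E3)) ∂surf ≤
      ENNReal.ofReal (4 * Real.pi) *
        (Ioc 0 a).indicator (fun ρ : ℝ => ENNReal.ofReal (ρ ^ (2 - γ))) ρ := by
    intro ρ hρ
    have hρ' : 0 < ρ := hρ
    have h1 : ∀ ω : S2, (Metric.ball (0 : E3) a).indicator
      (fun z => ENNReal.ofReal (‖z‖ ^ (-γ))) (ρ • (ω : E3)) ≤
        (Ioc 0 a).indicator (fun ρ : ℝ => ENNReal.ofReal (ρ ^ (-γ))) ρ := by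
      intro ω
      have hω : ‖ρ • (ω : E3)‖ = ρ := by simp [norm_smul, hρ'.le]
      by_cases ha : ρ < a
      · rw [indicator_of_mem (show ρ ∈ Ioc 0 a from ⟨hρ', ha.le⟩),
          indicator_of_mem (by simpa [hω] using ha), hω]
      · rw [indicator_of_notMem (by simpa [hω] using ha)]
        exact zero_le
    refine (mul_le_mul_right (lintegral_mono h1) _).trans ?_
    rw [lintegral_const, surf_univ, mul_comm, mul_assoc, mul_left_comm]
    refine mul_le_mul_right ?_ _
    by_cases hm : ρ ∈ Ioc 0 a
    · rw [indicator_of_mem hm, indicator_of_mem hm, ← ENNReal.ofReal_mul (by positivity),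
        ← Real.rpow_natCast, ← Real.rpow_add hρ']
      refine le_of_eq ?_
      congr 2
      push_cast; ring
    · rw [indicator_of_notMem hm]; simp
  refine (setLIntegral_mono' measurableSet_Ioi h).trans ?_
  rw [lintegral_const_mul' _ _ ENNReal.ofReal_ne_top]
  refine (mul_le_mul_right (setLIntegral_le_lintegral _ _) _).trans ?_
  rw [lintegral_indicator measurableSet_Ioc, lintegral_Ioc_rpow le_rfl ha.le
    (intervalIntegral.intervalIntegrable_rpow' (by linarith)), integral_rpow (Or.inl (by linarith)),
    Real.zero_rpow (by linarith), ← ENNReal.ofReal_mul (by positivity)]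
  refine ENNReal.ofReal_le_ofReal (le_of_eq ?_)
  rw [sub_zero, show 2 - γ + 1 = 3 - γ by ring]

/-- Within distance one of `x` the singularity is integrable because `γ < 3`; elsewhere the kernel
is at most one and only the volume of the ball counts. Neither bound depends on `x`. -/
theorem lintegral_closedBall_kernel {γ : ℝ} (hγ₀ : 0 < γ) (hγ : γ < 3) (a : ℝ) :
    ∃ C : ℝ, 0 ≤ C ∧ ∀ x : E3, ∫⁻ y in Metric.closedBall (0 : E3) a,
      ENNReal.ofReal (‖x - y‖ ^ (-γ)) ≤ ENNReal.ofReal C := by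
  refine ⟨4 * Real.pi * (1 / (3 - γ)) + volume.real (Metric.closedBall (0 : E3) a),
    by have := sub_pos.2 hγ; positivity, fun x => ?_⟩
  rw [← lintegral_add_compl _ (Metric.isOpen_ball.measurableSet : MeasurableSet (Metric.ball x 1)),
    ENNReal.ofReal_add (by have := sub_pos.2 hγ; positivity) (by positivity)]
  refine add_le_add ?_ ?_
  · rw [Measure.restrict_restrict measurableSet_ball]
    refine (lintegral_mono_set inter_subset_left).trans ?_
    have h := lintegral_ball_rpow hγ one_pos
    rw [Real.one_rpow] at h
    refine le_trans (le_of_eq ?_) h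
    rw [← lintegral_indicator measurableSet_ball, ← lintegral_indicator measurableSet_ball,
      ← lintegral_sub_left_eq_self _ x]
    refine lintegral_congr fun y => ?_
    simp [indicator, dist_eq_norm_sub]
  · have : ∀ y ∈ (Metric.ball x 1)ᶜ, ENNReal.ofReal (‖x - y‖ ^ (-γ)) ≤ 1 := by
      intro y hy
      rw [mem_compl_iff, Metric.mem_ball, dist_comm, dist_eq_norm, not_lt] at hy
      exact ENNReal.ofReal_le_one.2 (Real.rpow_le_one_of_one_le_of_nonpos hy (by linarith))
    refine (setLIntegral_mono' measurableSet_ball.compl this).trans ?_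
    rw [setLIntegral_const, one_mul, Measure.restrict_apply measurableSet_ball.compl,
      ofReal_measureReal (measure_closedBall_lt_top).ne]
    exact measure_mono inter_subset_right

/-- The radial profile `(p - l)⁻²`, cut off at `l ≤ p - 1`. -/
def profile (p l : ℝ) : ℝ≥0∞ :=
  (Iic (p - 1)).indicator (fun l => ENNReal.ofReal ((p - l) ^ (-2 : ℝ))) l

theorem measurable_profile (p : ℝ) : Measurable (profile p) :=
  Measurable.indicator (by fun_prop) measurableSet_Iic

theorem profile_le_one (p l : ℝ) : profile p l ≤ 1 := by
  unfold profile
  by_cases h : l ∈ Iic (p - 1)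
  · rw [indicator_of_mem h]
    have : 1 ≤ p - l := by have := mem_Iic.1 h; linarith
    exact ENNReal.ofReal_le_one.2 (Real.rpow_le_one_of_one_le_of_nonpos this (by norm_num))
  · rw [indicator_of_notMem h]; exact zero_le_one

theorem lintegral_profile (p : ℝ) : ∫⁻ l, profile p l = 1 := by
  rw [← lintegral_sub_left_eq_self _ p]
  have : ∀ l, profile p (p - l) = (Ici (1 : ℝ)).indicator
      (fun u => ENNReal.ofReal (u ^ (-2 : ℝ))) l := by
    intro l
    have : p - l ∈ Iic (p - 1) ↔ l ∈ Ici (1 : ℝ) := by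
      rw [mem_Iic, mem_Ici]; constructor <;> intro h <;> linarith
    by_cases h : l ∈ Ici (1 : ℝ)
    · rw [profile, indicator_of_mem (this.2 h), indicator_of_mem h, sub_sub_cancel]
    · rw [profile, indicator_of_notMem (mt this.1 h), indicator_of_notMem h]
  simp only [this]
  rw [lintegral_indicator measurableSet_Ici, lintegral_Ioi_rpow_neg (by norm_num)]
  norm_num

/-- The profile has total mass one and lives on `l ≤ p - 1`, so each factor `l` may be replaced by
`p`. -/
theorem lintegral_mul_profile_le (p : ℝ) {k : ℕ} :
    ∫⁻ l in Ioi (0 : ℝ), ENNReal.ofReal (l ^ k) * profile p l ≤ ENNReal.ofReal (p ^ k) := by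
  calc _ ≤ ∫⁻ l in Ioi (0 : ℝ), ENNReal.ofReal (p ^ k) * profile p l := by
        refine setLIntegral_mono' measurableSet_Ioi fun l hl => ?_
        have hl' : 0 < l := hl
        by_cases h : l ∈ Iic (p - 1)
        · have : l ≤ p := by have := mem_Iic.1 h; linarith
          gcongr
        · simp [profile, h]
    _ ≤ ENNReal.ofReal (p ^ k) * ∫⁻ l, profile p l := by
        rw [lintegral_const_mul' _ _ ENNReal.ofReal_ne_top]
        exact mul_le_mul_right (setLIntegral_le_lintegral _ _) _
    _ = _ := by rw [lintegral_profile, mul_one]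

theorem lintegral_profile_norm_le (p : ℝ) :
    ∫⁻ y : E3, profile p ‖y‖ ≤ ENNReal.ofReal (4 * Real.pi * p ^ 2) := by
  rw [lintegral_polar (fun y => profile p ‖y‖) ((measurable_profile p).comp measurable_norm)]
  have : ∀ ρ ∈ Ioi (0 : ℝ), ENNReal.ofReal (ρ ^ 2) * ∫⁻ ω : S2, profile p ‖ρ • (ω : E3)‖ ∂surf =
      ENNReal.ofReal (4 * Real.pi) * (ENNReal.ofReal (ρ ^ 2) * profile p ρ) := by
    intro ρ hρ
    have hρ' : 0 < ρ := hρ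
    have hω : ∀ ω : S2, ‖ρ • (ω : E3)‖ = ρ := fun ω => by simp [norm_smul, hρ'.le]
    simp only [hω, lintegral_const, surf_univ]
    ring
  rw [setLIntegral_congr_fun measurableSet_Ioi this, lintegral_const_mul' _ _ ENNReal.ofReal_ne_top,
    ENNReal.ofReal_mul (q := p ^ 2) (by positivity)]
  exact mul_le_mul_right (lintegral_mul_profile_le p) _

/-- Leaving the integral unevaluated treats `γ < 2`, `γ = 2` and `γ > 2` at once: for `γ > 0` it
shows that `p^(2-γ)` is at most twice one plus the integral. -/
theorem rpow_two_sub_eq (γ : ℝ) {p : ℝ} (hp : 1 ≤ p) :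
    p ^ (2 - γ) = 1 + (2 - γ) * ∫ s in (1 : ℝ)..p, s ^ (1 - γ) := by
  by_cases h : γ = 2
  · simp [h]
  · have h2 : 2 - γ ≠ 0 := fun h' => h (by linarith)
    rw [integral_rpow (Or.inr ⟨fun h' => h (by linarith), by
      rw [uIcc_of_le hp]; exact fun h' => by linarith [h'.1]⟩), Real.one_rpow,
      show 1 - γ + 1 = 2 - γ by ring]
    field_simp
    ring

theorem intervalIntegrable_rpow_one (s : ℝ) {p : ℝ} (hp : 1 ≤ p) :
    IntervalIntegrable (fun u : ℝ => u ^ s) volume 1 p :=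
  intervalIntegral.intervalIntegrable_rpow (Or.inr (by
      rw [uIcc_of_le hp]; exact fun h' => by linarith [h'.1]))

theorem integral_rpow_one_nonneg (s : ℝ) {p : ℝ} (hp : 1 ≤ p) :
    0 ≤ ∫ u in (1 : ℝ)..p, u ^ s :=
  intervalIntegral.integral_nonneg hp fun u hu => Real.rpow_nonneg (by linarith [hu.1]) _

/-- On spheres of radius `ρ ≤ 1` the bound `profile ≤ 1` suffices. On larger ones the mean formula
gives `2π / (‖x‖ ρ)` times the first moment of the profile, hence at most `8π / ρ` since the moment
is at most `p` and `‖x‖ ≥ p / 4`. This loses one power in `ρ² ρ^(-γ)`, which explains the exponent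
`1 - γ`. -/
theorem near_kernel_bound {γ : ℝ} (hγ : γ < 3) {p : ℝ} (hp : 2 ≤ p) (x : E3)
    (hx : p / 4 ≤ ‖x‖) :
    ∫⁻ z in Metric.ball (0 : E3) (p / 4), ENNReal.ofReal (‖z‖ ^ (-γ)) * profile p ‖x + z‖ ≤
      ENNReal.ofReal (4 * Real.pi / (3 - γ) + 8 * Real.pi * ∫ s in (1 : ℝ)..p, s ^ (1 - γ)) := by
  have hp0 : 0 < p := by linarith
  have hx0 : x ≠ 0 := norm_pos_iff.1 (by linarith)
  have hmp := measurable_profile p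
  rw [← lintegral_indicator measurableSet_ball, lintegral_polar _ (Measurable.indicator
    (by fun_prop) measurableSet_ball)]
  have h : ∀ ρ ∈ Ioi (0 : ℝ), ENNReal.ofReal (ρ ^ 2) * ∫⁻ ω : S2,
      (Metric.ball (0 : E3) (p / 4)).indicator
      (fun z => ENNReal.ofReal (‖z‖ ^ (-γ)) * profile p ‖x + z‖) (ρ • (ω : E3)) ∂surf ≤
      ENNReal.ofReal (4 * Real.pi) *
        (Ioc 0 1).indicator (fun ρ : ℝ => ENNReal.ofReal (ρ ^ (2 - γ))) ρ +
      ENNReal.ofReal (8 * Real.pi) *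
        (Ioc 1 p).indicator (fun ρ : ℝ => ENNReal.ofReal (ρ ^ (1 - γ))) ρ := by
    intro ρ hρ
    have hρ' : 0 < ρ := hρ
    have hω : ∀ ω : S2, ‖ρ • (ω : E3)‖ = ρ := fun ω => by simp [norm_smul, hρ'.le]
    by_cases hρp : ρ < p / 4
    swap
    · have : ∀ ω : S2, (Metric.ball (0 : E3) (p / 4)).indicator
          (fun z => ENNReal.ofReal (‖z‖ ^ (-γ)) * profile p ‖x + z‖) (ρ • (ω : E3)) = 0 := by
        intro ω
        rw [indicator_of_notMem (by simpa [hω] using hρp)]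
      simp [this]
    have h1 : ∀ ω : S2, (Metric.ball (0 : E3) (p / 4)).indicator
          (fun z => ENNReal.ofReal (‖z‖ ^ (-γ)) * profile p ‖x + z‖) (ρ • (ω : E3)) =
        ENNReal.ofReal (ρ ^ (-γ)) * profile p ‖x + ρ • (ω : E3)‖ := by
      intro ω
      rw [indicator_of_mem (by simpa [hω] using hρp), hω]
    simp only [h1]
    rw [lintegral_const_mul' _ _ ENNReal.ofReal_ne_top, ← mul_assoc,
      ← ENNReal.ofReal_mul (by positivity)]
    by_cases hρ1 : ρ ≤ 1
    · refine le_trans ?_ le_self_add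
      rw [indicator_of_mem (show ρ ∈ Ioc (0 : ℝ) 1 from ⟨hρ', hρ1⟩), mul_comm]
      refine mul_le_mul' ?_ (le_of_eq ?_)
      · refine (lintegral_mono fun ω => profile_le_one _ _).trans ?_
        rw [lintegral_const, surf_univ, one_mul]
      · rw [← Real.rpow_natCast, ← Real.rpow_add hρ']
        congr 2
    · push Not at hρ1
      refine le_trans ?_ le_add_self
      rw [indicator_of_mem (show ρ ∈ Ioc (1 : ℝ) p from ⟨hρ1, by linarith⟩),
        surf_lintegral_radial x hx0 hρ' _ hmp, ← mul_assoc, ← ENNReal.ofReal_mul (by positivity)]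
      have h2 : ∫⁻ l in Ioo |‖x‖ - ρ| (‖x‖ + ρ), ENNReal.ofReal l * profile p l ≤
          ENNReal.ofReal p := by
        refine (lintegral_mono_set (t := Ioi 0) fun l hl => (abs_nonneg _).trans_lt hl.1).trans ?_
        have := lintegral_mul_profile_le p (k := 1)
        simpa using this
      refine (mul_le_mul_right h2 _).trans ?_
      rw [← ENNReal.ofReal_mul (by positivity), ← ENNReal.ofReal_mul (by positivity)]
      refine ENNReal.ofReal_le_ofReal ?_
      have h3 : ρ ^ 2 * ρ ^ (-γ) = ρ * ρ ^ (1 - γ) := by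
        rw [← Real.rpow_natCast, ← Real.rpow_add hρ']
        nth_rewrite 2 [← Real.rpow_one ρ]
        rw [← Real.rpow_add hρ']
        congr 1; push_cast; ring
      have h4 : 0 ≤ ρ ^ (1 - γ) := Real.rpow_nonneg hρ'.le _
      have hx1 : 0 < ‖x‖ := by linarith
      have h5 : ρ ^ 2 * ρ ^ (-γ) * (2 * Real.pi / (‖x‖ * ρ)) * p =
          2 * Real.pi * ρ ^ (1 - γ) * (p / ‖x‖) := by
        rw [h3]; field_simp
      have h6 : p / ‖x‖ ≤ 4 := by rw [div_le_iff₀ hx1]; linarith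
      rw [h5]
      calc _ ≤ 2 * Real.pi * ρ ^ (1 - γ) * 4 := by gcongr
        _ = _ := by ring
  refine (setLIntegral_mono' measurableSet_Ioi h).trans ?_
  refine (setLIntegral_le_lintegral _ _).trans ?_
  have hI := integral_rpow_one_nonneg (1 - γ) (show 1 ≤ p by linarith)
  have h3 : 0 < 3 - γ := by linarith
  rw [lintegral_add_left (by
      exact (Measurable.indicator (by fun_prop) measurableSet_Ioc).const_mul _),
    lintegral_const_mul' _ _ ENNReal.ofReal_ne_top, lintegral_const_mul' _ _ ENNReal.ofReal_ne_top,
    lintegral_indicator measurableSet_Ioc, lintegral_indicator measurableSet_Ioc,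
    lintegral_Ioc_rpow le_rfl zero_le_one (intervalIntegral.intervalIntegrable_rpow' (by linarith)),
    lintegral_Ioc_rpow zero_le_one (by linarith) (intervalIntegrable_rpow_one _ (by linarith)),
    integral_rpow (Or.inl (by linarith)), Real.zero_rpow (by linarith), Real.one_rpow,
    ← ENNReal.ofReal_mul (by positivity), ← ENNReal.ofReal_mul (by positivity),
    ← ENNReal.ofReal_add (by
      rw [show 2 - γ + 1 = 3 - γ by ring, sub_zero]
      positivity) (by positivity)]
  refine ENNReal.ofReal_le_ofReal (le_of_eq ?_)
  rw [show 2 - γ + 1 = 3 - γ by ring]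
  ring

/-- Split at distance `p / 4` from `x`. Far away the kernel is at most `(p / 4)^(-γ)`, and the
profile has mass `O(p²)` in space. Near `x`, either `‖x‖ ≥ p / 4` and `near_kernel_bound` applies,
or the points stay within `p / 2` of the origin, where the profile is at most `(p / 2)^(-2)`. The
powers `p^(2-γ)` that arise are absorbed by `rpow_two_sub_eq`. -/
theorem kernel_bound {γ : ℝ} (hγ₀ : 0 < γ) (hγ : γ < 3) :
    ∃ C : ℝ, 0 < C ∧ ∀ p : ℝ, 2 ≤ p → ∀ x : E3,
      ∫⁻ y : E3, ENNReal.ofReal (‖x - y‖ ^ (-γ)) * profile p ‖y‖ ≤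
        ENNReal.ofReal (C * (1 + ∫ s in (1 : ℝ)..p, s ^ (1 - γ))) := by
  have h3 : 0 < 3 - γ := by linarith
  refine ⟨4 ^ γ * (4 * Real.pi) * 2 + (16 * Real.pi / (3 - γ) * 2 + (4 * Real.pi / (3 - γ) +
    8 * Real.pi)), by positivity, fun p hp x => ?_⟩
  have hp0 : 0 < p := by linarith
  have hI := integral_rpow_one_nonneg (1 - γ) (show 1 ≤ p by linarith)
  have hpI := rpow_two_sub_eq γ (show 1 ≤ p by linarith)
  set I := ∫ s in (1 : ℝ)..p, s ^ (1 - γ)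
  have hpI' : p ^ (2 - γ) ≤ 2 * (1 + I) := by rw [hpI]; nlinarith
  have hmp := measurable_profile p
  have hm : Measurable fun z : E3 => ENNReal.ofReal (‖z‖ ^ (-γ)) * profile p ‖x + z‖ := by
    fun_prop
  have hshift : ∫⁻ y : E3, ENNReal.ofReal (‖x - y‖ ^ (-γ)) * profile p ‖y‖ =
      ∫⁻ z : E3, ENNReal.ofReal (‖z‖ ^ (-γ)) * profile p ‖x + z‖ := by
    rw [← lintegral_add_left_eq_self _ x]
    refine lintegral_congr fun z => ?_
    rw [sub_add_cancel_left, norm_neg]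
  have hfar : ∫⁻ z in (Metric.ball (0 : E3) (p / 4))ᶜ,
      ENNReal.ofReal (‖z‖ ^ (-γ)) * profile p ‖x + z‖ ≤
      ENNReal.ofReal (4 ^ γ * (4 * Real.pi) * p ^ (2 - γ)) := by
    calc _ ≤ ∫⁻ z in (Metric.ball (0 : E3) (p / 4))ᶜ,
          ENNReal.ofReal ((p / 4) ^ (-γ)) * profile p ‖x + z‖ := by
          refine setLIntegral_mono' measurableSet_ball.compl fun z hz => ?_
          have hz' : p / 4 ≤ ‖z‖ := by simpa using hz
          refine mul_le_mul_left (ENNReal.ofReal_le_ofReal ?_) _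
          exact Real.rpow_le_rpow_of_nonpos (by positivity) hz' (by linarith)
      _ ≤ ENNReal.ofReal ((p / 4) ^ (-γ)) * ∫⁻ z, profile p ‖x + z‖ := by
          rw [lintegral_const_mul' _ _ ENNReal.ofReal_ne_top]
          exact mul_le_mul_right (setLIntegral_le_lintegral _ _) _
      _ ≤ ENNReal.ofReal ((p / 4) ^ (-γ)) * ENNReal.ofReal (4 * Real.pi * p ^ 2) := by
          rw [lintegral_add_left_eq_self (fun z => profile p ‖z‖) x]
          exact mul_le_mul_right (lintegral_profile_norm_le p) _
      _ = _ := by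
          rw [← ENNReal.ofReal_mul (by positivity), Real.div_rpow hp0.le (by norm_num),
            Real.rpow_neg (by norm_num : (0 : ℝ) ≤ 4), div_inv_eq_mul]
          congr 1
          rw [show (2 - γ) = -γ + (2 : ℕ) by push_cast; ring, Real.rpow_add hp0, Real.rpow_natCast]
          ring
  have hnear : ∫⁻ z in Metric.ball (0 : E3) (p / 4),
      ENNReal.ofReal (‖z‖ ^ (-γ)) * profile p ‖x + z‖ ≤
      ENNReal.ofReal (16 * Real.pi / (3 - γ) * p ^ (2 - γ) +
        (4 * Real.pi / (3 - γ) + 8 * Real.pi * I)) := by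
    rcases le_or_gt (p / 4) ‖x‖ with hx | hx
    · refine (near_kernel_bound hγ hp x hx).trans (ENNReal.ofReal_le_ofReal ?_)
      have : 0 ≤ 16 * Real.pi / (3 - γ) * p ^ (2 - γ) := by positivity
      linarith
    · calc _ ≤ ∫⁻ z in Metric.ball (0 : E3) (p / 4),
            ENNReal.ofReal (‖z‖ ^ (-γ)) * ENNReal.ofReal ((p / 2) ^ (-2 : ℝ)) := by
            refine setLIntegral_mono' measurableSet_ball fun z hz => ?_
            have hz' : ‖z‖ < p / 4 := by simpa using hz
            refine mul_le_mul_right ?_ _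
            have hxz : ‖x + z‖ ≤ p / 2 := (norm_add_le x z).trans (by linarith)
            unfold profile
            by_cases h : ‖x + z‖ ∈ Iic (p - 1)
            · rw [indicator_of_mem h]
              exact ENNReal.ofReal_le_ofReal (Real.rpow_le_rpow_of_nonpos (by positivity)
                (by linarith) (by norm_num))
            · rw [indicator_of_notMem h]; exact zero_le
        _ ≤ ENNReal.ofReal (4 * Real.pi * ((p / 4) ^ (3 - γ) / (3 - γ))) *
            ENNReal.ofReal ((p / 2) ^ (-2 : ℝ)) := by
            rw [lintegral_mul_const' _ _ ENNReal.ofReal_ne_top]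
            exact mul_le_mul_left (lintegral_ball_rpow hγ (by positivity)) _
        _ ≤ _ := by
            rw [← ENNReal.ofReal_mul (by positivity)]
            refine ENNReal.ofReal_le_ofReal ?_
            have h1 : (p / 4) ^ (3 - γ) ≤ p ^ (3 - γ) :=
              Real.rpow_le_rpow (by positivity) (by linarith) h3.le
            have h2 : p ^ (3 - γ) = p * p ^ (2 - γ) := by
              rw [show 3 - γ = 1 + (2 - γ) by ring, Real.rpow_add hp0, Real.rpow_one]
            have h5 : (p / 2) ^ (-2 : ℝ) = 4 / p ^ 2 := by
              rw [Real.rpow_neg (by positivity), Real.rpow_ofNat]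
              field_simp
              norm_num
            have h6 : 4 * Real.pi * ((p / 4) ^ (3 - γ) / (3 - γ)) * (p / 2) ^ (-2 : ℝ) ≤
                4 * Real.pi * (p * p ^ (2 - γ) / (3 - γ)) * (4 / p ^ 2) := by
              rw [h5, ← h2]
              gcongr
            refine h6.trans ?_
            have h7 : 4 * Real.pi * (p * p ^ (2 - γ) / (3 - γ)) * (4 / p ^ 2) =
                16 * Real.pi / (3 - γ) * p ^ (2 - γ) * (1 / p) := by
              field_simp; ring
            have h8 : 1 / p ≤ 1 := by rw [div_le_one hp0]; linarith
            have h9 : 0 ≤ 16 * Real.pi / (3 - γ) * p ^ (2 - γ) := by positivity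
            rw [h7]
            have h10 : 0 ≤ 4 * Real.pi / (3 - γ) + 8 * Real.pi * I := by positivity
            nlinarith
  rw [hshift, ← lintegral_add_compl _ (measurableSet_ball (x := (0 : E3)) (ε := p / 4))]
  refine (add_le_add hnear hfar).trans ?_
  rw [← ENNReal.ofReal_add (by positivity) (by positivity)]
  refine ENNReal.ofReal_le_ofReal ?_
  have e1 : 4 ^ γ * (4 * Real.pi) * p ^ (2 - γ) ≤ 4 ^ γ * (4 * Real.pi) * (2 * (1 + I)) := by
    gcongr
  have e2 : 16 * Real.pi / (3 - γ) * p ^ (2 - γ) ≤ 16 * Real.pi / (3 - γ) * (2 * (1 + I)) := by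
    gcongr
  have e3 : 0 ≤ 4 * Real.pi / (3 - γ) * I := by positivity
  nlinarith [Real.pi_pos]

/-! ### Convergence, bounds and continuity of the convolution. -/

theorem integrable_kernel_closedBall {γ : ℝ} (hγ₀ : 0 < γ) (hγ : γ < 3) (a : ℝ) (x : E3) :
    IntegrableOn (fun y : E3 => ‖x - y‖ ^ (-γ)) (Metric.closedBall 0 a) := by
  obtain ⟨C, -, hC⟩ := lintegral_closedBall_kernel hγ₀ hγ a
  refine ⟨Measurable.aestronglyMeasurable (by fun_prop), ?_⟩
  rw [HasFiniteIntegral]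
  refine lt_of_le_of_lt (le_of_eq ?_) ((hC x).trans_lt ENNReal.ofReal_lt_top)
  refine lintegral_congr fun y => ?_
  rw [Real.enorm_of_nonneg (Real.rpow_nonneg (norm_nonneg _) _)]

/-- `∫_{|y| ≤ a} |x - y|^{-γ} dy` is bounded uniformly in `x`. -/
theorem exists_bound_kernel {γ : ℝ} (hγ₀ : 0 < γ) (hγ : γ < 3) (a : ℝ) :
    ∃ C : ℝ, 0 ≤ C ∧ ∀ x : E3, ∫ y in Metric.closedBall (0 : E3) a, ‖x - y‖ ^ (-γ) ≤ C := by
  obtain ⟨C, hC0, hC⟩ := lintegral_closedBall_kernel hγ₀ hγ a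
  refine ⟨C, hC0, fun x => ?_⟩
  rw [integral_eq_lintegral_of_nonneg_ae
    (.of_forall fun y => Real.rpow_nonneg (norm_nonneg _) _)
    (Measurable.aestronglyMeasurable (by fun_prop))]
  exact ENNReal.toReal_le_of_le_ofReal hC0 (hC x)

theorem integrable_conv {γ : ℝ} (hγ₀ : 0 < γ) (hγ : γ < 3) {f : E3 → ℝ} (hf : Continuous f)
    {a : ℝ} (hs : ∀ y, f y ≠ 0 → ‖y‖ ≤ a) (x : E3) :
    Integrable fun y : E3 => ‖x - y‖ ^ (-γ) * f y := by
  obtain ⟨M, hM⟩ := (isCompact_closedBall (0 : E3) a).exists_bound_of_continuousOn hf.continuousOn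
  have h : IntegrableOn (fun y : E3 => ‖x - y‖ ^ (-γ) * f y) (Metric.closedBall 0 a) :=
    (integrable_kernel_closedBall hγ₀ hγ a x).mul_bdd (c := M) hf.aestronglyMeasurable
      (by filter_upwards [ae_restrict_mem Metric.isClosed_closedBall.measurableSet] with y hy
          using hM y hy)
  refine (integrableOn_iff_integrable_of_support_subset fun y hy => ?_).1 h
  have : f y ≠ 0 := fun h => hy (by simp [h])
  simpa using hs y this

/-- If `|f| ≤ B` is supported in the ball of radius `a`, its convolution with `|x|^{-γ}` is at
most `C B`. -/
theorem abs_integral_kernel_le {γ : ℝ} (hγ₀ : 0 < γ) (hγ : γ < 3) (a : ℝ) :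
    ∃ C : ℝ, 0 ≤ C ∧ ∀ (f : E3 → ℝ) (B : ℝ), 0 ≤ B → (∀ y, f y ≠ 0 → ‖y‖ ≤ a) →
      (∀ y, |f y| ≤ B) → ∀ x, |∫ y : E3, ‖x - y‖ ^ (-γ) * f y| ≤ C * B := by
  obtain ⟨C, hC0, hC⟩ := exists_bound_kernel hγ₀ hγ a
  refine ⟨C, hC0, fun f B hB hs hf x => ?_⟩
  have h0 : ∀ y, 0 ≤ ‖x - y‖ ^ (-γ) := fun y => Real.rpow_nonneg (norm_nonneg _) _
  have h1 : |∫ y : E3, ‖x - y‖ ^ (-γ) * f y| ≤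
      ∫ y : E3, (Metric.closedBall (0 : E3) a).indicator (fun y => ‖x - y‖ ^ (-γ) * B) y := by
    rw [← Real.norm_eq_abs]
    refine norm_integral_le_of_norm_le ?_ (.of_forall fun y => ?_)
    · exact (integrable_indicator_iff Metric.isClosed_closedBall.measurableSet).2
        ((integrable_kernel_closedBall hγ₀ hγ a x).mul_const B)
    · by_cases hy : f y = 0
      · simp only [hy, mul_zero, norm_zero]
        exact indicator_nonneg (fun y _ => mul_nonneg (h0 y) hB) _
      · rw [indicator_of_mem (by simpa using hs y hy), norm_mul, Real.norm_of_nonneg (h0 y)]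
        exact mul_le_mul_of_nonneg_left (hf y) (h0 y)
  refine h1.trans ?_
  rw [integral_indicator Metric.isClosed_closedBall.measurableSet, integral_mul_const]
  exact mul_le_mul_of_nonneg_right (hC x) hB

theorem continuous_conv {γ : ℝ} (hγ₀ : 0 < γ) (hγ : γ < 3) {u : E3 → ℝ → ℝ} {ρ : ℝ → ℝ}
    (hu : Continuous fun z : E3 × ℝ => u z.1 z.2) (hρ : Continuous ρ)
    (hs : ∀ y t, u y t ≠ 0 → ‖y‖ ≤ ρ t) :
    Continuous fun z : E3 × ℝ => conv γ u z.1 z.2 := by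
  rw [continuous_iff_continuousAt]
  rintro ⟨x₀, t₀⟩
  -- After this translation the singularity sits at the origin for every `z`, so a single multiple
  -- of `‖y‖^(-γ)` on a fixed ball dominates all integrands near `(x₀, t₀)`.
  have h1 : ∀ z : E3 × ℝ, conv γ u z.1 z.2 = ∫ y : E3, ‖y‖ ^ (-γ) * u (z.1 - y) z.2 ^ 2 := by
    intro z
    rw [conv, ← integral_sub_left_eq_self _ _ z.1]
    simp
  simp only [h1]
  set A := ρ t₀ + 1
  obtain ⟨M, hM⟩ := ((isCompact_closedBall (0 : E3) A).prod
    (isCompact_Icc (a := t₀ - 1) (b := t₀ + 1))).exists_bound_of_continuousOn hu.continuousOn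
  have hnear : ∀ᶠ z : E3 × ℝ in 𝓝 (x₀, t₀), ‖z.1‖ < ‖x₀‖ + 1 ∧ ρ z.2 < A ∧
      t₀ - 1 < z.2 ∧ z.2 < t₀ + 1 := by
    have c1 : Continuous fun z : E3 × ℝ => ‖z.1‖ := by fun_prop
    have c2 : Continuous fun z : E3 × ℝ => ρ z.2 := by fun_prop
    have c3 : Continuous fun z : E3 × ℝ => z.2 := by fun_prop
    filter_upwards [c1.continuousAt.eventually_lt_const (show ‖x₀‖ < ‖x₀‖ + 1 by linarith),
      c2.continuousAt.eventually_lt_const (show ρ t₀ < A by simp [A]),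
      c3.continuousAt.eventually_const_lt (show t₀ - 1 < t₀ by linarith),
      c3.continuousAt.eventually_lt_const (show t₀ < t₀ + 1 by linarith)] with z a b c d
    exact ⟨a, b, c, d⟩
  refine continuousAt_of_dominated (bound := fun y =>
    (Metric.closedBall (0 : E3) (‖x₀‖ + 1 + A)).indicator (fun y => ‖y‖ ^ (-γ) * M ^ 2) y)
    ?_ ?_ ?_ ?_
  · refine .of_forall fun z => Measurable.aestronglyMeasurable ?_
    have : Continuous fun y => u (z.1 - y) z.2 := hu.comp (by fun_prop : Continuous fun y : E3 =>
      ((z.1 - y, z.2) : E3 × ℝ))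
    exact Measurable.mul (by fun_prop) (this.measurable.pow_const 2)
  · filter_upwards [hnear] with z hz
    refine .of_forall fun y => ?_
    have h0 : 0 ≤ ‖y‖ ^ (-γ) := Real.rpow_nonneg (norm_nonneg _) _
    by_cases hy : u (z.1 - y) z.2 = 0
    · simp only [hy, ne_eq, OfNat.ofNat_ne_zero, not_false_eq_true, zero_pow, mul_zero, norm_zero]
      exact indicator_nonneg (fun y _ => mul_nonneg (Real.rpow_nonneg (norm_nonneg _) _)
        (sq_nonneg M)) _
    · have hzy := (hs _ _ hy).trans hz.2.1.le
      have hyn : ‖y‖ ≤ ‖x₀‖ + 1 + A := by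
        have : ‖y‖ ≤ ‖z.1‖ + ‖z.1 - y‖ := by
          rw [← norm_neg (z.1 - y), neg_sub]
          exact (norm_le_norm_add_norm_sub' y z.1)
        linarith [hz.1]
      rw [indicator_of_mem (by simpa using hyn), norm_mul, Real.norm_of_nonneg h0, norm_pow]
      refine mul_le_mul_of_nonneg_left ?_ h0
      have := hM (z.1 - y, z.2) ⟨by simpa using hzy, hz.2.2.1.le, hz.2.2.2.le⟩
      gcongr
  · have := integrable_kernel_closedBall hγ₀ hγ (‖x₀‖ + 1 + A) 0
    simp only [zero_sub, norm_neg] at this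
    exact (integrable_indicator_iff Metric.isClosed_closedBall.measurableSet).2
      (this.mul_const (M ^ 2))
  · refine .of_forall fun y => Continuous.continuousAt ?_
    have : Continuous fun z : E3 × ℝ => u (z.1 - y) z.2 :=
      hu.comp (by fun_prop : Continuous fun z : E3 × ℝ => ((z.1 - y, z.2) : E3 × ℝ))
    fun_prop

theorem conv_nonneg (γ : ℝ) (u : E3 → ℝ → ℝ) (x : E3) (t : ℝ) : 0 ≤ conv γ u x t :=
  integral_nonneg fun _ => mul_nonneg (Real.rpow_nonneg (norm_nonneg _) _) (sq_nonneg _)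

/-! ### The solution operator and the Duhamel integral. -/

/-- The solution operator of the free wave equation as an odd function of time. -/
def S (φ : E3 → ℝ) (x : E3) (τ : ℝ) : ℝ :=
  τ / (4 * Real.pi) * ∫ ω : S2, φ (x + τ • (ω : E3)) ∂surf

theorem W_eq_S (φ : E3 → ℝ) (x : E3) (t : ℝ) : W φ x t = S φ x |t| := rfl

theorem continuous_sphereMean {X : Type*} [TopologicalSpace X] [FirstCountableTopology X]
    [LocallyCompactSpace X] {f : X → E3 → ℝ} (hf : Continuous (Function.uncurry f)) :
    Continuous fun z => ∫ ω : S2, f z ω ∂surf := by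
  have h : Continuous (Function.uncurry fun (z : X) (ω : S2) => f z ω) :=
    hf.comp (by fun_prop : Continuous fun p : X × S2 => (p.1, (p.2 : E3)))
  have := continuous_parametric_integral_of_continuous (μ := surf) h (isCompact_univ)
  simpa using this

theorem continuous_S {X : Type*} [TopologicalSpace X] [FirstCountableTopology X]
    [LocallyCompactSpace X] {G : X → E3 → ℝ} (hG : Continuous (Function.uncurry G)) {x : X → E3}
    {τ : X → ℝ} (hx : Continuous x) (hτ : Continuous τ) :
    Continuous fun z => S (G z) (x z) (τ z) := by
  unfold S
  have : Continuous fun z => ∫ ω : S2, G z (x z + τ z • (ω : E3)) ∂surf :=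
    continuous_sphereMean (f := fun z y => G z (x z + τ z • y))
      (hG.comp (by fun_prop : Continuous fun p : X × E3 => (p.1, x p.1 + τ p.1 • p.2)))
  fun_prop

theorem integrable_sphere {f : E3 → ℝ} (hf : Continuous f) :
    Integrable (fun ω : S2 => f ω) surf :=
  (hf.comp continuous_subtype_val).integrable_of_hasCompactSupport
    (HasCompactSupport.of_compactSpace _)

theorem S_sub {φ ψ : E3 → ℝ} (hφ : Continuous φ) (hψ : Continuous ψ) (x : E3) (τ : ℝ) :
    S (fun y => φ y - ψ y) x τ = S φ x τ - S ψ x τ := by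
  unfold S
  rw [integral_sub (integrable_sphere (f := fun y => φ (x + τ • y)) (by fun_prop))
    (integrable_sphere (f := fun y => ψ (x + τ • y)) (by fun_prop))]
  ring

theorem abs_S_le {φ : E3 → ℝ} {x : E3} {τ B : ℝ}
    (h : ∀ ω : S2, |φ (x + τ • (ω : E3))| ≤ B) : |S φ x τ| ≤ |τ| * B := by
  have h1 : ‖∫ ω : S2, φ (x + τ • (ω : E3)) ∂surf‖ ≤ B * surf.real univ :=
    norm_integral_le_of_norm_le_const (.of_forall h)
  rw [surf_real_univ, Real.norm_eq_abs] at h1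
  rw [S, abs_mul, abs_div, abs_of_pos (show 0 < 4 * Real.pi by positivity)]
  calc _ ≤ |τ| / (4 * Real.pi) * (B * (4 * Real.pi)) := by gcongr
    _ = _ := by field_simp

theorem S_eq_zero {φ : E3 → ℝ} {x : E3} {τ : ℝ}
    (h : ∀ ω : S2, φ (x + τ • (ω : E3)) = 0) : S φ x τ = 0 := by
  simp [S, h]

/-- The Duhamel integral with an odd kernel. -/
theorem duhamel_eq {F G : E3 → ℝ → ℝ} {x : E3} {t : ℝ} (ht : 0 ≤ t)
    (h : ∀ y, ∀ s ∈ Icc 0 t, G y s = F y s / (1 + s) ^ 2) :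
    duhamel F x t = ∫ s in (0 : ℝ)..t, S (fun y => G y s) x (t - s) := by
  refine intervalIntegral.integral_congr fun s hs => ?_
  rw [uIcc_of_le ht] at hs
  rw [W_eq_S, abs_of_nonneg (by linarith [hs.2])]
  congr 1
  funext y
  rw [h y s hs]

theorem continuous_oddDuhamel {G : E3 → ℝ → ℝ} (hG : Continuous fun z : E3 × ℝ => G z.1 z.2) :
    Continuous fun z : E3 × ℝ => ∫ s in (0 : ℝ)..z.2, S (fun y => G y s) z.1 (z.2 - s) := by
  refine intervalIntegral.continuous_parametric_intervalIntegral_of_continuous ?_ continuous_snd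
  exact continuous_S (X := (E3 × ℝ) × ℝ) (G := fun p y => G y p.2)
    (hG.comp (by fun_prop : Continuous fun p : ((E3 × ℝ) × ℝ) × E3 => (p.2, p.1.2)))
    (by fun_prop) (by fun_prop)

theorem intervalIntegrable_oddDuhamel {G : E3 → ℝ → ℝ}
    (hG : Continuous fun z : E3 × ℝ => G z.1 z.2) (x : E3) (t a b : ℝ) :
    IntervalIntegrable (fun s => S (fun y => G y s) x (t - s)) volume a b := by
  refine Continuous.intervalIntegrable ?_ _ _
  exact continuous_S (X := ℝ) (G := fun s y => G y s)
    (hG.comp (by fun_prop : Continuous fun p : ℝ × E3 => (p.2, p.1)))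
    (by fun_prop) (by fun_prop)

/-- A majorant that is radial in `y` turns each spherical mean into a one-dimensional integral. The
majorant is needed only where `t - ‖x‖ ≤ s + ‖y‖`, which holds on the backward cone because its
points satisfy `‖y - x‖ = t - s`. -/
theorem enorm_duhamel_le {F : E3 → ℝ → ℝ} {x : E3} (hx : x ≠ 0) {t : ℝ} (ht : 0 ≤ t)
    (K : ℝ → ℝ → ℝ≥0∞) (hK : ∀ s, Measurable fun l => K l s)
    (h : ∀ y, ∀ s, 0 ≤ s → s ≤ t → t - ‖x‖ ≤ s + ‖y‖ →
      ‖F y s / (1 + s) ^ 2‖ₑ ≤ K ‖y‖ s) :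
    ‖duhamel F x t‖ₑ ≤ ENNReal.ofReal (1 / (2 * ‖x‖)) * ∫⁻ s in Ioo 0 t,
      ∫⁻ l in Ioo |‖x‖ - (t - s)| (‖x‖ + (t - s)), ENNReal.ofReal l * K l s := by
  have hr : 0 < ‖x‖ := norm_pos_iff.2 hx
  unfold duhamel
  rw [intervalIntegral.integral_of_le ht, ← lintegral_const_mul' _ _ ENNReal.ofReal_ne_top,
    ← Measure.restrict_congr_set Ioo_ae_eq_Ioc]
  refine (enorm_integral_le_lintegral_enorm _).trans ?_
  refine setLIntegral_mono' measurableSet_Ioo fun s hs => ?_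
  have hts : 0 < t - s := by linarith [hs.2]
  rw [W, abs_of_pos hts, enorm_mul, Real.enorm_of_nonneg (by positivity)]
  calc _ ≤ ENNReal.ofReal ((t - s) / (4 * Real.pi)) *
        ∫⁻ ω : S2, K ‖x + (t - s) • (ω : E3)‖ s ∂surf := by
        refine mul_le_mul_right ((enorm_integral_le_lintegral_enorm _).trans ?_) _
        refine lintegral_mono fun ω => h _ s hs.1.le hs.2.le ?_
        have h1 := norm_le_norm_add_norm_sub' ((t - s) • (ω : E3)) (x + (t - s) • (ω : E3))
        have h2 : ‖(t - s) • (ω : E3)‖ = t - s := by simp [norm_smul, hts.le]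
        have h3 : ‖(t - s) • (ω : E3) - (x + (t - s) • (ω : E3))‖ = ‖x‖ := by
          rw [sub_add_cancel_right, norm_neg]
        linarith
    _ = _ := by
        rw [surf_lintegral_radial x hx hts (fun l => K l s) (hK s), ← mul_assoc,
          ← ENNReal.ofReal_mul (by positivity)]
        congr 2
        field_simp
        ring

/-! ### The weighted estimate for the Duhamel integral. -/

/-- The change to `(s + l, s - l)` has Jacobian two. It is carried out as a translation in `l`,
followed, for fixed `a = s + l`, by the affine substitution `b = 2s - a`. -/
theorem lintegral_characteristic (f g : ℝ → ℝ≥0∞) (hf : Measurable f) (hg : Measurable g) :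
    ∫⁻ s, ∫⁻ l, f (s + l) * g (s - l) = ENNReal.ofReal (1 / 2) * ((∫⁻ a, f a) * ∫⁻ b, g b) := by
  have h1 : ∀ s : ℝ, ∫⁻ l, f (s + l) * g (s - l) = ∫⁻ a, f a * g (2 * s - a) := by
    intro s
    rw [← lintegral_add_left_eq_self (fun a => f a * g (2 * s - a)) s]
    refine lintegral_congr fun l => ?_
    rw [show 2 * s - (s + l) = s - l by ring]
  simp only [h1]
  rw [lintegral_lintegral_swap (by fun_prop)]
  have h2 : ∀ a : ℝ, ∫⁻ s, f a * g (2 * s - a) = f a * (ENNReal.ofReal (1 / 2) * ∫⁻ b, g b) := by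
    intro a
    rw [lintegral_const_mul _ (by fun_prop), ← lintegral_sub_right_eq_self g a]
    have h3 : Measurable fun b => g (b - a) := by fun_prop
    have := lintegral_map (μ := volume) h3 (measurable_const_mul (2 : ℝ))
    rw [← this, Real.map_volume_mul_left two_ne_zero, lintegral_smul_measure]
    congr 2
    norm_num
  simp only [h2]
  rw [lintegral_mul_const _ hf]
  ring

theorem lintegral_Ioo_rpow_neg_two {a b : ℝ} (ha : 0 < a) (hab : a ≤ b) :
    ∫⁻ u in Ioo a b, ENNReal.ofReal (u ^ (-2 : ℝ)) = ENNReal.ofReal ((b - a) / (a * b)) := by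
  have h0 : (0 : ℝ) ∉ uIcc a b := by rw [uIcc_of_le hab]; exact fun h => by linarith [h.1]
  have hb : 0 < b := by linarith
  rw [Measure.restrict_congr_set Ioo_ae_eq_Ioc, lintegral_Ioc_rpow ha.le hab
    (intervalIntegral.intervalIntegrable_rpow (Or.inr h0)),
    integral_rpow (Or.inr ⟨by norm_num, h0⟩)]
  congr 1
  rw [show (-2 : ℝ) + 1 = -1 by norm_num, Real.rpow_neg_one, Real.rpow_neg_one]
  field_simp
  ring

/-- The structural properties of the weight function used by the linear estimate. -/
structure IsWeight (N : ℝ → ℝ) (c q : ℝ) : Prop where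
  c_pos : 0 < c
  one_lt : 1 < q
  lower : ∀ ρ, 1 ≤ ρ → ρ ^ q ≤ N ρ
  quasiMono : ∀ a b, 1 ≤ a → a ≤ b → c * (b * N a) ≤ a * N b

theorem IsWeight.one_le {N : ℝ → ℝ} {c q : ℝ} (h : IsWeight N c q) {ρ : ℝ} (hρ : 1 ≤ ρ) :
    1 ≤ N ρ :=
  (Real.one_le_rpow hρ (by linarith [h.one_lt])).trans (h.lower ρ hρ)

theorem duhamel_weight_bound {N : ℝ → ℝ} {c q R : ℝ} (hN : IsWeight N c q) (hR : 1 ≤ R)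
    {F : E3 → ℝ → ℝ} {B : ℝ} (hB : 0 ≤ B)
    (hF : ∀ y s, 0 ≤ s → ‖y‖ ≤ s + R → |F y s / (1 + s) ^ 2| ≤
      B / (tauPlus R ‖y‖ s ^ 2 * N (tauPlus R ‖y‖ s) * N (tauMinus R ‖y‖ s)))
    (hF0 : ∀ y s, 0 ≤ s → s + R < ‖y‖ → F y s = 0) {x : E3} (hx : x ≠ 0) {t : ℝ} (ht : 0 ≤ t)
    (hxt : ‖x‖ ≤ t + R) :
    |duhamel F x t| ≤ R ^ 2 / (2 * c * (q - 1)) * B /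
      (tauPlus R ‖x‖ t * N (tauMinus R ‖x‖ t)) := by
  have hR0 : 0 < R := by linarith
  have hr : 0 < ‖x‖ := norm_pos_iff.2 hx
  have hc := hN.c_pos
  have hq : 0 < q - 1 := by linarith [hN.one_lt]
  set r := ‖x‖
  set a := tauMinus R r t with ha_def
  set b := tauPlus R r t with hb_def
  have ha1 : 1 ≤ a := by rw [ha_def, tauMinus, le_div_iff₀ hR0]; linarith
  have hNa := hN.one_le ha1
  have hab : a ≤ b := by
    rw [ha_def, hb_def, tauMinus, tauPlus]; gcongr; linarith
  have hb0 : 0 < b := by linarith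
  -- On the backward cone `τ₊ ≥ a`, and quasi-monotonicity gives `N(τ₊) ≥ c τ₊ N(a) / a`. This
  -- extracts the weight at the vertex and adds a third power to `τ₊⁻²`.
  set A := B * a / (c * N a) with hA_def
  have hA : 0 ≤ A := by positivity
  let K : ℝ → ℝ → ℝ≥0∞ := fun l s => (Iic (s + R)).indicator (fun l => ENNReal.ofReal
    (A * tauPlus R l s ^ (-3 : ℝ) * tauMinus R l s ^ (-q))) l
  have hK : ∀ s, Measurable fun l => K l s := by
    intro s
    refine Measurable.indicator ?_ measurableSet_Iic
    unfold tauPlus tauMinus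
    fun_prop
  have hKF : ∀ y, ∀ s, 0 ≤ s → s ≤ t → t - r ≤ s + ‖y‖ → ‖F y s / (1 + s) ^ 2‖ₑ ≤ K ‖y‖ s := by
    intro y s hs _ hy
    by_cases hys : ‖y‖ ≤ s + R
    swap
    · rw [hF0 y s hs (not_le.1 hys)]; simp
    simp only [K]
    rw [indicator_of_mem (mem_Iic.2 hys), ← ofReal_norm, Real.norm_eq_abs]
    refine ENNReal.ofReal_le_ofReal ((hF y s hs hys).trans ?_)
    have ha' : a ≤ tauPlus R ‖y‖ s := by
      rw [ha_def, tauMinus, tauPlus]; gcongr ?_ / R; linarith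
    have hm : 1 ≤ tauMinus R ‖y‖ s := by rw [tauMinus, le_div_iff₀ hR0]; linarith
    have h1 := hN.quasiMono a _ ha1 ha'
    have h2 := hN.lower _ hm
    set T := tauPlus R ‖y‖ s
    set M := tauMinus R ‖y‖ s
    have hT : 0 < T := by linarith
    have hM : 0 < M := by linarith
    rw [Real.rpow_neg hM.le, Real.rpow_neg hT.le, Real.rpow_ofNat, ← div_eq_mul_inv,
      ← div_eq_mul_inv, div_div, hA_def, div_div]
    have hMq : 0 < M ^ q := Real.rpow_pos_of_pos hM _
    have hNT0 : 0 ≤ N T := by linarith [hN.one_le (ha1.trans ha')]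
    have hNT : c * (T * N a) / a ≤ N T := by rw [div_le_iff₀ (by linarith)]; linarith
    calc B / (T ^ 2 * N T * N M) ≤ B / (T ^ 2 * (c * (T * N a) / a) * M ^ q) := by gcongr
      _ = _ := by field_simp
  have hmain := enorm_duhamel_le hx ht K hK hKF
  -- One power of `τ₊⁻³` pays for the density, `l ≤ R τ₊`. The rest is a product of a function of `s
  -- + l` in `(t - r, t + r)` and a function of `s - l ≥ -R`.
  let f : ℝ → ℝ≥0∞ := (Ioo (t - r) (t + r)).indicator
    (fun α => ENNReal.ofReal (((α + 2 * R) / R) ^ (-2 : ℝ)))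
  let g : ℝ → ℝ≥0∞ := (Ici (-R)).indicator
    (fun β => ENNReal.ofReal (((β + 2 * R) / R) ^ (-q)))
  have hf : Measurable f := Measurable.indicator (by fun_prop) measurableSet_Ioo
  have hg : Measurable g := Measurable.indicator (by fun_prop) measurableSet_Ici
  have hfg : ∀ s ∈ Ioo 0 t, ∫⁻ l in Ioo |r - (t - s)| (r + (t - s)), ENNReal.ofReal l * K l s ≤
      ENNReal.ofReal (A * R) * ∫⁻ l, f (s + l) * g (s - l) := by
    intro s hs
    rw [← lintegral_const_mul' _ _ ENNReal.ofReal_ne_top]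
    refine (setLIntegral_mono' measurableSet_Ioo fun l hl => ?_).trans
      (setLIntegral_le_lintegral _ _)
    have hl0 : 0 < l := (abs_nonneg _).trans_lt hl.1
    by_cases hls : l ≤ s + R
    swap
    · simp [K, hls]
    have h1 : s + l ∈ Ioo (t - r) (t + r) := by
      have := (abs_lt.1 hl.1).1
      exact ⟨by linarith, by linarith [hl.2]⟩
    simp only [K, f, g]
    rw [indicator_of_mem (mem_Iic.2 hls), indicator_of_mem h1,
      indicator_of_mem (show s - l ∈ Ici (-R) by rw [mem_Ici]; linarith)]
    have hT : 0 < tauPlus R l s := by rw [tauPlus]; have := hs.1; positivity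
    have hM : 0 ≤ tauMinus R l s := by
      rw [tauMinus]; exact div_nonneg (by linarith) hR0.le
    change _ ≤ ENNReal.ofReal (A * R) * (ENNReal.ofReal (tauPlus R l s ^ (-2 : ℝ)) *
      ENNReal.ofReal (tauMinus R l s ^ (-q)))
    rw [← ENNReal.ofReal_mul hl0.le, ← ENNReal.ofReal_mul (by positivity),
      ← ENNReal.ofReal_mul (by positivity)]
    refine ENNReal.ofReal_le_ofReal ?_
    have h2 : l ≤ R * tauPlus R l s := by
      rw [tauPlus, mul_div_cancel₀ _ hR0.ne']; linarith [hs.1]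
    have h3 : tauPlus R l s * tauPlus R l s ^ (-3 : ℝ) = tauPlus R l s ^ (-2 : ℝ) := by
      nth_rewrite 1 [← Real.rpow_one (tauPlus R l s)]
      rw [← Real.rpow_add hT]; norm_num
    have hp : 0 ≤ tauPlus R l s ^ (-3 : ℝ) := Real.rpow_nonneg hT.le _
    have hp' : 0 ≤ tauMinus R l s ^ (-q) := Real.rpow_nonneg hM _
    calc l * (A * tauPlus R l s ^ (-3 : ℝ) * tauMinus R l s ^ (-q)) ≤
        (R * tauPlus R l s) * (A * tauPlus R l s ^ (-3 : ℝ) * tauMinus R l s ^ (-q)) := by gcongr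
      _ = A * R * ((tauPlus R l s * tauPlus R l s ^ (-3 : ℝ)) * tauMinus R l s ^ (-q)) := by ring
      _ = _ := by rw [h3]
  have hIf : ∫⁻ α, f α = ENNReal.ofReal (R * ((b - a) / (a * b))) := by
    have h1 := lintegral_affine (fun α => ENNReal.ofReal (((α + 2 * R) / R) ^ (-2 : ℝ))) hR0
      (-(2 * R)) a b
    have e1 : -(2 * R) + R * a = t - r := by
      rw [ha_def, tauMinus]; field_simp; ring
    have e2 : -(2 * R) + R * b = t + r := by
      rw [hb_def, tauPlus]; field_simp; ring
    rw [e1, e2] at h1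
    simp only [f]
    rw [lintegral_indicator measurableSet_Ioo, h1, ENNReal.ofReal_mul hR0.le,
      ← lintegral_Ioo_rpow_neg_two (by linarith) hab]
    congr 1
    refine lintegral_congr fun u => ?_
    congr 2
    field_simp
    ring
  have hIg : ∫⁻ β, g β = ENNReal.ofReal (R * (1 / (q - 1))) := by
    rw [ENNReal.ofReal_mul hR0.le, ← lintegral_Ioi_rpow_neg hN.one_lt]
    have h1 := lintegral_add_right_eq_self (μ := volume) (fun β => (Ici R).indicator
      (fun β => ENNReal.ofReal ((β / R) ^ (-q))) β) (2 * R)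
    have h2 : ∀ β, g β = (Ici R).indicator
      (fun β => ENNReal.ofReal ((β / R) ^ (-q))) (β + 2 * R) := by
      intro β
      have : β ∈ Ici (-R) ↔ β + 2 * R ∈ Ici R := by
        rw [mem_Ici, mem_Ici]; constructor <;> intro h <;> linarith
      by_cases h : β ∈ Ici (-R)
      · simp only [g]; rw [indicator_of_mem h, indicator_of_mem (this.1 h)]
      · simp only [g]; rw [indicator_of_notMem h, indicator_of_notMem (mt this.2 h)]
    simp only [h2]
    rw [h1]
    have hmeas : Measurable fun u : ℝ => (Ici 1).indicator
        (fun u => ENNReal.ofReal (u ^ (-q))) u :=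
      Measurable.indicator (by fun_prop) measurableSet_Ici
    have h3 := lintegral_map (μ := volume) hmeas (measurable_const_mul (R⁻¹))
    rw [Real.map_volume_mul_left (by positivity), lintegral_smul_measure, inv_inv,
      abs_of_pos hR0, lintegral_indicator measurableSet_Ici] at h3
    rw [← smul_eq_mul, h3]
    refine lintegral_congr fun β => ?_
    have : β ∈ Ici R ↔ R⁻¹ * β ∈ Ici (1 : ℝ) := by
      rw [mem_Ici, mem_Ici, inv_mul_eq_div, le_div_iff₀ hR0, one_mul]
    by_cases h : β ∈ Ici R
    · rw [indicator_of_mem h, indicator_of_mem (this.1 h), inv_mul_eq_div]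
    · rw [indicator_of_notMem h, indicator_of_notMem (mt this.2 h)]
  -- The length of the `s + l` interval cancels the factor `1 / (2r)` of the mean formula, so no
  -- singularity at `r = 0` remains.
  have hba : b - a = 2 * r / R := by
    rw [ha_def, hb_def, tauMinus, tauPlus]; field_simp; ring
  have hfin : ‖duhamel F x t‖ₑ ≤ ENNReal.ofReal (R ^ 2 / (2 * c * (q - 1)) * B / (b * N a)) := by
    refine hmain.trans ?_
    calc _ ≤ ENNReal.ofReal (1 / (2 * r)) * (ENNReal.ofReal (A * R) *
          ∫⁻ s, ∫⁻ l, f (s + l) * g (s - l)) := by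
          refine mul_le_mul_right ?_ _
          rw [← lintegral_const_mul' _ _ ENNReal.ofReal_ne_top]
          exact (setLIntegral_mono' measurableSet_Ioo hfg).trans (setLIntegral_le_lintegral _ _)
      _ = _ := by
          rw [lintegral_characteristic f g hf hg, hIf, hIg, hba,
            ← ENNReal.ofReal_mul (by positivity), ← ENNReal.ofReal_mul (by positivity),
            ← ENNReal.ofReal_mul (by positivity), ← ENNReal.ofReal_mul (by positivity)]
          congr 1
          rw [hA_def]
          have : a ≠ 0 := by linarith
          field_simp
  rw [← ofReal_norm, Real.norm_eq_abs] at hfin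
  exact (ENNReal.ofReal_le_ofReal_iff (by positivity)).1 hfin

/-! ### Growth properties of the weight `N_γ`. -/

/-- From `1 + b ≤ (1 + a) b / a` follows `log (1 + b) ≤ log (1 + a) + b / a - 1`. After
multiplication by `log 2`, which is at most one and at most `log (1 + a)`, the right side is bounded
by `(b / a) log (1 + a)`. -/
theorem log_two_mul_le {a b : ℝ} (ha : 1 ≤ a) (hab : a ≤ b) :
    Real.log 2 * (a * Real.log (1 + b)) ≤ b * Real.log (1 + a) := by
  have hl2 : 0 < Real.log 2 := Real.log_pos (by norm_num)
  have hl2' : Real.log 2 ≤ 1 := by linarith [Real.log_two_lt_d9]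
  have h1 : Real.log 2 ≤ Real.log (1 + a) := Real.log_le_log (by norm_num) (by linarith)
  have hba : 1 ≤ b / a := by rw [le_div_iff₀ (by linarith)]; linarith
  have h2 : Real.log (1 + b) ≤ Real.log (1 + a) + (b / a - 1) := by
    calc Real.log (1 + b) ≤ Real.log ((1 + a) * (b / a)) := by
          refine Real.log_le_log (by linarith) ?_
          have : (1 + a) * (b / a) = b / a + b := by field_simp
          linarith
      _ = Real.log (1 + a) + Real.log (b / a) :=
          Real.log_mul (by positivity) (by positivity)
      _ ≤ _ := by gcongr; exact Real.log_le_sub_one_of_pos (by positivity)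
  have ha0 : 0 < a := by linarith
  have h3 : b = a * (b / a) := by field_simp
  set k := b / a
  have h4 : Real.log 2 * Real.log (1 + b) ≤ k * Real.log (1 + a) := by
    calc Real.log 2 * Real.log (1 + b) ≤ Real.log 2 * (Real.log (1 + a) + (k - 1)) := by gcongr
      _ ≤ k * Real.log (1 + a) := by nlinarith
  calc _ = a * (Real.log 2 * Real.log (1 + b)) := by ring
    _ ≤ a * (k * Real.log (1 + a)) := by gcongr
    _ = b * Real.log (1 + a) := by rw [← mul_assoc, ← h3]

/-- The exponent is a growth rate common to the three cases; at `γ = 2` one power pays for the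
logarithm. For `γ ≠ 2` the quotient `N(ρ)/ρ` is an increasing power; the constant comes from
`log_two_mul_le` at `γ = 2`. -/
theorem isWeight_weightN {γ : ℝ} (hγ : 0 < γ) :
    IsWeight (weightN γ) (Real.log 2 * Real.log 2) (1 + min γ 1) := by
  have hl2 : 0 < Real.log 2 := Real.log_pos (by norm_num)
  have hl2' : Real.log 2 ≤ 1 := by linarith [Real.log_two_lt_d9]
  have hl3 : Real.log 2 * Real.log 2 ≤ 1 := by nlinarith
  refine ⟨by positivity, by have := lt_min hγ one_pos; linarith, fun ρ hρ => ?_,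
    fun a b ha hab => ?_⟩
  · unfold weightN
    split_ifs with h1 h2
    · exact Real.rpow_le_rpow_of_exponent_le hρ (by linarith [min_le_left γ 1])
    · have h3 : ρ ^ (1 + min γ 1) ≤ ρ ^ (2 : ℝ) :=
        Real.rpow_le_rpow_of_exponent_le hρ (by linarith [min_le_right γ 1])
      rw [Real.rpow_ofNat] at h3
      have hlog : 0 < Real.log (1 + ρ) := Real.log_pos (by linarith)
      have hlog' : Real.log (1 + ρ) ≤ ρ := by
        have := Real.log_le_sub_one_of_pos (show 0 < 1 + ρ by linarith); linarith
      refine h3.trans ?_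
      rw [le_div_iff₀ hlog]
      nlinarith [sq_nonneg ρ]
    · have h3 : ρ ^ (1 + min γ 1) ≤ ρ ^ (3 : ℝ) :=
        Real.rpow_le_rpow_of_exponent_le hρ (by linarith [min_le_right γ 1])
      rwa [Real.rpow_ofNat] at h3
  · have ha0 : 0 < a := by linarith
    have hb0 : 0 < b := by linarith
    have key : b * weightN γ a * (Real.log 2 * Real.log 2) ≤ a * weightN γ b := by
      unfold weightN
      split_ifs with h1 h2
      · have : a ^ γ ≤ b ^ γ := Real.rpow_le_rpow ha0.le hab hγ.le
        rw [Real.rpow_add ha0, Real.rpow_add hb0, Real.rpow_one, Real.rpow_one]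
        have h5 : 0 ≤ a ^ γ := by positivity
        calc _ = a * b * (a ^ γ * (Real.log 2 * Real.log 2)) := by ring
          _ ≤ a * b * (b ^ γ * 1) := by gcongr
          _ = _ := by ring
      · have hla : 0 < Real.log (1 + a) := Real.log_pos (by linarith)
        have hlb : 0 < Real.log (1 + b) := Real.log_pos (by linarith)
        have h3 := log_two_mul_le ha hab
        rw [← mul_div_assoc, ← mul_div_assoc, div_mul_eq_mul_div, div_le_div_iff₀ hla hlb]
        calc _ = a ^ 2 * b * Real.log 2 * (Real.log 2 * (a * Real.log (1 + b))) := by ring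
          _ ≤ a ^ 2 * b * 1 * (b * Real.log (1 + a)) := by gcongr
          _ = a * a * b ^ 2 * Real.log (1 + a) := by ring
          _ ≤ a * b * b ^ 2 * Real.log (1 + a) := by gcongr
          _ = _ := by ring
      · calc _ = a * b * a ^ 2 * (Real.log 2 * Real.log 2) := by ring
          _ ≤ a * b * b ^ 2 * 1 := by gcongr
          _ = _ := by ring
    linarith

/-- This is what dictates the form of `N_γ`: the integral grows like `p^(2-γ)` for `γ < 2`, like
`log p` for `γ = 2`, and is bounded for `γ > 2`, and `N_γ` is `p³` divided by this growth. -/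
theorem weightN_mul_integral_le {γ : ℝ} :
    ∃ C : ℝ, 0 < C ∧ ∀ p : ℝ, 1 ≤ p →
      weightN γ p * (1 + ∫ s in (1 : ℝ)..p, s ^ (1 - γ)) ≤ C * p ^ 3 := by
  have hl2 : 0 < Real.log 2 := Real.log_pos (by norm_num)
  rcases lt_trichotomy γ 2 with h | h | h
  · have h2 : 0 < 2 - γ := by linarith
    refine ⟨1 + 1 / (2 - γ), by positivity, fun p hp => ?_⟩
    have hp0 : 0 < p := by linarith
    have e := rpow_two_sub_eq γ hp
    set I := ∫ s in (1 : ℝ)..p, s ^ (1 - γ)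
    have h1 : 1 ≤ p ^ (2 - γ) := Real.one_le_rpow hp h2.le
    have h3 : I ≤ p ^ (2 - γ) / (2 - γ) := by rw [le_div_iff₀ h2]; linarith
    have h4 : p ^ 3 = p ^ (γ + 1) * p ^ (2 - γ) := by
      rw [← Real.rpow_add hp0, ← Real.rpow_natCast]; congr 1; push_cast; ring
    rw [weightN, if_pos h, h4]
    calc p ^ (γ + 1) * (1 + I) ≤ p ^ (γ + 1) * (p ^ (2 - γ) + p ^ (2 - γ) / (2 - γ)) := by
          gcongr
      _ = _ := by ring
  · refine ⟨1 + 1 / Real.log 2, by positivity, fun p hp => ?_⟩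
    have hp0 : 0 < p := by linarith
    subst h
    have e : ∫ s in (1 : ℝ)..p, s ^ (1 - (2 : ℝ)) = Real.log p := by
      rw [show (1 : ℝ) - 2 = -1 by norm_num]
      simp only [Real.rpow_neg_one]
      rw [integral_inv_of_pos one_pos hp0, div_one]
    have h1 : Real.log 2 ≤ Real.log (1 + p) := Real.log_le_log (by norm_num) (by linarith)
    have h3 : Real.log p ≤ Real.log (1 + p) := Real.log_le_log hp0 (by linarith)
    have hl : 0 < Real.log (1 + p) := by linarith
    have h4 : 1 ≤ Real.log (1 + p) / Real.log 2 := by rw [le_div_iff₀ hl2]; linarith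
    rw [weightN, if_neg (lt_irrefl _), if_pos rfl, e, div_mul_eq_mul_div, div_le_iff₀ hl]
    calc _ ≤ p ^ 3 * (Real.log (1 + p) / Real.log 2 + Real.log (1 + p)) := by gcongr
      _ = _ := by ring
  · have h2 : 0 < γ - 2 := by linarith
    refine ⟨1 + 1 / (γ - 2), by positivity, fun p hp => ?_⟩
    have hp0 : 0 < p := by linarith
    have e := rpow_two_sub_eq γ hp
    set I := ∫ s in (1 : ℝ)..p, s ^ (1 - γ)
    have h1 : 0 ≤ p ^ (2 - γ) := by positivity
    have h3 : I ≤ 1 / (γ - 2) := by rw [le_div_iff₀ h2]; linarith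
    rw [weightN, if_neg (by linarith), if_neg (by linarith), mul_comm]
    gcongr

/-- The weight will be evaluated at `τ₊`, which may exceed `p = s + 2R` but not `2p`.
Quasi-monotonicity moves it to `2p`, and enlarging the interval of integration to `2p` only helps.
-/
theorem weightN_mul_integral_le_cube {γ : ℝ} (hγ : 0 < γ) :
    ∃ C : ℝ, 0 < C ∧ ∀ ρ p : ℝ, 1 ≤ ρ → ρ ≤ 2 * p → 1 ≤ p →
      weightN γ ρ * (1 + ∫ s in (1 : ℝ)..p, s ^ (1 - γ)) ≤ C * p ^ 3 := by
  obtain ⟨C, hC, h⟩ := weightN_mul_integral_le (γ := γ)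
  have hw := isWeight_weightN hγ
  have hc := hw.c_pos
  set c := Real.log 2 * Real.log 2
  refine ⟨8 * C / c, by positivity, fun ρ p hρ hρp hp => ?_⟩
  have h1 := hw.quasiMono ρ (2 * p) hρ hρp
  have h2 := h (2 * p) (by linarith)
  have hN0 : 1 ≤ weightN γ ρ := hw.one_le hρ
  have hN2 : 1 ≤ weightN γ (2 * p) := hw.one_le (by linarith)
  have hI : ∫ s in (1 : ℝ)..p, s ^ (1 - γ) ≤ ∫ s in (1 : ℝ)..(2 * p), s ^ (1 - γ) := by
    have e := intervalIntegral.integral_add_adjacent_intervals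
      (intervalIntegrable_rpow_one (1 - γ) hp)
      (intervalIntegral.intervalIntegrable_rpow (μ := volume)
        (r := 1 - γ) (a := p) (b := 2 * p) (Or.inr (by
        rw [uIcc_of_le (by linarith)]; exact fun h' => by linarith [h'.1])))
    have : 0 ≤ ∫ s in p..(2 * p), s ^ (1 - γ) :=
      intervalIntegral.integral_nonneg (by linarith)
        fun u hu => Real.rpow_nonneg (by linarith [hu.1]) _
    linarith
  have hI0 := integral_rpow_one_nonneg (1 - γ) hp
  have h3 : c * weightN γ ρ ≤ weightN γ (2 * p) := by
    have h4 : 2 * p * (c * weightN γ ρ) ≤ 2 * p * weightN γ (2 * p) := by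
      calc _ = c * (2 * p * weightN γ ρ) := by ring
        _ ≤ ρ * weightN γ (2 * p) := h1
        _ ≤ _ := by gcongr
    exact le_of_mul_le_mul_left h4 (by linarith)
  rw [div_mul_eq_mul_div, le_div_iff₀ hc]
  calc _ = (c * weightN γ ρ) * (1 + ∫ s in (1 : ℝ)..p, s ^ (1 - γ)) := by ring
    _ ≤ weightN γ (2 * p) * (1 + ∫ s in (1 : ℝ)..(2 * p), s ^ (1 - γ)) := by gcongr
    _ ≤ _ := h2
    _ = _ := by ring

theorem continuousOn_weightN (γ : ℝ) : ContinuousOn (weightN γ) (Ici 1) := by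
  have h0 : ∀ x ∈ Ici (1 : ℝ), 0 < x := fun x hx => lt_of_lt_of_le one_pos hx
  unfold weightN
  split_ifs
  · exact fun x hx => (Real.continuousAt_rpow_const x _
      (Or.inl (h0 x hx).ne')).continuousWithinAt
  · refine ContinuousOn.div (by fun_prop) (ContinuousOn.log (by fun_prop) fun x hx => ?_)
      fun x hx => ?_
    · have := h0 x hx; positivity
    · have := h0 x hx
      exact (Real.log_pos (by linarith)).ne'
  · fun_prop

/-! ### The nonlinearity in the weighted space. -/

/-- The weight `τ₊ N_γ(τ₋)` of the space `X`. -/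
def wt (γ R : ℝ) (y : E3) (s : ℝ) : ℝ :=
  tauPlus R ‖y‖ s * weightN γ (tauMinus R ‖y‖ s)

/-- `u` has norm at most `A` in `X(∞)`, and its support is in `|x| ≤ t + R`. -/
structure InX (γ R A : ℝ) (u : E3 → ℝ → ℝ) : Prop where
  bound : ∀ y s, 0 ≤ s → ‖y‖ ≤ s + R → |u y s| ≤ A / wt γ R y s
  support : ∀ y s, 0 ≤ s → s + R < ‖y‖ → u y s = 0

theorem one_le_tauMinus {R r s : ℝ} (hR : 1 ≤ R) (h : r ≤ s + R) : 1 ≤ tauMinus R r s := by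
  rw [tauMinus, le_div_iff₀ (by linarith)]; linarith

theorem one_le_wt {γ R : ℝ} (hγ : 0 < γ) (hR : 1 ≤ R) {y : E3} {s : ℝ} (hs : 0 ≤ s)
    (h : ‖y‖ ≤ s + R) : 1 ≤ wt γ R y s := by
  have h1 : 1 ≤ tauPlus R ‖y‖ s := by
    rw [tauPlus, le_div_iff₀ (by linarith)]; linarith [norm_nonneg y]
  have h2 := (isWeight_weightN hγ).one_le (one_le_tauMinus hR h)
  exact one_le_mul_of_one_le_of_one_le h1 h2

/-- Only `N(τ₋) ≥ τ₋` is used: it bounds `|f|` by `A R⁴ p⁻² (p - ‖y‖)⁻²` with `p = s + 2R`. On the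
support `p - ‖y‖ ≥ R ≥ 1`, so the cut-off profile of `kernel_bound` applies. -/
theorem conv_weight_bound {γ R : ℝ} (hγ₀ : 0 < γ) (hγ : γ < 3) (hR : 1 ≤ R) :
    ∃ C : ℝ, 0 < C ∧ ∀ (s : ℝ) (f : E3 → ℝ) (A : ℝ), 0 ≤ s → 0 ≤ A →
      (∀ y, ‖y‖ ≤ s + R → |f y| ≤ A / wt γ R y s ^ 2) → (∀ y, s + R < ‖y‖ → f y = 0) →
      ∀ x, |∫ y : E3, ‖x - y‖ ^ (-γ) * f y| ≤ C * A *
        ((1 + ∫ u in (1 : ℝ)..(s + 2 * R), u ^ (1 - γ)) / (s + 2 * R) ^ 2) := by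
  obtain ⟨C, hC, hK⟩ := kernel_bound hγ₀ hγ
  have hR0 : 0 < R := by linarith
  refine ⟨C * R ^ 4, by positivity, fun s f A hs hA hf hf0 x => ?_⟩
  set p := s + 2 * R with hp_def
  have hp : 2 ≤ p := by linarith
  have hp0 : 0 < p := by linarith
  have hI := integral_rpow_one_nonneg (1 - γ) (show 1 ≤ p by linarith)
  have hfp : ∀ y, ‖f y‖ₑ ≤ ENNReal.ofReal (A * R ^ 4 / p ^ 2) * profile p ‖y‖ := by
    intro y
    by_cases hy : ‖y‖ ≤ s + R
    swap
    · rw [hf0 y (not_le.1 hy)]; simp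
    have hpy : R ≤ p - ‖y‖ := by linarith
    rw [profile, indicator_of_mem (by rw [mem_Iic]; linarith), ← ofReal_norm, Real.norm_eq_abs,
      ← ENNReal.ofReal_mul (by positivity)]
    refine ENNReal.ofReal_le_ofReal ((hf y hy).trans ?_)
    have h1 : p / R ≤ tauPlus R ‖y‖ s := by
      rw [tauPlus]; gcongr; linarith [norm_nonneg y]
    have hm := one_le_tauMinus hR hy
    have h2 : (p - ‖y‖) / R ≤ weightN γ (tauMinus R ‖y‖ s) := by
      have e : (p - ‖y‖) / R = tauMinus R ‖y‖ s := by rw [tauMinus]; congr 1; linarith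
      rw [e]
      refine le_trans ?_ ((isWeight_weightN hγ₀).lower _ hm)
      have := lt_min hγ₀ one_pos
      calc tauMinus R ‖y‖ s = tauMinus R ‖y‖ s ^ (1 : ℝ) := (Real.rpow_one _).symm
        _ ≤ _ := Real.rpow_le_rpow_of_exponent_le hm (by linarith)
    have hpy0 : 0 < p - ‖y‖ := by linarith
    rw [Real.rpow_neg hpy0.le, Real.rpow_ofNat]
    calc A / wt γ R y s ^ 2 ≤ A / (p / R * ((p - ‖y‖) / R)) ^ 2 := by
          have hT0 : 0 ≤ tauPlus R ‖y‖ s := le_trans (by positivity) h1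
          rw [wt]; gcongr
      _ = _ := by field_simp
  have h1 : ‖∫ y : E3, ‖x - y‖ ^ (-γ) * f y‖ₑ ≤ ENNReal.ofReal (A * R ^ 4 / p ^ 2 *
      (C * (1 + ∫ u in (1 : ℝ)..p, u ^ (1 - γ)))) := by
    refine (enorm_integral_le_lintegral_enorm _).trans ?_
    calc _ ≤ ∫⁻ y : E3, ENNReal.ofReal (A * R ^ 4 / p ^ 2) *
          (ENNReal.ofReal (‖x - y‖ ^ (-γ)) * profile p ‖y‖) := by
          refine lintegral_mono fun y => ?_
          rw [enorm_mul, Real.enorm_of_nonneg (Real.rpow_nonneg (norm_nonneg _) _),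
            mul_left_comm]
          exact mul_le_mul_right (hfp y) _
      _ ≤ _ := by
          rw [lintegral_const_mul' _ _ ENNReal.ofReal_ne_top, ENNReal.ofReal_mul (by positivity)]
          exact mul_le_mul_right (hK p hp x) _
  rw [← ofReal_norm, Real.norm_eq_abs] at h1
  refine ((ENNReal.ofReal_le_ofReal_iff (by positivity)).1 h1).trans (le_of_eq ?_)
  field_simp

theorem abs_mul_sub_mul_le {a b p q A D K : ℝ} (hA : 0 ≤ A) (hK : 0 ≤ K)
    (h1 : |a - b| ≤ 2 * A * D * K) (h2 : |b| ≤ A ^ 2 * K) {P : ℝ} (hp : |p| ≤ A * P)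
    (hpq : |p - q| ≤ D * P) (hD : 0 ≤ D) :
    |a * p - b * q| ≤ 3 * A ^ 2 * D * K * P := by
  have : a * p - b * q = (a - b) * p + b * (p - q) := by ring
  rw [this]
  refine (abs_add_le _ _).trans ?_
  rw [abs_mul, abs_mul]
  have e1 : |a - b| * |p| ≤ 2 * A * D * K * (A * P) := by gcongr
  have e2 : |b| * |p - q| ≤ A ^ 2 * K * (D * P) := by gcongr
  linarith

/-- The nonlinearity is locally Lipschitz, with the decay needed by the linear estimate. -/
theorem nonlinear_bound {γ R : ℝ} (hγ₀ : 0 < γ) (hγ : γ < 3) (hR : 1 ≤ R) :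
    ∃ C : ℝ, 0 < C ∧ ∀ (u w : E3 → ℝ → ℝ) (A D : ℝ), 0 ≤ A → 0 ≤ D →
      (∀ s, 0 ≤ s → Continuous fun y => u y s) → (∀ s, 0 ≤ s → Continuous fun y => w y s) →
      InX γ R A u → InX γ R A w → InX γ R D (fun y s => u y s - w y s) →
      ∀ y s, 0 ≤ s → ‖y‖ ≤ s + R →
        |(conv γ u y s * u y s - conv γ w y s * w y s) / (1 + s) ^ 2| ≤
          C * (A ^ 2 * D) / (tauPlus R ‖y‖ s ^ 2 * weightN γ (tauPlus R ‖y‖ s) *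
            weightN γ (tauMinus R ‖y‖ s)) := by
  obtain ⟨C₁, hC₁, hconv⟩ := conv_weight_bound hγ₀ hγ hR
  obtain ⟨C₂, hC₂, hN⟩ := weightN_mul_integral_le_cube hγ₀
  have hR0 : 0 < R := by linarith
  refine ⟨3 * C₁ * C₂ * (2 * (2 * R) ^ 2), by positivity,
    fun u w A D hA hD huc hwc hu hw huw y s hs hy => ?_⟩
  set p := s + 2 * R with hp_def
  have hp : 2 ≤ p := by linarith
  have hI := integral_rpow_one_nonneg (1 - γ) (show 1 ≤ p by linarith)
  have hsu : ∀ y, u y s ^ 2 ≠ 0 → ‖y‖ ≤ s + R := fun y h => by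
    by_contra hn; exact h (by rw [hu.support y s hs (not_le.1 hn)]; simp)
  have hsw : ∀ y, w y s ^ 2 ≠ 0 → ‖y‖ ≤ s + R := fun y h => by
    by_contra hn; exact h (by rw [hw.support y s hs (not_le.1 hn)]; simp)
  have hdiff : conv γ u y s - conv γ w y s =
      ∫ z : E3, ‖y - z‖ ^ (-γ) * (u z s ^ 2 - w z s ^ 2) := by
    rw [conv, conv, ← integral_sub
      (integrable_conv hγ₀ hγ (f := fun y => u y s ^ 2) ((huc s hs).pow 2) hsu y)
      (integrable_conv hγ₀ hγ (f := fun y => w y s ^ 2) ((hwc s hs).pow 2) hsw y)]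
    simp only [mul_sub]
  set K := C₁ * ((1 + ∫ u in (1 : ℝ)..p, u ^ (1 - γ)) / p ^ 2)
  have hK : 0 ≤ K := by positivity
  have hwt : ∀ z : E3, ‖z‖ ≤ s + R → 0 < wt γ R z s := fun z hz =>
    one_pos.trans_le (one_le_wt hγ₀ hR hs hz)
  have h1 : |conv γ u y s - conv γ w y s| ≤ 2 * A * D * K := by
    rw [hdiff]
    refine (hconv s _ (2 * A * D) hs (by positivity) (fun z hz => ?_) (fun z hz => ?_) y).trans
      (le_of_eq (by simp only [K]; ring))
    · have := hwt z hz
      have e1 := hu.bound z s hs hz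
      have e2 := hw.bound z s hs hz
      have e3 := huw.bound z s hs hz
      rw [sq_sub_sq, abs_mul]
      calc |u z s + w z s| * |u z s - w z s| ≤ (A / wt γ R z s + A / wt γ R z s) *
            (D / wt γ R z s) := by
            gcongr
            exact (abs_add_le _ _).trans (add_le_add e1 e2)
        _ = _ := by field_simp; ring
    · rw [hu.support z s hs hz, hw.support z s hs hz, sub_self]
  have h2 : |conv γ w y s| ≤ A ^ 2 * K := by
    refine (hconv s (fun z => w z s ^ 2) (A ^ 2) hs (by positivity) (fun z hz => ?_)
      (fun z hz => ?_) y).trans (le_of_eq (by simp only [K]; ring))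
    · rw [abs_pow, ← div_pow]
      have e2 := hw.bound z s hs hz
      gcongr
    · rw [hw.support z s hs hz]; simp
  have hw0 := hwt y hy
  have h3 := abs_mul_sub_mul_le hA hK h1 h2 (P := 1 / wt γ R y s) (p := u y s) (q := w y s)
    (by rw [mul_one_div]; exact hu.bound y s hs hy)
    (by rw [mul_one_div]; exact huw.bound y s hs hy) hD
  have hT1 : 1 ≤ tauPlus R ‖y‖ s := by
    rw [tauPlus, le_div_iff₀ hR0]; linarith [norm_nonneg y]
  have hTp : tauPlus R ‖y‖ s ≤ 2 * p := by
    rw [tauPlus, div_le_iff₀ hR0]; nlinarith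
  have hNT := hN (tauPlus R ‖y‖ s) p hT1 hTp (by linarith)
  have hNT0 : 0 < weightN γ (tauPlus R ‖y‖ s) :=
    one_pos.trans_le ((isWeight_weightN hγ₀).one_le hT1)
  have hM0 : 0 < weightN γ (tauMinus R ‖y‖ s) :=
    one_pos.trans_le ((isWeight_weightN hγ₀).one_le (one_le_tauMinus hR hy))
  rw [abs_div, abs_of_pos (show 0 < (1 + s) ^ 2 by positivity), div_le_iff₀ (by positivity)]
  refine h3.trans ?_
  rw [wt, ← sub_nonneg]
  set T := tauPlus R ‖y‖ s
  set M := weightN γ (tauMinus R ‖y‖ s)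
  set NT := weightN γ T
  set J := 1 + ∫ u in (1 : ℝ)..p, u ^ (1 - γ)
  have hp0 : 0 < p := by linarith
  have hps : p ≤ 2 * R * (1 + s) := by nlinarith
  rw [sub_nonneg]
  have hT0 : 0 < T := by linarith
  -- Here the factor `(1 + s)⁻²` of the equation is used up: `NT * J` is at most `C₂ p³` and `T` at
  -- most `2p`, so the quotient is `O(p²)`, while `p ≤ 2R(1 + s)`.
  have key : NT * J * T / p ^ 2 ≤ C₂ * (2 * (2 * R) ^ 2) * (1 + s) ^ 2 := by
    rw [div_le_iff₀ (by positivity)]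
    calc NT * J * T ≤ (C₂ * p ^ 3) * (2 * p) := mul_le_mul hNT hTp hT0.le (by positivity)
      _ = C₂ * 2 * p ^ 2 * p ^ 2 := by ring
      _ ≤ C₂ * 2 * (2 * R * (1 + s)) ^ 2 * p ^ 2 := by gcongr
      _ = _ := by ring
  have e1 : 3 * A ^ 2 * D * K * (1 / (T * M)) =
      3 * A ^ 2 * D * C₁ / (T ^ 2 * NT * M) * (NT * J * T / p ^ 2) := by
    change 3 * A ^ 2 * D * (C₁ * (J / p ^ 2)) * (1 / (T * M)) = _
    field_simp
  rw [e1]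
  calc _ ≤ 3 * A ^ 2 * D * C₁ / (T ^ 2 * NT * M) *
        (C₂ * (2 * (2 * R) ^ 2) * (1 + s) ^ 2) := by gcongr
    _ = _ := by ring

/-! ### The free part of the solution. -/

theorem hasDerivAt_sphereMean {f f' : ℝ → E3 → ℝ} (hf : ∀ τ, Continuous (f τ))
    (hf' : Continuous (Function.uncurry f'))
    (h : ∀ τ (ω : S2), HasDerivAt (fun τ => f τ ω) (f' τ ω) τ) (τ : ℝ) :
    HasDerivAt (fun τ => ∫ ω : S2, f τ ω ∂surf) (∫ ω : S2, f' τ ω ∂surf) τ := by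
  obtain ⟨M, hM⟩ := ((isCompact_closedBall τ 1).prod
    (isCompact_sphere (0 : E3) 1)).exists_bound_of_continuousOn hf'.continuousOn
  have hc : ∀ τ, Continuous (f' τ) := fun τ => hf'.comp (by fun_prop :
    Continuous fun y : E3 => (τ, y))
  exact (hasDerivAt_integral_of_dominated_loc_of_deriv_le (bound := fun _ => M)
    (Metric.closedBall_mem_nhds τ one_pos)
    (.of_forall fun σ => (integrable_sphere (hf σ)).aestronglyMeasurable)
    (integrable_sphere (hf τ)) (integrable_sphere (hc τ)).aestronglyMeasurable
    (.of_forall fun ω σ hσ => hM (σ, ω) ⟨hσ, ω.2⟩) (integrable_const M)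
    (.of_forall fun ω σ _ => h σ ω)).2

/-- The time derivative of `S φ`. -/
def dS (φ : E3 → ℝ) (x : E3) (τ : ℝ) : ℝ :=
  1 / (4 * Real.pi) * (∫ ω : S2, φ (x + τ • (ω : E3)) ∂surf) +
    τ / (4 * Real.pi) * ∫ ω : S2, fderiv ℝ φ (x + τ • (ω : E3)) ω ∂surf

theorem hasDerivAt_S {φ : E3 → ℝ} (hφ : ContDiff ℝ 1 φ) (x : E3) (τ : ℝ) :
    HasDerivAt (S φ x) (dS φ x τ) τ := by
  have hd : Continuous (fderiv ℝ φ) := hφ.continuous_fderiv one_ne_zero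
  have h := hasDerivAt_sphereMean (f := fun τ y => φ (x + τ • y))
    (f' := fun τ y => fderiv ℝ φ (x + τ • y) y) (fun τ => by have := hφ.continuous; fun_prop)
    ((hd.comp (by fun_prop : Continuous fun p : ℝ × E3 => x + p.1 • p.2)).clm_apply continuous_snd)
    (fun τ ω => by
      have h1 : HasDerivAt (fun τ : ℝ => x + τ • (ω : E3)) (ω : E3) τ := by
        simpa using ((hasDerivAt_id τ).smul_const (ω : E3)).const_add x
      exact ((hφ.differentiable one_ne_zero _).hasFDerivAt).comp_hasDerivAt τ h1) τ
  have h2 := ((hasDerivAt_id τ).div_const (4 * Real.pi)).mul h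
  exact h2

/-- For `t ≥ 0` the operators `W` and `S` agree, and `S` is differentiable across `t = 0`; the
one-sided derivative is thus an ordinary derivative of `S`. -/
theorem freePart_eq {v₀ v₁ : E3 → ℝ} (h₀ : ContDiff ℝ 1 v₀) (x : E3) {t : ℝ} (ht : 0 ≤ t) :
    freePart v₀ v₁ x t = dS v₀ x t + S (fun y => v₀ y + v₁ y) x t := by
  unfold freePart
  rw [W_eq_S, abs_of_nonneg ht]
  congr 1
  have h1 : HasDerivWithinAt (fun τ => W v₀ x τ) (dS v₀ x t) (Ici 0) t := by
    refine (hasDerivAt_S h₀ x t).hasDerivWithinAt.congr (fun τ hτ => ?_) ?_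
    · rw [W_eq_S, abs_of_nonneg hτ]
    · rw [W_eq_S, abs_of_nonneg ht]
  exact h1.derivWithin (uniqueDiffOn_Ici 0 t ht)

theorem continuous_dS {φ : E3 → ℝ} (hφ : ContDiff ℝ 1 φ) :
    Continuous fun z : E3 × ℝ => dS φ z.1 z.2 := by
  have hd : Continuous (fderiv ℝ φ) := hφ.continuous_fderiv one_ne_zero
  have hc := hφ.continuous
  have h1 : Continuous fun z : E3 × ℝ => ∫ ω : S2, φ (z.1 + z.2 • (ω : E3)) ∂surf :=
    continuous_sphereMean (X := E3 × ℝ) (f := fun z y => φ (z.1 + z.2 • y))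
      (hc.comp (by fun_prop : Continuous fun p : (E3 × ℝ) × E3 => p.1.1 + p.1.2 • p.2))
  have h2 : Continuous fun z : E3 × ℝ => ∫ ω : S2, fderiv ℝ φ (z.1 + z.2 • (ω : E3)) ω ∂surf :=
    continuous_sphereMean (X := E3 × ℝ) (f := fun z y => fderiv ℝ φ (z.1 + z.2 • y) y)
      ((hd.comp (by fun_prop : Continuous fun p : (E3 × ℝ) × E3 =>
        p.1.1 + p.1.2 • p.2)).clm_apply continuous_snd)
  unfold dS
  fun_prop

theorem continuous_S_snd {φ : E3 → ℝ} (hφ : Continuous φ) :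
    Continuous fun z : E3 × ℝ => S φ z.1 z.2 :=
  continuous_S (G := fun _ y => φ y) (hφ.comp continuous_snd) continuous_fst continuous_snd

theorem abs_norm_sub_le_norm_add {x : E3} {t : ℝ} (ht : 0 ≤ t) (ω : S2) :
    |‖x‖ - t| ≤ ‖x + t • (ω : E3)‖ := by
  have h : ‖t • (ω : E3)‖ = t := by simp [norm_smul, ht]
  have := abs_norm_sub_norm_le x (-(t • (ω : E3)))
  rwa [norm_neg, h, sub_neg_eq_add] at this

/-- The part of a sphere of radius `t` that lies in a fixed ball. -/
theorem surf_cap_le {R : ℝ} (hR : 0 < R) (x : E3) {t : ℝ} (ht : 0 ≤ t) :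
    ∫⁻ ω : S2, (Iic R).indicator 1 ‖x + t • (ω : E3)‖ ∂surf ≤
      ENNReal.ofReal (36 * Real.pi * R ^ 2 / (R + t) ^ 2) := by
  -- In this range the whole sphere may be counted: its area `4π` equals `36πR² / (3R)²`, which
  -- fixes the constant.
  by_cases h2 : t ≤ 2 * R
  · calc _ ≤ ∫⁻ _ : S2, (1 : ℝ≥0∞) ∂surf :=
          lintegral_mono fun ω => (indicator_le_self' (fun _ _ => zero_le) _ :
            (Iic R).indicator (1 : ℝ → ℝ≥0∞) ‖x + t • (ω : E3)‖ ≤ 1)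
      _ = ENNReal.ofReal (4 * Real.pi) := by rw [lintegral_const, one_mul, surf_univ]
      _ ≤ _ := by
          refine ENNReal.ofReal_le_ofReal ?_
          rw [le_div_iff₀ (by positivity)]
          have : (R + t) ^ 2 ≤ (3 * R) ^ 2 := by gcongr; linarith
          nlinarith [Real.pi_pos]
  push Not at h2
  have ht0 : 0 < t := by linarith
  by_cases hx : |‖x‖ - t| ≤ R
  swap
  · have : ∀ ω : S2, (Iic R).indicator (1 : ℝ → ℝ≥0∞) ‖x + t • (ω : E3)‖ = 0 := fun ω => by
      refine indicator_of_notMem (fun h => hx ?_) _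
      exact (abs_norm_sub_le_norm_add ht ω).trans h
    simp [this]
  have hxt : t / 2 ≤ ‖x‖ := by have := (abs_le.1 hx).1; linarith
  have hx0 : 0 < ‖x‖ := by linarith
  rw [surf_lintegral_radial x (norm_pos_iff.1 hx0) ht0 _
    (measurable_one.indicator measurableSet_Iic)]
  have h3 : ∫⁻ l in Ioo |‖x‖ - t| (‖x‖ + t), ENNReal.ofReal l * (Iic R).indicator 1 l ≤
      ENNReal.ofReal (R * R) := by
    calc _ ≤ ∫⁻ l in Ioo |‖x‖ - t| (‖x‖ + t),
            (Ioc 0 R).indicator (fun _ => ENNReal.ofReal R) l := by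
          refine setLIntegral_mono' measurableSet_Ioo fun l hl => ?_
          have hl0 : 0 < l := (abs_nonneg _).trans_lt hl.1
          by_cases h : l ≤ R
          · rw [indicator_of_mem (mem_Iic.2 h), indicator_of_mem (show l ∈ Ioc 0 R from ⟨hl0, h⟩)]
            simpa using ENNReal.ofReal_le_ofReal h
          · rw [indicator_of_notMem (by simpa using h)]; simp
      _ ≤ ∫⁻ l, (Ioc 0 R).indicator (fun _ => ENNReal.ofReal R) l := setLIntegral_le_lintegral _ _
      _ = _ := by
          rw [lintegral_indicator measurableSet_Ioc, setLIntegral_const, Real.volume_Ioc, sub_zero,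
            ENNReal.ofReal_mul hR.le]
  refine (mul_le_mul_right h3 _).trans ?_
  rw [← ENNReal.ofReal_mul (by positivity)]
  refine ENNReal.ofReal_le_ofReal ?_
  rw [div_mul_eq_mul_div, div_le_div_iff₀ (by positivity) (by positivity)]
  have h4 : (R + t) ^ 2 ≤ (3 / 2 * t) ^ 2 := by gcongr; linarith
  calc 2 * Real.pi * (R * R) * (R + t) ^ 2 ≤ 2 * Real.pi * (R * R) * (3 / 2 * t) ^ 2 := by gcongr
    _ ≤ 36 * Real.pi * R ^ 2 * (t / 2 * t) := by
        have : 0 ≤ Real.pi * R ^ 2 * t ^ 2 := by positivity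
        nlinarith
    _ ≤ _ := by gcongr

theorem abs_sphereMean_le {R : ℝ} (hR : 0 < R) {f : S2 → ℝ} {B : ℝ} (hB : 0 ≤ B) {x : E3} {t : ℝ}
    (ht : 0 ≤ t) (hf : ∀ ω, |f ω| ≤ B) (hf0 : ∀ ω : S2, R < ‖x + t • (ω : E3)‖ → f ω = 0) :
    |∫ ω : S2, f ω ∂surf| ≤ B * (36 * Real.pi * R ^ 2 / (R + t) ^ 2) := by
  have h : ‖∫ ω : S2, f ω ∂surf‖ₑ ≤
      ENNReal.ofReal (B * (36 * Real.pi * R ^ 2 / (R + t) ^ 2)) := by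
    refine (enorm_integral_le_lintegral_enorm _).trans ?_
    rw [ENNReal.ofReal_mul hB]
    refine le_trans ?_ (mul_le_mul_right (surf_cap_le hR x ht) _)
    rw [← lintegral_const_mul' _ _ ENNReal.ofReal_ne_top]
    refine lintegral_mono fun ω => ?_
    by_cases h : ‖x + t • (ω : E3)‖ ≤ R
    · rw [indicator_of_mem (mem_Iic.2 h), ← ofReal_norm, Real.norm_eq_abs]
      simpa using ENNReal.ofReal_le_ofReal (hf ω)
    · rw [hf0 ω (not_le.1 h)]; simp
  rw [← ofReal_norm, Real.norm_eq_abs] at h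
  exact (ENNReal.ofReal_le_ofReal_iff (by positivity)).1 h

/-- The data are bounded by `ε` and supported in the ball of radius `R`. -/
structure SmallData (R ε : ℝ) (v₀ v₁ : E3 → ℝ) : Prop where
  contDiff₀ : ContDiff ℝ 1 v₀
  continuous₁ : Continuous v₁
  zero₀ : ∀ y, R < ‖y‖ → v₀ y = 0
  zero₀' : ∀ y, R < ‖y‖ → fderiv ℝ v₀ y = 0
  zero₁ : ∀ y, R < ‖y‖ → v₁ y = 0
  bound₀ : ∀ y, |v₀ y| ≤ ε
  bound₀' : ∀ y, ‖fderiv ℝ v₀ y‖ ≤ ε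
  bound₁ : ∀ y, |v₁ y| ≤ ε

theorem smallData_of_dataNorm {R ε : ℝ} {v₀ v₁ : E3 → ℝ} (hε : 0 ≤ ε) (h₀ : ContDiff ℝ 2 v₀)
    (h₁ : ContDiff ℝ 1 v₁) (hs₀ : tsupport v₀ ⊆ Metric.closedBall 0 R)
    (hs₁ : tsupport v₁ ⊆ Metric.closedBall 0 R)
    (h : dataNorm v₀ v₁ ≤ ENNReal.ofReal ε) : SmallData R ε v₀ v₁ := by
  have hb : ∀ y, (∑ k ∈ Finset.range 3, ‖iteratedFDeriv ℝ k v₀ y‖ₑ) +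
      ∑ k ∈ Finset.range 2, ‖iteratedFDeriv ℝ k v₁ y‖ₑ ≤ ENNReal.ofReal ε := fun y =>
    (le_iSup (fun y => (∑ k ∈ Finset.range 3, ‖iteratedFDeriv ℝ k v₀ y‖ₑ) +
      ∑ k ∈ Finset.range 2, ‖iteratedFDeriv ℝ k v₁ y‖ₑ) y).trans h
  have hb₀ : ∀ k ∈ Finset.range 3, ∀ y, ‖iteratedFDeriv ℝ k v₀ y‖ ≤ ε := fun k hk y => by
    rw [← ENNReal.ofReal_le_ofReal_iff hε, ofReal_norm]
    exact (Finset.single_le_sum (f := fun k => ‖iteratedFDeriv ℝ k v₀ y‖ₑ)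
      (fun _ _ => zero_le) hk).trans (le_self_add.trans (hb y))
  have hb₁ : ∀ k ∈ Finset.range 2, ∀ y, ‖iteratedFDeriv ℝ k v₁ y‖ ≤ ε := fun k hk y => by
    rw [← ENNReal.ofReal_le_ofReal_iff hε, ofReal_norm]
    exact (Finset.single_le_sum (f := fun k => ‖iteratedFDeriv ℝ k v₁ y‖ₑ)
      (fun _ _ => zero_le) hk).trans (le_add_self.trans (hb y))
  have hz : ∀ (f : E3 → ℝ), tsupport f ⊆ Metric.closedBall 0 R → ∀ y, R < ‖y‖ → y ∉ tsupport f :=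
    fun f hf y hy h => by have := hf h; rw [mem_closedBall_zero_iff] at this; linarith
  refine ⟨h₀.of_le (by norm_num), h₁.continuous, fun y hy => ?_, fun y hy => ?_, fun y hy => ?_,
    fun y => ?_, fun y => ?_, fun y => ?_⟩
  · exact image_eq_zero_of_notMem_tsupport (hz _ hs₀ y hy)
  · by_contra hne
    exact hz _ hs₀ y hy (support_fderiv_subset ℝ hne)
  · exact image_eq_zero_of_notMem_tsupport (hz _ hs₁ y hy)
  · simpa using hb₀ 0 (by simp) y
  · have := hb₀ 1 (by simp) y
    rwa [norm_iteratedFDeriv_one] at this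
  · simpa using hb₁ 0 (by simp) y

/-- Huygens' principle: the sphere of radius `t` around `x` misses the support of the data both
before the signal arrives and after it has passed. -/
theorem freePart_eq_zero {R ε : ℝ} {v₀ v₁ : E3 → ℝ} (hd : SmallData R ε v₀ v₁) {x : E3} {t : ℝ}
    (ht : 0 ≤ t) (h : R < |‖x‖ - t|) : freePart v₀ v₁ x t = 0 := by
  have hy : ∀ ω : S2, R < ‖x + t • (ω : E3)‖ := fun ω =>
    h.trans_le (abs_norm_sub_le_norm_add ht ω)
  rw [freePart_eq hd.contDiff₀ x ht, dS, S]
  simp [hd.zero₀ _ (hy _), hd.zero₀' _ (hy _), hd.zero₁ _ (hy _)]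

theorem abs_freePart_le {R ε : ℝ} (hR : 1 ≤ R) {v₀ v₁ : E3 → ℝ} (hd : SmallData R ε v₀ v₁)
    (x : E3) {t : ℝ} (ht : 0 ≤ t) :
    |freePart v₀ v₁ x t| ≤ 27 * R ^ 2 * ε / (R + t) := by
  have hR0 : 0 < R := by linarith
  have hε : 0 ≤ ε := (abs_nonneg _).trans (hd.bound₀ 0)
  have h1 : |∫ ω : S2, v₀ (x + t • (ω : E3)) ∂surf| ≤ _ := abs_sphereMean_le hR0 hε ht
    (fun ω => hd.bound₀ _) (fun ω h => hd.zero₀ _ h)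
  have h2 : |∫ ω : S2, fderiv ℝ v₀ (x + t • (ω : E3)) ω ∂surf| ≤ _ :=
    abs_sphereMean_le hR0 hε (x := x) ht
    (fun ω => by
      have := (fderiv ℝ v₀ (x + t • (ω : E3))).le_opNorm ω
      simp only [norm_eq_of_mem_sphere, mul_one, Real.norm_eq_abs] at this
      exact this.trans (hd.bound₀' _)) (fun ω h => by rw [hd.zero₀' _ h]; rfl)
  have h3 : |∫ ω : S2, (v₀ (x + t • (ω : E3)) + v₁ (x + t • (ω : E3))) ∂surf| ≤ _ :=
    abs_sphereMean_le hR0 (by positivity : 0 ≤ 2 * ε) (x := x) ht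
    (f := fun ω : S2 => v₀ (x + t • (ω : E3)) + v₁ (x + t • (ω : E3)))
    (fun ω => by
      have e1 := hd.bound₀ (x + t • (ω : E3))
      have e2 := hd.bound₁ (x + t • (ω : E3))
      exact (abs_add_le _ _).trans (by linarith))
    (fun ω h => by rw [hd.zero₀ _ h, hd.zero₁ _ h, add_zero])
  rw [freePart_eq hd.contDiff₀ x ht, dS, S]
  set K := 36 * Real.pi * R ^ 2 / (R + t) ^ 2
  have hpi := Real.pi_pos
  have e : ∀ a b c : ℝ, |a| ≤ ε * K → |b| ≤ ε * K → |c| ≤ 2 * ε * K →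
      |1 / (4 * Real.pi) * a + t / (4 * Real.pi) * b + t / (4 * Real.pi) * c| ≤
        1 / (4 * Real.pi) * (ε * K) + t / (4 * Real.pi) * (ε * K) +
          t / (4 * Real.pi) * (2 * ε * K) := by
    intro a b c ha hb hc
    refine (abs_add_three _ _ _).trans ?_
    rw [abs_mul, abs_mul, abs_mul, abs_of_nonneg (show 0 ≤ 1 / (4 * Real.pi) by positivity),
      abs_of_nonneg (show 0 ≤ t / (4 * Real.pi) by positivity)]
    gcongr
  refine (e _ _ _ h1 h2 h3).trans ?_
  have : 1 / (4 * Real.pi) * (ε * K) + t / (4 * Real.pi) * (ε * K) +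
          t / (4 * Real.pi) * (2 * ε * K) = 9 * R ^ 2 * ε * (1 + 3 * t) / (R + t) ^ 2 := by
    simp only [K]; field_simp; ring
  rw [this, div_le_div_iff₀ (by positivity) (by positivity)]
  calc 9 * R ^ 2 * ε * (1 + 3 * t) * (R + t) ≤ 9 * R ^ 2 * ε * (3 * (R + t)) * (R + t) := by
        gcongr; linarith
    _ = _ := by ring

/-- By Huygens' principle only `|‖y‖ - s| ≤ R` matters. There `τ₋ ≤ 3`, so `N(τ₋)` is bounded, and
the decay `1 / (R + s)` pays for `τ₊`. -/
theorem freePart_inX {γ R : ℝ} (hγ : 0 < γ) (hR : 1 ≤ R) :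
    ∃ C : ℝ, 0 < C ∧ ∀ (ε : ℝ) (v₀ v₁ : E3 → ℝ), SmallData R ε v₀ v₁ →
      InX γ R (C * ε) (freePart v₀ v₁) := by
  have hR0 : 0 < R := by linarith
  obtain ⟨n, hn⟩ := (isCompact_Icc (a := (1 : ℝ)) (b := 3)).exists_bound_of_continuousOn
    ((continuousOn_weightN γ).mono fun x hx => hx.1)
  have hn1 : 0 ≤ n := (norm_nonneg _).trans (hn 1 ⟨le_rfl, by norm_num⟩)
  refine ⟨81 * R * (n + 1), by positivity, fun ε v₀ v₁ hd =>
    ⟨fun y s hs hy => ?_, fun y s hs hy => ?_⟩⟩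
  · have hε : 0 ≤ ε := (abs_nonneg _).trans (hd.bound₀ 0)
    have hw := one_le_wt hγ hR hs hy
    by_cases h : R < |‖y‖ - s|
    · rw [freePart_eq_zero hd hs h, abs_zero]; positivity
    · push Not at h
      rw [le_div_iff₀ (by positivity)]
      have h3 : tauMinus R ‖y‖ s ≤ 3 := by
        rw [tauMinus, div_le_iff₀ hR0]; linarith [(abs_le.1 h).1]
      have h4 := (le_abs_self _).trans (hn _ ⟨one_le_tauMinus hR hy, h3⟩)
      have h5 : tauPlus R ‖y‖ s ≤ 3 * (R + s) / R := by
        rw [tauPlus]; gcongr; linarith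
      have h6 : 0 ≤ tauPlus R ‖y‖ s := by rw [tauPlus]; positivity
      calc |freePart v₀ v₁ y s| * wt γ R y s ≤ 27 * R ^ 2 * ε / (R + s) *
            (3 * (R + s) / R * (n + 1)) := by
            refine mul_le_mul (abs_freePart_le hR hd y hs) ?_ (by linarith) (by positivity)
            rw [wt]
            refine (mul_le_mul_of_nonneg_left (h4.trans
              (le_add_of_nonneg_right zero_le_one)) h6).trans ?_
            gcongr
        _ = _ := by field_simp; ring
  · exact freePart_eq_zero hd hs (by rw [lt_abs]; left; linarith)

/-! ### The contraction argument. -/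

/-- The cubic nonlinearity `(V_γ * u²) u`. -/
def cubic (γ : ℝ) (u : E3 → ℝ → ℝ) (y : E3) (s : ℝ) : ℝ := conv γ u y s * u y s

/-- The nonlinearity with its time weight, frozen for negative times. -/
def source (γ : ℝ) (u : E3 → ℝ → ℝ) (y : E3) (s : ℝ) : ℝ := cubic γ u y s / (1 + max s 0) ^ 2

theorem continuous_source {γ R : ℝ} (hγ₀ : 0 < γ) (hγ : γ < 3) {u : E3 → ℝ → ℝ}
    (hu : Continuous fun z : E3 × ℝ => u z.1 z.2)
    (hs : ∀ y s, max s 0 + R < ‖y‖ → u y s = 0) :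
    Continuous fun z : E3 × ℝ => source γ u z.1 z.2 := by
  have h := continuous_conv hγ₀ hγ hu (ρ := fun s => max s 0 + R) (by fun_prop)
    (fun y t h => by by_contra hn; exact h (hs y t (not_le.1 hn)))
  unfold source cubic
  refine (h.mul hu).div (by fun_prop) fun z => ?_
  have : 0 ≤ max z.2 0 := le_max_right _ _
  positivity

theorem duhamel_cubic_eq (γ : ℝ) (u : E3 → ℝ → ℝ) (x : E3) {t : ℝ} (ht : 0 ≤ t) :
    duhamel (cubic γ u) x t = ∫ s in (0 : ℝ)..t, S (fun y => source γ u y s) x (t - s) :=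
  duhamel_eq ht fun y s hs => by rw [source, max_eq_left hs.1]

theorem continuous_duhamel_cubic {γ R : ℝ} (hγ₀ : 0 < γ) (hγ : γ < 3) {u : E3 → ℝ → ℝ}
    (hu : Continuous fun z : E3 × ℝ => u z.1 z.2)
    (hs : ∀ y s, max s 0 + R < ‖y‖ → u y s = 0) :
    Continuous fun z : E3 × ℝ => duhamel (cubic γ u) z.1 (max z.2 0) := by
  have h := (continuous_oddDuhamel (continuous_source hγ₀ hγ hu hs)).comp
    (by fun_prop : Continuous fun z : E3 × ℝ => (z.1, max z.2 0))
  refine h.congr fun z => ?_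
  rw [duhamel_cubic_eq γ u z.1 (le_max_right _ _)]
  rfl

/-- A continuous positive extension of the weight to all of space-time. -/
def wtExt (γ R : ℝ) (z : E3 × ℝ) : ℝ :=
  tauPlus R ‖z.1‖ (max z.2 0) * weightN γ (max 1 (tauMinus R ‖z.1‖ (max z.2 0)))

theorem continuous_wtExt {γ R : ℝ} : Continuous (wtExt γ R) := by
  have h1 : Continuous fun z : E3 × ℝ => max 1 (tauMinus R ‖z.1‖ (max z.2 0)) := by
    unfold tauMinus; fun_prop
  have h2 : Continuous fun z : E3 × ℝ => weightN γ (max 1 (tauMinus R ‖z.1‖ (max z.2 0))) :=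
    (continuousOn_weightN γ).comp_continuous h1 fun z => mem_Ici.2 (le_max_left _ _)
  have h3 : Continuous fun z : E3 × ℝ => tauPlus R ‖z.1‖ (max z.2 0) := by
    unfold tauPlus; fun_prop
  exact h3.mul h2

theorem one_le_wtExt {γ R : ℝ} (hγ : 0 < γ) (hR : 1 ≤ R) (z : E3 × ℝ) : 1 ≤ wtExt γ R z := by
  have h1 : 1 ≤ tauPlus R ‖z.1‖ (max z.2 0) := by
    rw [tauPlus, le_div_iff₀ (by linarith)]
    linarith [norm_nonneg z.1, le_max_right z.2 0]
  exact one_le_mul_of_one_le_of_one_le h1 ((isWeight_weightN hγ).one_le (le_max_left _ _))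

theorem wtExt_eq {γ R : ℝ} (hR : 1 ≤ R) {y : E3} {s : ℝ} (hs : 0 ≤ s) (hy : ‖y‖ ≤ s + R) :
    wtExt γ R (y, s) = wt γ R y s := by
  simp only [wtExt, wt, max_eq_left hs, max_eq_right (one_le_tauMinus hR hy)]

theorem source_sub {γ : ℝ} {u w : E3 → ℝ → ℝ} {y : E3} {s : ℝ} (hs : 0 ≤ s) :
    source γ u y s - source γ w y s = (cubic γ u y s - cubic γ w y s) / (1 + s) ^ 2 := by
  rw [source, source, max_eq_left hs, sub_div]

theorem duhamel_sub {γ R : ℝ} (hγ₀ : 0 < γ) (hγ : γ < 3) {u w : E3 → ℝ → ℝ}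
    (hu : Continuous fun z : E3 × ℝ => u z.1 z.2) (hw : Continuous fun z : E3 × ℝ => w z.1 z.2)
    (hus : ∀ y s, max s 0 + R < ‖y‖ → u y s = 0) (hws : ∀ y s, max s 0 + R < ‖y‖ → w y s = 0)
    (x : E3) {t : ℝ} (ht : 0 ≤ t) :
    duhamel (cubic γ u) x t - duhamel (cubic γ w) x t =
      duhamel (fun y s => cubic γ u y s - cubic γ w y s) x t := by
  have hcu := continuous_source hγ₀ hγ hu hus
  have hcw := continuous_source hγ₀ hγ hw hws
  rw [duhamel_cubic_eq γ u x ht, duhamel_cubic_eq γ w x ht, duhamel_eq ht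
    (fun y s hs => source_sub (γ := γ) (u := u) (w := w) (y := y) hs.1),
    ← intervalIntegral.integral_sub (intervalIntegrable_oddDuhamel hcu x t 0 t)
    (intervalIntegrable_oddDuhamel hcw x t 0 t)]
  refine intervalIntegral.integral_congr fun s _ => ?_
  exact (S_sub (hcu.comp (by fun_prop : Continuous fun y : E3 => (y, s)))
    (hcw.comp (by fun_prop : Continuous fun y : E3 => (y, s))) x (t - s)).symm

/-- The main linear estimate applied to differences of the nonlinearity. -/
theorem duhamel_lipschitz {γ R : ℝ} (hγ₀ : 0 < γ) (hγ : γ < 3) (hR : 1 ≤ R) :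
    ∃ C : ℝ, 0 < C ∧ ∀ (u w : E3 → ℝ → ℝ) (A D : ℝ), 0 ≤ A → 0 ≤ D →
      Continuous (fun z : E3 × ℝ => u z.1 z.2) → Continuous (fun z : E3 × ℝ => w z.1 z.2) →
      (∀ y s, max s 0 + R < ‖y‖ → u y s = 0) → (∀ y s, max s 0 + R < ‖y‖ → w y s = 0) →
      InX γ R A u → InX γ R A w → InX γ R D (fun y s => u y s - w y s) →
      InX γ R (C * (A ^ 2 * D))
        (fun x t => duhamel (cubic γ u) x t - duhamel (cubic γ w) x t) := by
  obtain ⟨C, hC, hnl⟩ := nonlinear_bound hγ₀ hγ hR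
  have hN := isWeight_weightN hγ₀
  set c := Real.log 2 * Real.log 2
  set q := 1 + min γ 1
  have hc := hN.c_pos
  have hq : 0 < q - 1 := by linarith [hN.one_lt]
  have hR0 : 0 < R := by linarith
  refine ⟨R ^ 2 / (2 * c * (q - 1)) * C, by positivity,
    fun u w A D hA hD hu hw hus hws huX hwX huwX => ?_⟩
  have hF0 : ∀ y s, 0 ≤ s → s + R < ‖y‖ → cubic γ u y s - cubic γ w y s = 0 := by
    intro y s hs hy
    rw [cubic, cubic, huX.support y s hs hy, hwX.support y s hs hy]; simp
  have hb : ∀ x t, x ≠ 0 → 0 ≤ t → ‖x‖ ≤ t + R →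
      |duhamel (cubic γ u) x t - duhamel (cubic γ w) x t| ≤
        R ^ 2 / (2 * c * (q - 1)) * C * (A ^ 2 * D) / wt γ R x t := by
    intro x t hx ht hxt
    rw [duhamel_sub hγ₀ hγ hu hw hus hws x ht]
    refine (duhamel_weight_bound hN hR (B := C * (A ^ 2 * D)) (by positivity)
      (fun y s hs hy => ?_) hF0 hx ht hxt).trans (le_of_eq ?_)
    · exact hnl u w A D hA hD (fun s _ => hu.comp (by fun_prop : Continuous fun y : E3 => (y, s)))
        (fun s _ => hw.comp (by fun_prop : Continuous fun y : E3 => (y, s))) huX hwX huwX y s hs hy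
    · rw [wt, mul_assoc (R ^ 2 / _)]
  refine ⟨fun x t ht hxt => ?_, fun x t ht hxt => ?_⟩
  -- The mean formula divides by `‖x‖`, so the origin was excluded; the bound extends to it by
  -- continuity.
  · rcases eq_or_ne x 0 with rfl | hx
    swap
    · exact hb x t hx ht hxt
    have hcu := continuous_duhamel_cubic hγ₀ hγ hu hus
    have hcw := continuous_duhamel_cubic hγ₀ hγ hw hws
    have hc1 : Continuous fun x : E3 => |duhamel (cubic γ u) x t - duhamel (cubic γ w) x t| *
        wtExt γ R (x, t) := by
      have h1 := hcu.comp (by fun_prop : Continuous fun y : E3 => (y, t))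
      have h2 := hcw.comp (by fun_prop : Continuous fun y : E3 => (y, t))
      have h3 := (continuous_wtExt (γ := γ) (R := R)).comp
        (by fun_prop : Continuous fun y : E3 => (y, t))
      simp only [Function.comp_def, max_eq_left ht] at h1 h2 h3
      exact (h1.sub h2).abs.mul h3
    have hw0 := one_le_wt hγ₀ hR ht hxt
    rw [le_div_iff₀ (by linarith), ← wtExt_eq hR ht hxt]
    refine le_of_tendsto (hc1.continuousAt.tendsto.mono_left
      (nhdsWithin_le_nhds (s := {0}ᶜ))) ?_
    have hnear : ∀ᶠ x : E3 in 𝓝[≠] 0, ‖x‖ < t + R :=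
      nhdsWithin_le_nhds (continuous_norm.continuousAt.eventually_lt_const
        (by simp only [norm_zero]; linarith))
    filter_upwards [hnear, self_mem_nhdsWithin] with x hx hx0
    have hw1 := one_le_wt hγ₀ hR ht hx.le
    rw [wtExt_eq hR ht hx.le, ← le_div_iff₀ (by linarith)]
    exact hb x t hx0 ht hx.le
  · rw [duhamel_sub hγ₀ hγ hu hw hus hws x ht, duhamel]
    refine intervalIntegral.integral_zero_ae (.of_forall fun s hs => ?_)
    rw [uIoc_of_le ht] at hs
    rw [W_eq_S, abs_of_nonneg (by linarith [hs.2])]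
    refine S_eq_zero fun ω => ?_
    have h1 := abs_norm_sub_le_norm_add (x := x) (show 0 ≤ t - s by linarith [hs.2]) ω
    have h2 := le_abs_self (‖x‖ - (t - s))
    rw [hF0 _ s hs.1.le (by linarith), zero_div]

/-- The fixed point map. -/
def picard (γ : ℝ) (v₀ v₁ : E3 → ℝ) (u : E3 → ℝ → ℝ) (x : E3) (t : ℝ) : ℝ :=
  freePart v₀ v₁ x (max t 0) + duhamel (cubic γ u) x (max t 0)

theorem continuous_freePart {R ε : ℝ} {v₀ v₁ : E3 → ℝ} (hd : SmallData R ε v₀ v₁) :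
    Continuous fun z : E3 × ℝ => freePart v₀ v₁ z.1 (max z.2 0) := by
  have h1 := (continuous_dS hd.contDiff₀).comp
    (by fun_prop : Continuous fun z : E3 × ℝ => (z.1, max z.2 0))
  have h2 := (continuous_S_snd (hd.contDiff₀.continuous.add hd.continuous₁)).comp
    (by fun_prop : Continuous fun z : E3 × ℝ => (z.1, max z.2 0))
  refine (h1.add h2).congr fun z => ?_
  rw [freePart_eq hd.contDiff₀ _ (le_max_right _ _)]
  rfl

/-- The complete metric space in which the contraction takes place. -/
def solBall (R A : ℝ) : Set (BoundedContinuousFunction (E3 × ℝ) ℝ) :=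
  {U | ‖U‖ ≤ A ∧ ∀ z, max z.2 0 + R < ‖z.1‖ → U z = 0}

theorem isClosed_solBall (R A : ℝ) : IsClosed (solBall R A) := by
  have : solBall R A = {U | ‖U‖ ≤ A} ∩ ⋂ z : E3 × ℝ, ⋂ _ : max z.2 0 + R < ‖z.1‖,
      {U | U z = 0} := by
    ext U
    simp [solBall]
  rw [this]
  exact (isClosed_le continuous_norm continuous_const).inter
    (isClosed_iInter fun z => isClosed_iInter fun _ =>
      isClosed_eq (continuous_eval_const z) continuous_const)

/-- Division by the weight. -/
def unweight (γ R : ℝ) (U : BoundedContinuousFunction (E3 × ℝ) ℝ) (y : E3) (s : ℝ) : ℝ :=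
  U (y, s) / wtExt γ R (y, s)

theorem continuous_unweight {γ R : ℝ} (hγ : 0 < γ) (hR : 1 ≤ R)
    (U : BoundedContinuousFunction (E3 × ℝ) ℝ) :
    Continuous fun z : E3 × ℝ => unweight γ R U z.1 z.2 :=
  U.continuous.div continuous_wtExt fun z => (one_pos.trans_le (one_le_wtExt hγ hR z)).ne'

theorem inX_unweight {γ R A D : ℝ} (hγ : 0 < γ) (hR : 1 ≤ R)
    {U V : BoundedContinuousFunction (E3 × ℝ) ℝ} (hU : U ∈ solBall R A) (hV : V ∈ solBall R A)
    (h : dist U V ≤ D) : InX γ R D (fun y s => unweight γ R U y s - unweight γ R V y s) := by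
  refine ⟨fun y s hs hy => ?_, fun y s hs hy => ?_⟩
  · have hw := one_le_wt hγ hR hs hy
    rw [unweight, unweight, ← sub_div, wtExt_eq hR hs hy, abs_div,
      abs_of_pos (show 0 < wt γ R y s by linarith)]
    gcongr
    exact (U.dist_coe_le_dist (g := V) (y, s)).trans h
  · have h1 := hU.2 (y, s) (by simpa [max_eq_left hs] using hy)
    have h2 := hV.2 (y, s) (by simpa [max_eq_left hs] using hy)
    simp [unweight, h1, h2]

theorem InX.add {γ R A B : ℝ} {u w : E3 → ℝ → ℝ} (hu : InX γ R A u) (hw : InX γ R B w) :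
    InX γ R (A + B) (fun y s => u y s + w y s) :=
  ⟨fun y s hs hy => (abs_add_le _ _).trans (by
    rw [add_div]; exact add_le_add (hu.bound y s hs hy) (hw.bound y s hs hy)),
   fun y s hs hy => by rw [hu.support y s hs hy, hw.support y s hs hy, add_zero]⟩

theorem InX.congr {γ R A : ℝ} {u w : E3 → ℝ → ℝ} (hu : InX γ R A u)
    (h : ∀ y s, 0 ≤ s → w y s = u y s) : InX γ R A w :=
  ⟨fun y s hs hy => by rw [h y s hs]; exact hu.bound y s hs hy,
   fun y s hs hy => by rw [h y s hs]; exact hu.support y s hs hy⟩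

theorem InX.mono {γ R A B : ℝ} (hγ : 0 < γ) (hR : 1 ≤ R) {u : E3 → ℝ → ℝ} (hu : InX γ R A u)
    (h : A ≤ B) : InX γ R B u :=
  ⟨fun y s hs hy => (hu.bound y s hs hy).trans (by
    have := one_le_wt hγ hR hs hy
    gcongr), hu.support⟩

theorem wtExt_mul_abs_le {γ R A : ℝ} (hγ : 0 < γ) (hR : 1 ≤ R) (hA : 0 ≤ A) {u : E3 → ℝ → ℝ}
    (hu : InX γ R A u) (z : E3 × ℝ) : |wtExt γ R z * u z.1 (max z.2 0)| ≤ A := by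
  have hs : 0 ≤ max z.2 0 := le_max_right _ _
  have e : wtExt γ R z = wtExt γ R (z.1, max z.2 0) := by simp [wtExt]
  rw [e]
  by_cases hy : ‖z.1‖ ≤ max z.2 0 + R
  · have hw := one_le_wt hγ hR hs hy
    rw [abs_mul, wtExt_eq hR hs hy, abs_of_pos (by linarith), mul_comm, ← le_div_iff₀ (by linarith)]
    exact hu.bound _ _ hs hy
  · rw [hu.support _ _ hs (not_le.1 hy)]; simpa

theorem exists_fixedPoint {γ R : ℝ} (hγ₀ : 0 < γ) (hγ : γ < 3) (hR : 1 ≤ R) :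
    ∃ ε₀ : ℝ, 0 < ε₀ ∧ ∃ C : ℝ, 0 < C ∧ ∀ (ε : ℝ) (v₀ v₁ : E3 → ℝ), 0 < ε → ε ≤ ε₀ →
      SmallData R ε v₀ v₁ → ∃ u : E3 → ℝ → ℝ, Continuous (fun z : E3 × ℝ => u z.1 z.2) ∧
        InX γ R (C * ε) u ∧ (∀ y s, max s 0 + R < ‖y‖ → u y s = 0) ∧
        ∀ x t, 0 ≤ t → u x t = freePart v₀ v₁ x t + duhamel (cubic γ u) x t := by
  obtain ⟨C₀, hC₀, hfree⟩ := freePart_inX hγ₀ hR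
  obtain ⟨C₁, hC₁, hlip⟩ := duhamel_lipschitz hγ₀ hγ hR
  have hk : 0 < 8 * C₁ * C₀ ^ 2 + 1 := by positivity
  -- In the ball of radius `A = 2C₀ε` the free part uses half of the radius. The Duhamel term has
  -- Lipschitz constant one half once `C₁ A² ≤ 1/2`, that is, `8 C₁ C₀² ε² ≤ 1`. The summand one in
  -- the denominator ensures `ε ≤ 1`, so that a bound on `8 C₁ C₀² ε` is enough.
  refine ⟨1 / (8 * C₁ * C₀ ^ 2 + 1), by positivity, 2 * C₀, by positivity,
    fun ε v₀ v₁ hε hεε hd => ?_⟩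
  set A := 2 * C₀ * ε with hA_def
  have hA : 0 ≤ A := by positivity
  have hsmall : C₁ * A ^ 2 ≤ 1 / 2 := by
    rw [le_div_iff₀ hk] at hεε
    have hε1 : ε ≤ 1 := by nlinarith [mul_pos (mul_pos hC₁ (pow_pos hC₀ 2)) hε]
    have h1 : 8 * C₁ * C₀ ^ 2 * ε ^ 2 ≤ 1 := by
      calc 8 * C₁ * C₀ ^ 2 * ε ^ 2 = (8 * C₁ * C₀ ^ 2 * ε) * ε := by ring
        _ ≤ 1 * 1 := by
            gcongr
            nlinarith
        _ = 1 := by norm_num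
    rw [hA_def]; nlinarith
  have hdiff : ∀ U ∈ solBall R A, ∀ V ∈ solBall R A, ∀ D, dist U V ≤ D →
      InX γ R (1 / 2 * D) (fun x t => duhamel (cubic γ (unweight γ R U)) x t -
        duhamel (cubic γ (unweight γ R V)) x t) := by
    intro U hU V hV D hD
    have hD0 : 0 ≤ D := dist_nonneg.trans hD
    have h0 : (0 : BoundedContinuousFunction (E3 × ℝ) ℝ) ∈ solBall R A := ⟨by simpa, by simp⟩
    have hX : ∀ U ∈ solBall R A, InX γ R A (unweight γ R U) := fun U hU => by
      have := inX_unweight hγ₀ hR hU h0 (D := A) (by rw [dist_zero_right]; exact hU.1)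
      refine this.congr fun y s _ => ?_
      simp [unweight]
    have hs : ∀ U ∈ solBall R A, ∀ y s, max s 0 + R < ‖y‖ → unweight γ R U y s = 0 :=
      fun U hU y s h => by rw [unweight, hU.2 (y, s) h, zero_div]
    refine (hlip _ _ A D hA hD0 (continuous_unweight hγ₀ hR U) (continuous_unweight hγ₀ hR V)
      (hs U hU) (hs V hV) (hX U hU) (hX V hV) (inX_unweight hγ₀ hR hU hV hD)).mono hγ₀ hR ?_
    rw [← mul_assoc]
    gcongr
  have h0 : (0 : BoundedContinuousFunction (E3 × ℝ) ℝ) ∈ solBall R A := ⟨by simpa, by simp⟩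
  have hzero : ∀ x t, duhamel (cubic γ (unweight γ R 0)) x t = 0 := by
    intro x t
    simp [duhamel, cubic, unweight, W]
  have hpic : ∀ U ∈ solBall R A, InX γ R A (fun x t => freePart v₀ v₁ x t +
      duhamel (cubic γ (unweight γ R U)) x t) := by
    intro U hU
    -- The nonlinearity vanishes at zero, so the self-mapping property is the difference estimate
    -- against `0`.
    have h1 := hdiff U hU 0 h0 A (by rw [dist_zero_right]; exact hU.1)
    have h2 := (hfree ε v₀ v₁ hd).add h1
    refine (h2.mono hγ₀ hR (B := A) (by rw [hA_def]; linarith)).congr fun y s _ => ?_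
    rw [hzero, sub_zero]
  have hs : ∀ U ∈ solBall R A, ∀ y s, max s 0 + R < ‖y‖ → unweight γ R U y s = 0 :=
    fun U hU y s h => by rw [unweight, hU.2 (y, s) h, zero_div]
  -- The unknown is the product of `u` with the extended weight. The norm of `X` becomes the sup
  -- norm, and completeness is inherited from the bounded continuous functions.
  let Ψ : solBall R A → solBall R A := fun U =>
    ⟨BoundedContinuousFunction.ofNormedAddCommGroup
      (fun z => wtExt γ R z * picard γ v₀ v₁ (unweight γ R U) z.1 z.2)
      (continuous_wtExt.mul ((continuous_freePart hd).add
        (continuous_duhamel_cubic hγ₀ hγ (continuous_unweight hγ₀ hR U.1) (hs U.1 U.2)))) A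
      (fun z => wtExt_mul_abs_le hγ₀ hR hA (hpic U.1 U.2) z),
    BoundedContinuousFunction.norm_ofNormedAddCommGroup_le _ hA _, fun z hz => by
      have := (hpic U.1 U.2).support z.1 (max z.2 0) (le_max_right _ _) hz
      simp only [BoundedContinuousFunction.coe_ofNormedAddCommGroup, picard]
      rw [this, mul_zero]⟩
  have hΨ : ContractingWith (1 / 2) Ψ := by
    refine ⟨by rw [div_lt_one] <;> norm_num, LipschitzWith.of_dist_le_mul fun U V => ?_⟩
    rw [Subtype.dist_eq, BoundedContinuousFunction.dist_le (by positivity)]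
    intro z
    have h1 := wtExt_mul_abs_le hγ₀ hR (by positivity)
      (hdiff U.1 U.2 V.1 V.2 (dist U V) le_rfl) z
    have h2 : (Ψ U).1 z - (Ψ V).1 z = wtExt γ R z *
        (duhamel (cubic γ (unweight γ R U)) z.1 (max z.2 0) -
          duhamel (cubic γ (unweight γ R V)) z.1 (max z.2 0)) := by
      simp only [Ψ, BoundedContinuousFunction.coe_ofNormedAddCommGroup, picard]
      ring
    rw [Real.dist_eq, h2]
    simpa using h1
  have : CompleteSpace (solBall R A) := (isClosed_solBall R A).completeSpace_coe
  have : Nonempty (solBall R A) := ⟨⟨0, h0⟩⟩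
  let U := hΨ.fixedPoint
  have hU : Ψ U = U := hΨ.fixedPoint_isFixedPt
  refine ⟨unweight γ R U, continuous_unweight hγ₀ hR U, ?_, hs U.1 U.2, fun x t ht => ?_⟩
  · have := inX_unweight hγ₀ hR U.2 h0 (D := A) (by rw [dist_zero_right]; exact U.2.1)
    refine this.congr fun y s _ => ?_
    simp [unweight]
  · have h1 : (Ψ U).1 (x, t) = U.1 (x, t) := by rw [hU]
    simp only [Ψ, BoundedContinuousFunction.coe_ofNormedAddCommGroup, picard, max_eq_left ht] at h1
    have hw : wtExt γ R (x, t) ≠ 0 := (one_pos.trans_le (one_le_wtExt hγ₀ hR (x, t))).ne'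
    rw [unweight, ← h1, mul_div_cancel_left₀ _ hw]

/-! ### Gronwall argument, finite speed of propagation and uniqueness. -/

theorem duhamel_congr {F F' : E3 → ℝ → ℝ} {t : ℝ} (ht : 0 ≤ t)
    (h : ∀ y, ∀ s ∈ Icc 0 t, F y s = F' y s) (x : E3) : duhamel F x t = duhamel F' x t := by
  refine intervalIntegral.integral_congr fun s hs => ?_
  rw [uIcc_of_le ht] at hs
  simp only [h _ s hs]

theorem conv_congr {γ : ℝ} {u w : E3 → ℝ → ℝ} {s : ℝ} (h : ∀ y, u y s = w y s) (x : E3) :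
    conv γ u x s = conv γ w x s := by
  simp only [conv, h]

theorem cubic_congr {γ : ℝ} {u w : E3 → ℝ → ℝ} {s : ℝ} (h : ∀ y, u y s = w y s) (x : E3) :
    cubic γ u x s = cubic γ w x s := by
  rw [cubic, cubic, conv_congr h, h]

theorem integral_sub_mul_exp_le {L t : ℝ} (hL : 0 < L) (ht : 0 ≤ t) :
    ∫ s in (0 : ℝ)..t, (t - s) * Real.exp (L * s) ≤ Real.exp (L * t) / L ^ 2 := by
  have hd : ∀ s : ℝ, HasDerivAt (fun s => (t - s) * Real.exp (L * s) / L + Real.exp (L * s) / L ^ 2)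
      ((t - s) * Real.exp (L * s)) s := by
    intro s
    have h1 : HasDerivAt (fun s => Real.exp (L * s)) (Real.exp (L * s) * L) s := by
      simpa using ((hasDerivAt_id s).const_mul L).exp
    have h2 : HasDerivAt (fun s => t - s) (-1) s := by
      simpa using (hasDerivAt_id s).const_sub t
    refine (((h2.mul h1).div_const L).add (h1.div_const (L ^ 2))).congr_deriv ?_
    field_simp
    ring
  rw [intervalIntegral.integral_eq_sub_of_hasDerivAt (fun s _ => hd s)
    (Continuous.intervalIntegrable (by fun_prop) _ _)]
  have : 0 ≤ t / L := by positivity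
  have h3 : 0 ≤ 1 / L ^ 2 := by positivity
  simp only [sub_self, zero_mul, zero_div, zero_add, sub_zero, mul_zero, Real.exp_zero, mul_one]
  linarith

/-- A Gronwall inequality for the Duhamel operator on a set that is closed under passing to
backward characteristic cones. -/
theorem eq_zero_of_le_duhamel {D : Set (E3 × ℝ)} (hD0 : ∀ z ∈ D, 0 ≤ z.2)
    (hcone : ∀ x t, (x, t) ∈ D → ∀ s ∈ Ioc 0 t, ∀ ω : S2, (x + (t - s) • (ω : E3), s) ∈ D)
    {f g : E3 → ℝ → ℝ} {C M : ℝ} (hC : 0 ≤ C) (hM0 : 0 ≤ M) (hM : ∀ z ∈ D, |f z.1 z.2| ≤ M)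
    (hfg : ∀ z ∈ D, |f z.1 z.2| ≤ |duhamel g z.1 z.2|)
    (hg : ∀ B L, 0 ≤ B → (∀ z ∈ D, |f z.1 z.2| ≤ B * Real.exp (L * z.2)) →
      ∀ z ∈ D, |g z.1 z.2| ≤ C * (B * Real.exp (L * z.2))) :
    ∀ z ∈ D, f z.1 z.2 = 0 := by
  -- With respect to `exp (L t)` one application of the Duhamel operator gains `C / L²`, by
  -- `integral_sub_mul_exp_le`. This choice of `L` makes the gain at most one half.
  set L := 2 * C + 1
  have hL : 0 < L := by positivity
  have hCL : C / L ^ 2 ≤ 1 / 2 := by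
    rw [div_le_div_iff₀ (by positivity) two_pos]; simp only [L]; nlinarith
  have key : ∀ n : ℕ, ∀ z ∈ D, |f z.1 z.2| ≤ M * (1 / 2) ^ n * Real.exp (L * z.2) := by
    intro n
    induction n with
    | zero =>
      intro z hz
      rw [pow_zero, mul_one]
      refine (hM z hz).trans (le_mul_of_one_le_right hM0 (Real.one_le_exp ?_))
      have := hD0 z hz
      positivity
    | succ n ih =>
      rintro ⟨x, t⟩ hz
      have ht : 0 ≤ t := hD0 _ hz
      have h1 := hg _ L (by positivity) ih
      set B := M * (1 / 2) ^ n with hB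
      have hB0 : 0 ≤ B := by positivity
      refine (hfg _ hz).trans ?_
      have h2 : ‖duhamel g x t‖ ≤ ∫ s in (0 : ℝ)..t, C * B * ((t - s) * Real.exp (L * s)) := by
        refine intervalIntegral.norm_integral_le_of_norm_le ht (.of_forall fun s hs => ?_)
          (Continuous.intervalIntegrable (by fun_prop) _ _)
        have hts : 0 ≤ t - s := by linarith [hs.2]
        rw [W_eq_S, abs_of_nonneg hts, Real.norm_eq_abs]
        refine (abs_S_le (B := C * (B * Real.exp (L * s))) fun ω => ?_).trans (le_of_eq ?_)
        · have h3 := h1 _ (hcone x t hz s hs ω)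
          have h4 : 1 ≤ (1 + s) ^ 2 := one_le_pow₀ (by linarith [hs.1])
          rw [abs_div, abs_of_pos (show 0 < (1 + s) ^ 2 by positivity)]
          exact (div_le_self (abs_nonneg _) h4).trans h3
        · rw [abs_of_nonneg hts]; ring
      rw [Real.norm_eq_abs, intervalIntegral.integral_const_mul] at h2
      refine h2.trans ?_
      calc _ ≤ C * B * (Real.exp (L * t) / L ^ 2) := by
            gcongr; exact integral_sub_mul_exp_le hL ht
        _ = B * (C / L ^ 2) * Real.exp (L * t) := by ring
        _ ≤ B * (1 / 2) * Real.exp (L * t) := by gcongr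
        _ = _ := by rw [hB]; ring
  intro z hz
  have hlim : Tendsto (fun n : ℕ => M * (1 / 2) ^ n * Real.exp (L * z.2)) atTop (𝓝 0) := by
    have := ((tendsto_pow_atTop_nhds_zero_of_lt_one (show (0 : ℝ) ≤ 1 / 2 by norm_num)
      (by norm_num)).const_mul M).mul_const (Real.exp (L * z.2))
    simpa using this
  exact abs_eq_zero.1 (le_antisymm (ge_of_tendsto' hlim fun n => key n z hz) (abs_nonneg _))

theorem mem_slab_of_le {T : ℝ≥0∞} {t s : ℝ} (hs : 0 ≤ s) (hst : s ≤ t)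
    (ht : ENNReal.ofReal t < T) (x : E3) : (x, s) ∈ slab T :=
  ⟨hs, (ENNReal.ofReal_le_ofReal hst).trans_lt ht⟩

/-- Finite speed of propagation. -/
theorem IsSolution.support {γ R ε : ℝ} {v₀ v₁ : E3 → ℝ} (hd : SmallData R ε v₀ v₁) {T : ℝ≥0∞}
    {w : E3 → ℝ → ℝ} (hw : IsSolution γ v₀ v₁ T w) {x : E3} {t : ℝ} (hz : (x, t) ∈ slab T)
    (hx : t + R < ‖x‖) : w x t = 0 := by
  have ht : 0 ≤ t := hz.1
  -- The solid backward cone is compact, so `locallyBounded` makes the nonlocal factor a bounded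
  -- potential on it. The equation is then linear in `w`, and values of `w` outside the cone enter
  -- only through that potential.
  set D : Set (E3 × ℝ) := {z | 0 ≤ z.2 ∧ z.2 ≤ t ∧ ‖z.1 - x‖ ≤ t - z.2}
  have hDs : D ⊆ slab T := fun z hzD => mem_slab_of_le hzD.1 hzD.2.1 hz.2 z.1
  have hDc : IsCompact D := by
    have hcl : IsClosed D := by
      have h1 : IsClosed {z : E3 × ℝ | ‖z.1 - x‖ ≤ t - z.2} :=
        isClosed_le (by fun_prop) (by fun_prop)
      exact (isClosed_le continuous_const continuous_snd).inter
        ((isClosed_le continuous_snd continuous_const).inter h1)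
    refine ((isCompact_closedBall x t).prod (isCompact_Icc (a := 0) (b := t))).of_isClosed_subset
      hcl fun z hzD => ⟨?_, hzD.1, hzD.2.1⟩
    rw [Metric.mem_closedBall, dist_eq_norm]
    linarith [hzD.1, hzD.2.2]
  obtain ⟨C, hC⟩ := hw.locallyBounded D hDc hDs
  obtain ⟨M, hM⟩ := hDc.exists_bound_of_continuousOn (hw.continuousOn.mono hDs)
  have hxD : (x, t) ∈ D := ⟨ht, le_rfl, by simp⟩
  refine eq_zero_of_le_duhamel (D := D) (f := w) (g := cubic γ w) (C := max C 0) (M := M)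
    (fun z hz => hz.1) ?_ (le_max_right _ _) ((norm_nonneg _).trans (hM _ hxD)) hM ?_ ?_ (x, t) hxD
  · intro y r hy s hs ω
    refine ⟨hs.1.le, hs.2.trans hy.2.1, ?_⟩
    have h1 : ‖(r - s) • (ω : E3)‖ = r - s := by
      rw [norm_smul, Real.norm_of_nonneg (by linarith [hs.2])]; simp
    have h2 := norm_add_le (y - x) ((r - s) • (ω : E3))
    have h3 : y + (r - s) • (ω : E3) - x = (y - x) + (r - s) • (ω : E3) := by abel
    have h4 := hy.2.2
    simp only at h4 ⊢
    rw [h3]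
    linarith
  · intro z hz
    have h1 : freePart v₀ v₁ z.1 z.2 = 0 := by
      refine freePart_eq_zero hd hz.1 (lt_of_lt_of_le ?_ (le_abs_self _))
      have := norm_le_norm_add_norm_sub' x z.1
      rw [norm_sub_rev] at this
      linarith [hz.2.2]
    rw [hw.equation z (hDs hz), h1, zero_add]
    rfl
  · intro B L hB h z hz
    rw [cubic, abs_mul, abs_of_nonneg (conv_nonneg _ _ _ _)]
    have h1 := h z hz
    have h2 := (hC z hz).trans (le_max_left C 0)
    have := conv_nonneg γ w z.1 z.2
    gcongr

/-- A function on a slab, frozen outside of `[0, b]`. -/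
def clamp (b : ℝ) (u : E3 → ℝ → ℝ) (y : E3) (s : ℝ) : ℝ := u y (min (max s 0) b)

theorem clamp_eq {b : ℝ} (u : E3 → ℝ → ℝ) (y : E3) {s : ℝ} (hs : s ∈ Icc 0 b) :
    clamp b u y s = u y s := by
  rw [clamp, max_eq_left hs.1, min_eq_left hs.2]

theorem continuous_clamp {b : ℝ} (hb : 0 ≤ b) {T : ℝ≥0∞} (hbT : ENNReal.ofReal b < T)
    {u : E3 → ℝ → ℝ} (hu : ContinuousOn (fun z : E3 × ℝ => u z.1 z.2) (slab T)) :
    Continuous fun z : E3 × ℝ => clamp b u z.1 z.2 :=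
  hu.comp_continuous (by fun_prop : Continuous fun z : E3 × ℝ => (z.1, min (max z.2 0) b))
    fun z => mem_slab_of_le (le_min (le_max_right _ _) hb) (min_le_right _ _) hbT z.1

theorem clamp_support {γ R ε : ℝ} {v₀ v₁ : E3 → ℝ} (hd : SmallData R ε v₀ v₁) {T : ℝ≥0∞}
    {w : E3 → ℝ → ℝ} (hw : IsSolution γ v₀ v₁ T w) {b : ℝ} (hb : 0 ≤ b)
    (hbT : ENNReal.ofReal b < T) (y : E3) (s : ℝ) (h : max s 0 + R < ‖y‖) : clamp b w y s = 0 :=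
  hw.support hd (mem_slab_of_le (le_min (le_max_right _ _) hb) (min_le_right _ _) hbT y)
    (lt_of_le_of_lt (by gcongr; exact min_le_left _ _) h)

theorem IsSolution.mono {γ : ℝ} {v₀ v₁ : E3 → ℝ} {T T' : ℝ≥0∞} {u : E3 → ℝ → ℝ}
    (hu : IsSolution γ v₀ v₁ T u) (h : T' ≤ T) : IsSolution γ v₀ v₁ T' u := by
  have hs : slab T' ⊆ slab T := fun z hz => ⟨hz.1, hz.2.trans_le h⟩
  exact ⟨hu.continuousOn.mono hs, fun z hz => hu.integrable z (hs hz),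
    fun K hK hKs => hu.locallyBounded K hK (hKs.trans hs), fun z hz => hu.equation z (hs hz)⟩

theorem abs_conv_sub_le {γ : ℝ} (hγ₀ : 0 < γ) (hγ : γ < 3) (a : ℝ) :
    ∃ K : ℝ, 0 ≤ K ∧ ∀ (f g : E3 → ℝ) (M B : ℝ), 0 ≤ B → Continuous f → Continuous g →
      (∀ y, f y ≠ 0 → ‖y‖ ≤ a) → (∀ y, g y ≠ 0 → ‖y‖ ≤ a) → (∀ y, |f y| ≤ M) → (∀ y, |g y| ≤ M) →
      (∀ y, |f y - g y| ≤ B) → ∀ x,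
      |(∫ y : E3, ‖x - y‖ ^ (-γ) * f y ^ 2) - ∫ y : E3, ‖x - y‖ ^ (-γ) * g y ^ 2| ≤
        K * (2 * M * B) := by
  obtain ⟨K, hK, h⟩ := abs_integral_kernel_le hγ₀ hγ a
  refine ⟨K, hK, fun f g M B hB hf hg hfs hgs hfM hgM hfg x => ?_⟩
  have hM : 0 ≤ M := (abs_nonneg _).trans (hfM 0)
  have hfs' : ∀ y, f y ^ 2 ≠ 0 → ‖y‖ ≤ a := fun y hy => hfs y fun h => hy (by simp [h])
  have hgs' : ∀ y, g y ^ 2 ≠ 0 → ‖y‖ ≤ a := fun y hy => hgs y fun h => hy (by simp [h])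
  rw [← integral_sub (integrable_conv hγ₀ hγ (f := fun y => f y ^ 2) (hf.pow 2) hfs' x)
    (integrable_conv hγ₀ hγ (f := fun y => g y ^ 2) (hg.pow 2) hgs' x)]
  simp only [← mul_sub]
  refine h (fun y => f y ^ 2 - g y ^ 2) (2 * M * B) (by positivity) (fun y hy => ?_) (fun y => ?_) x
  · by_contra hn
    have h1 : f y = 0 := by by_contra h; exact hn (hfs y h)
    have h2 : g y = 0 := by by_contra h; exact hn (hgs y h)
    exact hy (by simp [h1, h2])
  · rw [sq_sub_sq, abs_mul]
    have h1 := (abs_add_le (f y) (g y)).trans (add_le_add (hfM y) (hgM y))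
    have h2 := hfg y
    calc _ ≤ (M + M) * B := by gcongr
      _ = _ := by ring

/-- Finite speed of propagation confines both solutions to a fixed ball during `[0, b]`, where they
are bounded. The nonlinearity is then Lipschitz in the sup norm, and the Gronwall argument applies
to the difference on the whole strip. -/
theorem IsSolution.unique {γ R ε : ℝ} (hγ₀ : 0 < γ) (hγ : γ < 3) {v₀ v₁ : E3 → ℝ}
    (hd : SmallData R ε v₀ v₁) {T : ℝ≥0∞} {u w : E3 → ℝ → ℝ} (hu : IsSolution γ v₀ v₁ T u)
    (hw : IsSolution γ v₀ v₁ T w) : ∀ z ∈ slab T, w z.1 z.2 = u z.1 z.2 := by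
  rintro ⟨x₀, b⟩ hz
  have hb : 0 ≤ b := hz.1
  have hbT : ENNReal.ofReal b < T := hz.2
  set p := clamp b w with hp
  set q := clamp b u with hq
  have hpc : Continuous fun z : E3 × ℝ => p z.1 z.2 := continuous_clamp hb hbT hw.continuousOn
  have hqc : Continuous fun z : E3 × ℝ => q z.1 z.2 := continuous_clamp hb hbT hu.continuousOn
  have hps := clamp_support hd hw hb hbT
  have hqs := clamp_support hd hu hb hbT
  obtain ⟨M₁, hM₁⟩ := ((isCompact_closedBall (0 : E3) (b + R)).prod
    (isCompact_Icc (a := 0) (b := b))).exists_bound_of_continuousOn hpc.continuousOn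
  obtain ⟨M₂, hM₂⟩ := ((isCompact_closedBall (0 : E3) (b + R)).prod
    (isCompact_Icc (a := 0) (b := b))).exists_bound_of_continuousOn hqc.continuousOn
  set M := max (max M₁ M₂) 0
  have hM0 : 0 ≤ M := le_max_right _ _
  have hsupp : ∀ (r : E3 → ℝ → ℝ), (∀ y s, max s 0 + R < ‖y‖ → r y s = 0) →
      ∀ s ∈ Icc 0 b, ∀ y, r y s ≠ 0 → ‖y‖ ≤ b + R := by
    intro r hr s hs y hy
    by_contra hn
    exact hy (hr y s (by rw [max_eq_left hs.1]; linarith [hs.2]))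
  have hpM : ∀ s ∈ Icc 0 b, ∀ y, |p y s| ≤ M := by
    intro s hs y
    by_cases hy : p y s = 0
    · rw [hy, abs_zero]; exact hM0
    · exact (hM₁ (y, s) ⟨by simpa using hsupp p hps s hs y hy, hs⟩).trans
        ((le_max_left _ _).trans (le_max_left _ _))
  have hqM : ∀ s ∈ Icc 0 b, ∀ y, |q y s| ≤ M := by
    intro s hs y
    by_cases hy : q y s = 0
    · rw [hy, abs_zero]; exact hM0
    · exact (hM₂ (y, s) ⟨by simpa using hsupp q hqs s hs y hy, hs⟩).trans
        ((le_max_right _ _).trans (le_max_left _ _))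
  obtain ⟨K, hK, hconv⟩ := abs_conv_sub_le hγ₀ hγ (b + R)
  set D : Set (E3 × ℝ) := {z | 0 ≤ z.2 ∧ z.2 ≤ b}
  have hpcs : ∀ s, Continuous fun y => p y s := fun s =>
    hpc.comp (by fun_prop : Continuous fun y : E3 => (y, s))
  have hqcs : ∀ s, Continuous fun y => q y s := fun s =>
    hqc.comp (by fun_prop : Continuous fun y : E3 => (y, s))
  -- The constant `4 * K * M ^ 2` collects `2KM · M` from the difference of the convolutions and
  -- `2KM²` from the difference of the remaining factors.
  have hmain := eq_zero_of_le_duhamel (D := D) (f := fun x t => p x t - q x t)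
    (g := fun x t => cubic γ p x t - cubic γ q x t) (C := 4 * K * M ^ 2) (M := 2 * M)
    (fun z hz => hz.1) (fun x t hz s hs ω => ⟨hs.1.le, hs.2.trans hz.2⟩) (by positivity)
    (by positivity) (fun z hz => ?_) (fun z hz => ?_) (fun B L hB h z hz => ?_) (x₀, b) ⟨hb, le_rfl⟩
  · have h1 := clamp_eq w x₀ (show b ∈ Icc 0 b from ⟨hb, le_rfl⟩)
    have h2 := clamp_eq u x₀ (show b ∈ Icc 0 b from ⟨hb, le_rfl⟩)
    simp only [hp, hq] at hmain
    rw [h1, h2] at hmain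
    exact sub_eq_zero.1 hmain
  · refine (abs_sub _ _).trans ?_
    linarith [hpM z.2 hz z.1, hqM z.2 hz z.1]
  · have e1 := hw.equation z (mem_slab_of_le hz.1 hz.2 hbT z.1)
    have e2 := hu.equation z (mem_slab_of_le hz.1 hz.2 hbT z.1)
    have e3 : duhamel (fun y s => conv γ w y s * w y s) z.1 z.2 = duhamel (cubic γ p) z.1 z.2 :=
      duhamel_congr hz.1 (fun y s hs => cubic_congr (γ := γ) (fun y =>
        (clamp_eq w y ⟨hs.1, hs.2.trans hz.2⟩).symm) y) z.1
    have e4 : duhamel (fun y s => conv γ u y s * u y s) z.1 z.2 = duhamel (cubic γ q) z.1 z.2 :=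
      duhamel_congr hz.1 (fun y s hs => cubic_congr (γ := γ) (fun y =>
        (clamp_eq u y ⟨hs.1, hs.2.trans hz.2⟩).symm) y) z.1
    rw [← duhamel_sub hγ₀ hγ hpc hqc hps hqs z.1 hz.1]
    have e5 : p z.1 z.2 = w z.1 z.2 := clamp_eq w z.1 hz
    have e6 : q z.1 z.2 = u z.1 z.2 := clamp_eq u z.1 hz
    rw [e5, e6, e1, e2, e3, e4, add_sub_add_left_eq_sub]
  · set E := B * Real.exp (L * z.2)
    have hE : 0 ≤ E := by positivity
    have h1 : ∀ y, |p y z.2 - q y z.2| ≤ E := fun y => h (y, z.2) hz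
    have h2 : |conv γ p z.1 z.2 - conv γ q z.1 z.2| ≤ K * (2 * M * E) :=
      hconv (fun y => p y z.2) (fun y => q y z.2) M E hE (hpcs _) (hqcs _)
        (hsupp p hps z.2 hz) (hsupp q hqs z.2 hz) (hpM z.2 hz) (hqM z.2 hz) h1 z.1
    have h3 : |conv γ q z.1 z.2| ≤ K * (2 * M * M) := by
      have h4 := hconv (fun y => q y z.2) (fun _ => 0) M M hM0 (hqcs _) continuous_const
        (hsupp q hqs z.2 hz) (fun y hy => absurd rfl hy) (hqM z.2 hz) (fun y => by simpa)
        (fun y => by simpa using hqM z.2 hz y) z.1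
      simpa [conv] using h4
    have h5 : cubic γ p z.1 z.2 - cubic γ q z.1 z.2 = (conv γ p z.1 z.2 - conv γ q z.1 z.2) *
        p z.1 z.2 + conv γ q z.1 z.2 * (p z.1 z.2 - q z.1 z.2) := by
      rw [cubic, cubic]; ring
    rw [h5]
    refine (abs_add_le _ _).trans ?_
    rw [abs_mul, abs_mul]
    calc _ ≤ K * (2 * M * E) * M + K * (2 * M * M) * E := by
          gcongr
          · exact hpM z.2 hz z.1
          · exact h1 z.1
      _ = _ := by ring

/-! ### Rotations of the sphere and the Euler–Poisson–Darboux identity. -/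

/-- The rotation by the angle `θ` in the plane of the `i`-th and the `j`-th axis. -/
def rotFun (i j : Fin 3) (θ : ℝ) (y : E3) : E3 :=
  y + (Real.cos θ - 1) • (y i • EuclideanSpace.single i (1 : ℝ) +
    y j • EuclideanSpace.single j (1 : ℝ)) +
    Real.sin θ • (y i • EuclideanSpace.single j (1 : ℝ) - y j • EuclideanSpace.single i (1 : ℝ))

theorem norm_rotFun {i j : Fin 3} (hij : i ≠ j) (θ : ℝ) (y : E3) : ‖rotFun i j θ y‖ = ‖y‖ := by
  rw [← sq_eq_sq₀ (norm_nonneg _) (norm_nonneg _), norm_sq_coords, norm_sq_coords]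
  have h := Real.sin_sq_add_cos_sq θ
  have hs : Real.sin θ ^ 2 = 1 - Real.cos θ ^ 2 := by linarith
  fin_cases i <;> fin_cases j <;> simp [rotFun] at hij ⊢ <;> ring_nf <;> rw [hs] <;> ring

theorem exists_rotation {i j : Fin 3} (hij : i ≠ j) (θ : ℝ) :
    ∃ L : E3 ≃ₗᵢ[ℝ] E3, ∀ y, L y = rotFun i j θ y := by
  let L : E3 →ₗᵢ[ℝ] E3 :=
    { toFun := rotFun i j θ
      map_add' := fun x y => by
        simp only [rotFun, PiLp.add_apply]; module
      map_smul' := fun c y => by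
        simp only [rotFun, PiLp.smul_apply, smul_eq_mul, RingHom.id_apply]; module
      norm_map' := norm_rotFun hij θ }
  exact ⟨L.toLinearIsometryEquiv rfl, fun y => rfl⟩

theorem hasDerivAt_comp_path {φ : E3 × ℝ → ℝ} (hφ : ContDiff ℝ 2 φ) {c : ℝ → E3 × ℝ}
    {c' : E3 × ℝ} {θ : ℝ} (hc : HasDerivAt c c' θ) :
    HasDerivAt (fun θ => φ (c θ)) (fderiv ℝ φ (c θ) c') θ :=
  ((hφ.differentiable two_ne_zero _).hasFDerivAt).comp_hasDerivAt θ hc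

theorem hasDerivAt_fderiv_comp_path {φ : E3 × ℝ → ℝ} (hφ : ContDiff ℝ 2 φ) {c v : ℝ → E3 × ℝ}
    {c' v' : E3 × ℝ} {θ : ℝ} (hc : HasDerivAt c c' θ) (hv : HasDerivAt v v' θ) :
    HasDerivAt (fun θ => fderiv ℝ φ (c θ) (v θ))
      (fderiv ℝ (fderiv ℝ φ) (c θ) c' (v θ) + fderiv ℝ φ (c θ) v') θ := by
  have h1 : Differentiable ℝ (fderiv ℝ φ) :=
    (hφ.fderiv_right (m := 1) (by norm_num)).differentiable one_ne_zero
  exact ((h1 _).hasFDerivAt.comp_hasDerivAt θ hc).clm_apply hv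

theorem continuous_fderiv_fderiv {φ : E3 × ℝ → ℝ} (hφ : ContDiff ℝ 2 φ) :
    Continuous (fderiv ℝ (fderiv ℝ φ)) :=
  (hφ.fderiv_right (m := 1) (by norm_num)).continuous_fderiv one_ne_zero

/-- The infinitesimal rotation. -/
def rotGen (i j : Fin 3) (y : E3) : E3 :=
  y i • EuclideanSpace.single j (1 : ℝ) - y j • EuclideanSpace.single i (1 : ℝ)

/-- The projection to the plane of rotation. -/
def rotProj (i j : Fin 3) (y : E3) : E3 :=
  y i • EuclideanSpace.single i (1 : ℝ) + y j • EuclideanSpace.single j (1 : ℝ)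

/-- The mean over a sphere is unchanged when the sphere is rotated by `θ`; the identity is the
second derivative of this at `θ = 0`. The velocity of the rotation yields the second-order term, its
centripetal acceleration the first-order term. -/
theorem integral_rotation {φ : E3 × ℝ → ℝ} (hφ : ContDiff ℝ 2 φ) {i j : Fin 3} (hij : i ≠ j)
    (y : E3) (t τ : ℝ) :
    ∫ ω : S2, (τ ^ 2 * fderiv ℝ (fderiv ℝ φ) (y + τ • (ω : E3), t)
      (rotGen i j ω, 0) (rotGen i j ω, 0) -
      τ * fderiv ℝ φ (y + τ • (ω : E3), t) (rotProj i j ω, 0)) ∂surf = 0 := by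
  have hD2 := continuous_fderiv_fderiv hφ
  have hD1 : Continuous (fderiv ℝ φ) := hφ.continuous_fderiv two_ne_zero
  have hφc := hφ.continuous
  let r' : ℝ → E3 → E3 := fun θ ω => -Real.sin θ • rotProj i j ω + Real.cos θ • rotGen i j ω
  let r'' : ℝ → E3 → E3 := fun θ ω => -Real.cos θ • rotProj i j ω - Real.sin θ • rotGen i j ω
  let c : ℝ → E3 → E3 × ℝ := fun θ ω => (y + τ • rotFun i j θ ω, t)
  have hr : ∀ θ ω, HasDerivAt (fun θ => rotFun i j θ ω) (r' θ ω) θ := by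
    intro θ ω
    have h1 := ((Real.hasDerivAt_cos θ).sub_const 1).smul_const (rotProj i j ω)
    have h2 := (Real.hasDerivAt_sin θ).smul_const (rotGen i j ω)
    exact (h1.const_add ω).add h2
  have hr' : ∀ θ ω, HasDerivAt (fun θ => r' θ ω) (r'' θ ω) θ := by
    intro θ ω
    have h1 := ((Real.hasDerivAt_sin θ).neg).smul_const (rotProj i j ω)
    have h2 := (Real.hasDerivAt_cos θ).smul_const (rotGen i j ω)
    refine (h1.add h2).congr_deriv ?_
    simp only [r'', neg_smul]
    abel
  have hc : ∀ θ ω, HasDerivAt (fun θ => c θ ω) ((τ • r' θ ω, 0) : E3 × ℝ) θ := fun θ ω =>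
    (((hr θ ω).const_smul τ).const_add y).prodMk (hasDerivAt_const θ t)
  have hv : ∀ θ ω, HasDerivAt (fun θ => ((τ • r' θ ω, 0) : E3 × ℝ)) ((τ • r'' θ ω, 0) : E3 × ℝ) θ :=
    fun θ ω => ((hr' θ ω).const_smul τ).prodMk (hasDerivAt_const θ 0)
  have hcoord : ∀ k : Fin 3, Continuous fun p : ℝ × E3 => p.2 k := fun k => by fun_prop
  have hcrot : Continuous fun p : ℝ × E3 => rotFun i j p.1 p.2 := by
    unfold rotFun; fun_prop
  have hcr' : Continuous fun p : ℝ × E3 => r' p.1 p.2 := by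
    simp only [r', rotProj, rotGen]; fun_prop
  have hcr'' : Continuous fun p : ℝ × E3 => r'' p.1 p.2 := by
    simp only [r'', rotProj, rotGen]; fun_prop
  have hcc : Continuous fun p : ℝ × E3 => c p.1 p.2 := by
    simp only [c]; fun_prop
  let f : ℝ → E3 → ℝ := fun θ ω => φ (c θ ω)
  let f' : ℝ → E3 → ℝ := fun θ ω => fderiv ℝ φ (c θ ω) (τ • r' θ ω, 0)
  let f'' : ℝ → E3 → ℝ := fun θ ω => fderiv ℝ (fderiv ℝ φ) (c θ ω) (τ • r' θ ω, 0)
    (τ • r' θ ω, 0) + fderiv ℝ φ (c θ ω) (τ • r'' θ ω, 0)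
  have hf : Continuous (Function.uncurry f) := hφc.comp hcc
  have hf' : Continuous (Function.uncurry f') :=
    (hD1.comp hcc).clm_apply (by fun_prop : Continuous fun p : ℝ × E3 =>
      ((τ • r' p.1 p.2, 0) : E3 × ℝ))
  have hf'' : Continuous (Function.uncurry f'') :=
    (((hD2.comp hcc).clm_apply (by fun_prop : Continuous fun p : ℝ × E3 =>
      ((τ • r' p.1 p.2, 0) : E3 × ℝ))).clm_apply (by fun_prop : Continuous fun p : ℝ × E3 =>
      ((τ • r' p.1 p.2, 0) : E3 × ℝ))).add ((hD1.comp hcc).clm_apply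
      (by fun_prop : Continuous fun p : ℝ × E3 => ((τ • r'' p.1 p.2, 0) : E3 × ℝ)))
  have hslice : ∀ {g : ℝ → E3 → ℝ}, Continuous (Function.uncurry g) → ∀ θ, Continuous (g θ) :=
    fun hg θ => hg.comp (by fun_prop : Continuous fun y : E3 => (θ, y))
  have d1 : ∀ θ, HasDerivAt (fun θ => ∫ ω : S2, f θ ω ∂surf) (∫ ω : S2, f' θ ω ∂surf) θ :=
    hasDerivAt_sphereMean (hslice hf) hf' fun θ ω => hasDerivAt_comp_path hφ (hc θ ω)
  have d2 : ∀ θ, HasDerivAt (fun θ => ∫ ω : S2, f' θ ω ∂surf) (∫ ω : S2, f'' θ ω ∂surf) θ :=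
    hasDerivAt_sphereMean (hslice hf') hf'' fun θ ω =>
      hasDerivAt_fderiv_comp_path hφ (hc θ ω) (hv θ ω)
  have hconst : ∀ θ, ∫ ω : S2, f θ ω ∂surf = ∫ ω : S2, φ (y + τ • (ω : E3), t) ∂surf := by
    intro θ
    obtain ⟨L, hL⟩ := exists_rotation hij θ
    rw [← surf_integral_isometry L (fun ω => φ (y + τ • ω, t)) (by fun_prop)]
    simp only [f, c, hL]
  have e1 : ∀ θ, ∫ ω : S2, f' θ ω ∂surf = 0 := by
    intro θ
    have h := d1 θ
    simp only [hconst] at h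
    exact h.unique (hasDerivAt_const _ _)
  have e2 : ∫ ω : S2, f'' 0 ω ∂surf = 0 := by
    have h := d2 0
    simp only [e1] at h
    exact h.unique (hasDerivAt_const _ _)
  refine Eq.trans (integral_congr_ae (.of_forall fun ω => ?_)) e2
  have h1 : c 0 ω = (y + τ • (ω : E3), t) := by simp [c, rotFun]
  have h2 : r' 0 ω = rotGen i j ω := by simp [r']
  have h3 : r'' 0 ω = -rotProj i j ω := by simp [r'']
  simp only [f'']
  rw [h1, h2, h3]
  have h4 : ∀ v : E3, ((τ • v, 0) : E3 × ℝ) = τ • ((v, 0) : E3 × ℝ) := fun v => by simp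
  have h5 : ∀ v : E3, ((-v, 0) : E3 × ℝ) = -((v, 0) : E3 × ℝ) := fun v => by simp
  rw [h4, h4, h5]
  simp only [map_smul, map_neg, _root_.smul_apply, smul_eq_mul]
  ring

/-- The spatial Laplacian in terms of the second Fréchet derivative. -/
def lap (φ : E3 × ℝ → ℝ) (z : E3 × ℝ) : ℝ :=
  ∑ i : Fin 3, fderiv ℝ (fderiv ℝ φ) z (EuclideanSpace.single i 1, 0)
    (EuclideanSpace.single i 1, 0)

/-- The three rotation fields at a unit vector `ω` form a Parseval frame of the tangent plane, so
the sum is the trace of `B` without its normal component. -/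
theorem sum_rotGen (B : E3 →L[ℝ] E3 →L[ℝ] ℝ) (ω : E3) (hω : ‖ω‖ = 1) :
    B (rotGen 0 1 ω) (rotGen 0 1 ω) + B (rotGen 0 2 ω) (rotGen 0 2 ω) +
      B (rotGen 1 2 ω) (rotGen 1 2 ω) =
      (∑ i : Fin 3, B (EuclideanSpace.single i 1) (EuclideanSpace.single i 1)) - B ω ω := by
  have h1 : ω = ω 0 • EuclideanSpace.single 0 1 + ω 1 • EuclideanSpace.single 1 1 +
      ω 2 • EuclideanSpace.single 2 1 := by
    ext k; fin_cases k <;> simp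
  have h2 := norm_sq_coords ω
  rw [hω] at h2
  have h3 : B ω ω = B (ω 0 • EuclideanSpace.single 0 1 + ω 1 • EuclideanSpace.single 1 1 +
      ω 2 • EuclideanSpace.single 2 1) (ω 0 • EuclideanSpace.single 0 1 +
      ω 1 • EuclideanSpace.single 1 1 + ω 2 • EuclideanSpace.single 2 1) := by rw [← h1]
  rw [h3, Fin.sum_univ_three]
  simp only [rotGen, map_add, map_sub, map_smul, _root_.add_apply, _root_.sub_apply,
    _root_.smul_apply, smul_eq_mul]
  have h4 : ω 2 ^ 2 = 1 - ω 0 ^ 2 - ω 1 ^ 2 := by linarith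
  ring_nf
  ring_nf at h4
  rw [h4]
  ring

theorem sum_rotProj (ω : E3) : rotProj 0 1 ω + rotProj 0 2 ω + rotProj 1 2 ω = (2 : ℝ) • ω := by
  ext k; fin_cases k <;> simp [rotProj] <;> ring

/-- The Euler–Poisson–Darboux identity for spherical means. -/
theorem integral_euler_poisson_darboux {φ : E3 × ℝ → ℝ} (hφ : ContDiff ℝ 2 φ) (y : E3) (t τ : ℝ) :
    ∫ ω : S2, (τ ^ 2 * (lap φ (y + τ • (ω : E3), t) - fderiv ℝ (fderiv ℝ φ)
      (y + τ • (ω : E3), t) ((ω : E3), 0) ((ω : E3), 0)) -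
      2 * τ * fderiv ℝ φ (y + τ • (ω : E3), t) ((ω : E3), 0)) ∂surf = 0 := by
  have hD2 := continuous_fderiv_fderiv hφ
  have hD1 : Continuous (fderiv ℝ φ) := hφ.continuous_fderiv two_ne_zero
  have hcg : ∀ i j, Continuous (rotGen i j) := fun i j => by unfold rotGen; fun_prop
  have hcp : ∀ i j, Continuous (rotProj i j) := fun i j => by unfold rotProj; fun_prop
  have hint : ∀ i j, Integrable (fun ω : S2 => τ ^ 2 * fderiv ℝ (fderiv ℝ φ) (y + τ • (ω : E3), t)
      (rotGen i j ω, 0) (rotGen i j ω, 0) -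
      τ * fderiv ℝ φ (y + τ • (ω : E3), t) (rotProj i j ω, 0)) surf := by
    intro i j
    have := hcg i j
    have := hcp i j
    refine integrable_sphere (f := fun ω => τ ^ 2 * fderiv ℝ (fderiv ℝ φ) (y + τ • ω, t)
      (rotGen i j ω, 0) (rotGen i j ω, 0) -
      τ * fderiv ℝ φ (y + τ • ω, t) (rotProj i j ω, 0)) ?_
    have c0 : Continuous fun ω : E3 => (y + τ • ω, t) := by fun_prop
    have c1 : Continuous fun ω : E3 => ((rotGen i j ω, 0) : E3 × ℝ) := by fun_prop
    have c2 : Continuous fun ω : E3 => ((rotProj i j ω, 0) : E3 × ℝ) := by fun_prop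
    exact (continuous_const.mul (((hD2.comp c0).clm_apply c1).clm_apply c1)).sub
      (continuous_const.mul ((hD1.comp c0).clm_apply c2))
  have h := (integral_add ((hint 0 1).add (hint 0 2)) (hint 1 2)).trans (congrArg₂ (· + ·)
    (integral_add (hint 0 1) (hint 0 2)) rfl)
  rw [integral_rotation hφ (show (0 : Fin 3) ≠ 1 by decide) y t τ,
    integral_rotation hφ (show (0 : Fin 3) ≠ 2 by decide) y t τ,
    integral_rotation hφ (show (1 : Fin 3) ≠ 2 by decide) y t τ, add_zero, add_zero] at h
  refine Eq.trans (integral_congr_ae (.of_forall fun ω => ?_)) h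
  have hω : ‖(ω : E3)‖ = 1 := by simp
  set z : E3 × ℝ := (y + τ • (ω : E3), t)
  let B : E3 →L[ℝ] E3 →L[ℝ] ℝ := (fderiv ℝ (fderiv ℝ φ) z).bilinearComp
    (ContinuousLinearMap.inl ℝ E3 ℝ) (ContinuousLinearMap.inl ℝ E3 ℝ)
  have h1 := sum_rotGen B ω hω
  have h2 : fderiv ℝ φ z (rotProj 0 1 ω, 0) + fderiv ℝ φ z (rotProj 0 2 ω, 0) +
      fderiv ℝ φ z (rotProj 1 2 ω, 0) = 2 * fderiv ℝ φ z ((ω : E3), 0) := by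
    rw [← map_add, ← map_add, Prod.mk_add_mk, Prod.mk_add_mk, sum_rotProj]
    have : (((2 : ℝ) • (ω : E3), 0 + 0 + 0) : E3 × ℝ) = (2 : ℝ) • (((ω : E3), 0) : E3 × ℝ) := by
      simp
    rw [this, map_smul, smul_eq_mul]
  simp only [B, ContinuousLinearMap.bilinearComp_apply, ContinuousLinearMap.inl_apply] at h1
  simp only [Pi.add_apply, lap]
  linear_combination (-τ ^ 2) * h1 + τ * h2

/-! ### Spherical means as distributional solutions of the wave equation. -/

/-- The wave operator in terms of the second Fréchet derivative. -/
def box (φ : E3 × ℝ → ℝ) (z : E3 × ℝ) : ℝ :=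
  fderiv ℝ (fderiv ℝ φ) z (0, 1) (0, 1) - lap φ z

theorem hasDerivAt_line (y v : E3) (s t : ℝ) :
    HasDerivAt (fun t : ℝ => ((y + (t - s) • v, t) : E3 × ℝ)) (v, 1) t := by
  have h : HasDerivAt (fun t : ℝ => y + (t - s) • v) v t := by
    simpa using (((hasDerivAt_id t).sub_const s).smul_const v).const_add y
  exact h.prodMk (hasDerivAt_id t)

theorem iteratedDeriv_two_snd {φ : E3 × ℝ → ℝ} (hφ : ContDiff ℝ 2 φ) (x : E3) (t : ℝ) :
    iteratedDeriv 2 (fun s => φ (x, s)) t = fderiv ℝ (fderiv ℝ φ) (x, t) (0, 1) (0, 1) := by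
  have hc : ∀ t, HasDerivAt (fun t : ℝ => ((x, t) : E3 × ℝ)) (0, 1) t := fun t =>
    (hasDerivAt_const t x).prodMk (hasDerivAt_id t)
  have h1 : deriv (fun s => φ (x, s)) = fun s => fderiv ℝ φ (x, s) (0, 1) := by
    ext s
    exact (hasDerivAt_comp_path hφ (hc s)).deriv
  rw [iteratedDeriv_succ, iteratedDeriv_one, h1,
    (hasDerivAt_fderiv_comp_path hφ (hc t) (hasDerivAt_const t ((0, 1) : E3 × ℝ))).deriv]
  simp

theorem laplacian_fst {φ : E3 × ℝ → ℝ} (hφ : ContDiff ℝ 2 φ) (x : E3) (t : ℝ) :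
    Laplacian.laplacian (fun y : E3 => φ (y, t)) x = lap φ (x, t) := by
  have hp : ∀ y, HasFDerivAt (fun y : E3 => ((y, t) : E3 × ℝ)) (ContinuousLinearMap.inl ℝ E3 ℝ) y :=
    fun y => hasFDerivAt_prodMk_left y t
  have hd : Differentiable ℝ (fderiv ℝ φ) :=
    (hφ.fderiv_right (m := 1) (by norm_num)).differentiable one_ne_zero
  have h1 : fderiv ℝ (fun y : E3 => φ (y, t)) =
      fun y => (fderiv ℝ φ (y, t)).comp (ContinuousLinearMap.inl ℝ E3 ℝ) := by
    ext1 y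
    exact (((hφ.differentiable two_ne_zero _).hasFDerivAt).comp y (hp y)).fderiv
  have h2 : ∀ v : E3, fderiv ℝ (fderiv ℝ (fun y : E3 => φ (y, t))) x v v =
      fderiv ℝ (fderiv ℝ φ) (x, t) (v, 0) (v, 0) := by
    intro v
    rw [h1]
    have h3 := ((hd (x, t)).hasFDerivAt.comp x (hp x)).clm_comp
      (hasFDerivAt_const (ContinuousLinearMap.inl ℝ E3 ℝ) x)
    have h4 : fderiv ℝ (fun y => (fderiv ℝ φ (y, t)).comp (ContinuousLinearMap.inl ℝ E3 ℝ)) x = _ :=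
      h3.fderiv
    rw [h4]
    simp
  rw [InnerProductSpace.laplacian_eq_iteratedFDeriv_orthonormalBasis _
    (EuclideanSpace.basisFun (Fin 3) ℝ)]
  simp only [iteratedFDeriv_two_apply, lap]
  refine Finset.sum_congr rfl fun i _ => ?_
  simpa using h2 (EuclideanSpace.single i 1)

theorem continuous_box {φ : E3 × ℝ → ℝ} (hφ : ContDiff ℝ 2 φ) : Continuous (box φ) := by
  have := continuous_fderiv_fderiv hφ
  unfold box lap
  fun_prop

theorem exists_support_bound {φ : E3 × ℝ → ℝ} (hs : HasCompactSupport φ) :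
    ∃ a : ℝ, ∀ z : E3 × ℝ, a < ‖z‖ → φ z = 0 ∧ fderiv ℝ φ z = 0 ∧ box φ z = 0 := by
  obtain ⟨a, ha⟩ := hs.isCompact.isBounded.subset_closedBall 0
  refine ⟨a, fun z hz => ?_⟩
  have h0 : z ∉ tsupport φ := fun h => by
    have := ha h
    rw [mem_closedBall_zero_iff] at this
    linarith
  have h1 : z ∉ tsupport (fderiv ℝ φ) := fun h => h0 (tsupport_fderiv_subset ℝ h)
  have h2 : z ∉ tsupport (fderiv ℝ (fderiv ℝ φ)) := fun h => h1 (tsupport_fderiv_subset ℝ h)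
  have h3 := image_eq_zero_of_notMem_tsupport h2
  exact ⟨image_eq_zero_of_notMem_tsupport h0, image_eq_zero_of_notMem_tsupport h1, by
    simp [box, lap, h3]⟩

/-- The wave operator is orthogonal to the fundamental solution. -/
theorem integral_mul_sphereMean_box {φ : E3 × ℝ → ℝ} (hφ : ContDiff ℝ 2 φ)
    (hs : HasCompactSupport φ) (y : E3) (s : ℝ) :
    ∫ t : ℝ, (t - s) * ∫ ω : S2, box φ (y + (t - s) • (ω : E3), t) ∂surf = 0 := by
  obtain ⟨a, ha⟩ := exists_support_bound hs
  have hD2 := continuous_fderiv_fderiv hφ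
  have hD1 : Continuous (fderiv ℝ φ) := hφ.continuous_fderiv two_ne_zero
  have hφc := hφ.continuous
  have hbox := continuous_box hφ
  let c : ℝ → E3 → E3 × ℝ := fun t ω => (y + (t - s) • ω, t)
  have hc : Continuous fun p : ℝ × E3 => c p.1 p.2 := by simp only [c]; fun_prop
  have hdc : ∀ t ω, HasDerivAt (fun t => c t ω) (ω, 1) t := fun t ω => hasDerivAt_line y ω s t
  have hca : ∀ t ω, a < |t| → a < ‖c t ω‖ := fun t ω h => h.trans_le (norm_snd_le (c t ω))
  -- Differentiating `q` along the ray `(ω, 1)` cancels the mixed second derivatives. By the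
  -- Euler–Poisson–Darboux identity the spherical integral of `q'` is `t - s` times that of `box φ`,
  -- so the integrand in `t` is almost everywhere the derivative of a compactly supported function.
  let q : ℝ → E3 → ℝ := fun t ω => (t - s) * fderiv ℝ φ (c t ω) (-ω, 1) - φ (c t ω)
  let q' : ℝ → E3 → ℝ := fun t ω => (t - s) * (fderiv ℝ (fderiv ℝ φ) (c t ω) (0, 1) (0, 1) -
    fderiv ℝ (fderiv ℝ φ) (c t ω) (ω, 0) (ω, 0)) - 2 * fderiv ℝ φ (c t ω) (ω, 0)
  have hq : Continuous (Function.uncurry q) :=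
    ((continuous_fst.sub continuous_const).mul ((hD1.comp hc).clm_apply (by fun_prop :
      Continuous fun p : ℝ × E3 => ((-p.2, 1) : E3 × ℝ)))).sub (hφc.comp hc)
  have cω : Continuous fun p : ℝ × E3 => ((p.2, 0) : E3 × ℝ) := by fun_prop
  have hq' : Continuous (Function.uncurry q') :=
    ((continuous_fst.sub continuous_const).mul
      ((((hD2.comp hc).clm_apply continuous_const).clm_apply continuous_const).sub
      (((hD2.comp hc).clm_apply cω).clm_apply cω))).sub
      (continuous_const.mul ((hD1.comp hc).clm_apply cω))
  have hdq : ∀ t (ω : S2), HasDerivAt (fun t => q t ω) (q' t ω) t := by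
    intro t ω
    have h1 := (((hasDerivAt_id t).sub_const s).mul (hasDerivAt_fderiv_comp_path hφ (hdc t ω)
      (hasDerivAt_const t ((-(ω : E3), 1) : E3 × ℝ)))).sub (hasDerivAt_comp_path hφ (hdc t ω))
    refine h1.congr_deriv ?_
    have hsym : IsSymmSndFDerivAt ℝ φ (c t ω) := hφ.contDiffAt.isSymmSndFDerivAt (by simp)
    have e1 : (((ω : E3), 1) : E3 × ℝ) = ((ω : E3), 0) + (0, 1) := by simp
    have e2 : ((-(ω : E3), 1) : E3 × ℝ) = (0, 1) - ((ω : E3), 0) := by simp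
    have e3 := hsym ((ω : E3), 0) (0, 1)
    simp only [q', id, e1, e2, map_add, map_sub, _root_.add_apply, map_zero, e3]
    ring
  have hQ : ∀ t, HasDerivAt (fun t => ∫ ω : S2, q t ω ∂surf) (∫ ω : S2, q' t ω ∂surf) t :=
    hasDerivAt_sphereMean (fun t => hq.comp (by fun_prop : Continuous fun y : E3 => (t, y))) hq' hdq
  have hint : ∀ {p : ℝ → E3 → ℝ}, Continuous (Function.uncurry p) →
      (∀ t (ω : E3), a < |t| → p t ω = 0) → Integrable fun t => ∫ ω : S2, p t ω ∂surf := by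
    intro p hp h0
    refine (continuous_sphereMean hp).integrable_of_hasCompactSupport
      (HasCompactSupport.intro (isCompact_closedBall (0 : ℝ) a) fun t ht => ?_)
    rw [mem_closedBall_zero_iff, not_le, Real.norm_eq_abs] at ht
    simp [h0 t _ ht]
  have h2 : ∀ t (ω : E3), a < |t| → fderiv ℝ (fderiv ℝ φ) (c t ω) = 0 := by
    intro t ω h
    have h3 : fderiv ℝ φ =ᶠ[𝓝 (c t ω)] fun _ => 0 := by
      have : ∀ᶠ z : E3 × ℝ in 𝓝 (c t ω), a < ‖z‖ :=
        continuous_norm.continuousAt.eventually_const_lt (hca t ω h)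
      filter_upwards [this] with z hz using (ha z hz).2.1
    rw [h3.fderiv_eq]; simp
  have hzero := integral_eq_zero_of_hasDerivAt_of_integrable hQ
    (hint hq' fun t ω h => by simp [q', h2 t ω h, (ha _ (hca t ω h)).2.1])
    (hint hq fun t ω h => by simp [q, (ha _ (hca t ω h)).1, (ha _ (hca t ω h)).2.1])
  rw [← hzero]
  have hne : ∀ᵐ t : ℝ, t ≠ s := by
    rw [ae_iff]; simp
  refine integral_congr_ae (hne.mono fun t ht => ?_)
  have hts : t - s ≠ 0 := sub_ne_zero.2 ht
  have hslice : ∀ {p : ℝ → E3 → ℝ}, Continuous (Function.uncurry p) →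
      Integrable (fun ω : S2 => p t ω) surf := fun hp =>
    integrable_sphere (f := fun ω => _) (hp.comp (by fun_prop : Continuous fun y : E3 => (t, y)))
  have hepd := integral_euler_poisson_darboux hφ y t (t - s)
  have hcb : Continuous fun p : ℝ × E3 => box φ (c p.1 p.2) := hbox.comp hc
  have i1 : Integrable (fun ω : S2 => (t - s) * q' t ω) surf := (hslice hq').const_mul _
  have i2 : Integrable (fun ω : S2 => (t - s) ^ 2 * box φ (c t ω)) surf :=
    (hslice (p := fun t ω => box φ (c t ω)) hcb).const_mul _
  have h5 : ∫ ω : S2, ((t - s) * q' t ω - (t - s) ^ 2 * box φ (c t ω)) ∂surf = 0 := by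
    rw [← hepd]
    refine integral_congr_ae (.of_forall fun ω => ?_)
    simp only [q', box, c]
    ring
  rw [integral_sub i1 i2, integral_const_mul, integral_const_mul] at h5
  have h6 : (t - s) * (∫ ω : S2, q' t ω ∂surf - (t - s) * ∫ ω : S2, box φ (c t ω) ∂surf) = 0 := by
    linear_combination h5
  have h7 := (mul_eq_zero.1 h6).resolve_left hts
  simp only [c] at h7 ⊢
  linarith

theorem integral_shear {F : E3 × ℝ → ℝ} (hF : Continuous F) (hs : HasCompactSupport F)
    (v : E3) (s : ℝ) : ∫ z : E3 × ℝ, F (z.1 + (z.2 - s) • v, z.2) = ∫ z : E3 × ℝ, F z := by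
  let e : E3 × ℝ ≃ₜ E3 × ℝ :=
    { toFun := fun z => (z.1 + (z.2 - s) • v, z.2)
      invFun := fun z => (z.1 - (z.2 - s) • v, z.2)
      left_inv := fun z => by simp
      right_inv := fun z => by simp
      continuous_toFun := by fun_prop
      continuous_invFun := by fun_prop }
  have i1 : Integrable F (volume.prod volume) := hF.integrable_of_hasCompactSupport hs
  have i2 : Integrable (fun z => F (e z)) (volume.prod volume) :=
    (hF.comp e.continuous).integrable_of_hasCompactSupport (hs.comp_homeomorph e)
  have h1 := integral_prod_symm _ i1
  have h2 := integral_prod_symm _ i2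
  refine (h2.trans ?_).trans h1.symm
  refine integral_congr_ae (.of_forall fun t => ?_)
  exact integral_add_right_eq_self (fun x => F (x, t)) ((t - s) • v)

/-- Fubini and a shear along `(ω, 1)` move the spherical mean from `G` to the test function, where
`integral_mul_sphereMean_box` applies for each `y`. Since `S` is odd in time, both halves of the
cone with vertex at time `s` contribute and no boundary term arises there. -/
theorem integral_S_mul_box {G : E3 → ℝ} (hG : Continuous G) {φ : E3 × ℝ → ℝ}
    (hφ : ContDiff ℝ 2 φ) (hs : HasCompactSupport φ) (s : ℝ) :
    ∫ z : E3 × ℝ, S G z.1 (z.2 - s) * box φ z = 0 := by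
  obtain ⟨a, ha⟩ := exists_support_bound hs
  have hbox := continuous_box hφ
  let H : (E3 × ℝ) × S2 → ℝ := fun p =>
    (p.1.2 - s) * (G p.1.1 * box φ (p.1.1 + (p.1.2 - s) • (p.2 : E3), p.1.2))
  let K : (E3 × ℝ) × S2 → ℝ := fun p =>
    (p.1.2 - s) * (G (p.1.1 - (p.1.2 - s) • (p.2 : E3)) * box φ p.1)
  have hH : Continuous H := by simp only [H]; fun_prop
  have hK : Continuous K := by simp only [K]; fun_prop
  have cH : HasCompactSupport H := by
    refine HasCompactSupport.intro ((isCompact_closedBall (0 : E3 × ℝ) (2 * a + |s|)).prod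
      (isCompact_univ (X := S2))) fun p hp => ?_
    have h1 : 2 * a + |s| < ‖p.1‖ := by simpa using hp
    have h2 : a < ‖((p.1.1 + (p.1.2 - s) • (p.2 : E3), p.1.2) : E3 × ℝ)‖ := by
      by_contra h
      push Not at h
      have h3 := (norm_snd_le ((p.1.1 + (p.1.2 - s) • (p.2 : E3), p.1.2) : E3 × ℝ)).trans h
      have h4 := (norm_fst_le ((p.1.1 + (p.1.2 - s) • (p.2 : E3), p.1.2) : E3 × ℝ)).trans h
      have h5 : ‖(p.1.2 - s) • (p.2 : E3)‖ = |p.1.2 - s| := by simp [norm_smul]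
      simp only [Real.norm_eq_abs] at h3 h4
      have h6 := norm_sub_le (p.1.1 + (p.1.2 - s) • (p.2 : E3)) ((p.1.2 - s) • (p.2 : E3))
      rw [add_sub_cancel_right, h5] at h6
      have h7 := abs_sub p.1.2 s
      have h8 := abs_nonneg s
      rw [Prod.norm_def, Real.norm_eq_abs] at h1
      rcases lt_max_iff.1 h1 with h9 | h9 <;> linarith [abs_nonneg p.1.2]
    simp [H, (ha _ h2).2.2]
  have cK : HasCompactSupport K := by
    refine HasCompactSupport.intro ((isCompact_closedBall (0 : E3 × ℝ) a).prod
      (isCompact_univ (X := S2))) fun p hp => ?_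
    have h1 : a < ‖p.1‖ := by simpa using hp
    simp [K, (ha _ h1).2.2]
  have iH : Integrable H ((volume : Measure (E3 × ℝ)).prod surf) :=
    hH.integrable_of_hasCompactSupport cH
  have iK : Integrable K ((volume : Measure (E3 × ℝ)).prod surf) :=
    hK.integrable_of_hasCompactSupport cK
  -- The antipodal symmetry gives the sign for which the shear cancels the shift inside `G`.
  have h0 : ∀ (x : E3) (τ : ℝ), ∫ ω : S2, G (x + τ • (ω : E3)) ∂surf =
      ∫ ω : S2, G (x - τ • (ω : E3)) ∂surf := by
    intro x τ
    have := surf_integral_isometry (LinearIsometryEquiv.neg ℝ) (fun ω => G (x + τ • ω))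
      (by fun_prop)
    simpa [← sub_eq_add_neg] using this.symm
  have h1 : ∫ z : E3 × ℝ, S G z.1 (z.2 - s) * box φ z =
      1 / (4 * Real.pi) * ∫ z : E3 × ℝ, ∫ ω : S2, K (z, ω) ∂surf := by
    rw [← integral_const_mul]
    refine integral_congr_ae (.of_forall fun z => ?_)
    simp only [S, h0, K, integral_const_mul, integral_mul_const]
    ring
  have h2 : ∀ ω : S2, ∫ z, K (z, ω) = ∫ z, H (z, ω) := by
    intro ω
    have c1 : Continuous fun z : E3 × ℝ => (z, ω) := by fun_prop
    have c2 : HasCompactSupport fun z : E3 × ℝ => K (z, ω) :=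
      HasCompactSupport.intro (isCompact_closedBall (0 : E3 × ℝ) a) fun z hz => by
        rw [mem_closedBall_zero_iff, not_le] at hz
        simp [K, (ha _ hz).2.2]
    refine (integral_shear (F := fun z => K (z, ω)) (hK.comp c1) c2 ω s).symm.trans ?_
    refine integral_congr_ae (.of_forall fun z => ?_)
    simp [K, H]
  have h3 : ∫ z : E3 × ℝ, ∫ ω : S2, H (z, ω) ∂surf = 0 := by
    have i3 : Integrable (fun z : E3 × ℝ => ∫ ω : S2, H (z, ω) ∂surf) (volume.prod volume) :=
      iH.integral_prod_left
    refine (integral_prod _ i3).trans ?_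
    refine integral_eq_zero_of_ae (.of_forall fun y => ?_)
    have h4 := integral_mul_sphereMean_box hφ hs y s
    simp only [H, integral_const_mul, Pi.zero_apply]
    rw [← mul_zero (G y), ← h4, ← integral_const_mul]
    refine integral_congr_ae (.of_forall fun t => ?_)
    ring
  rw [h1, integral_integral_swap (f := fun z ω => K (z, ω)) iK]
  simp only [h2]
  rw [← integral_integral_swap (f := fun z ω => H (z, ω)) iH, h3, mul_zero]

/-- The pairing of `box φ` with every time shift of `S v` vanishes; differentiating in the shift
under the integral gives the claim with only one derivative of `v`. -/
theorem integral_dS_mul_box {v : E3 → ℝ} (hv : ContDiff ℝ 1 v) {φ : E3 × ℝ → ℝ}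
    (hφ : ContDiff ℝ 2 φ) (hs : HasCompactSupport φ) :
    ∫ z : E3 × ℝ, dS v z.1 z.2 * box φ z = 0 := by
  obtain ⟨a, ha⟩ := exists_support_bound hs
  have hbox := continuous_box hφ
  have hcS := continuous_S_snd hv.continuous
  have hcd := continuous_dS hv
  have hcomp : ∀ F : E3 × ℝ → ℝ, Continuous F → Integrable fun z => F z * box φ z := by
    intro F hF
    refine (hF.mul hbox).integrable_of_hasCompactSupport
      (HasCompactSupport.intro (isCompact_closedBall (0 : E3 × ℝ) a) fun z hz => ?_)
    rw [mem_closedBall_zero_iff, not_le] at hz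
    simp [(ha _ hz).2.2]
  have c1 : ∀ s : ℝ, Continuous fun z : E3 × ℝ => (z.1, z.2 + s) := fun s => by fun_prop
  obtain ⟨M, hM⟩ := (isCompact_closedBall (0 : E3 × ℝ) (a + 1)).exists_bound_of_continuousOn
    hcd.continuousOn
  have key := hasDerivAt_integral_of_dominated_loc_of_deriv_le (μ := (volume : Measure (E3 × ℝ)))
    (s := Metric.ball (0 : ℝ) 1) (x₀ := 0) (bound := fun z => ‖M * box φ z‖)
    (F := fun s z => S v z.1 (z.2 + s) * box φ z) (F' := fun s z => dS v z.1 (z.2 + s) * box φ z)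
    (Metric.ball_mem_nhds _ one_pos)
    (.of_forall fun s => ((hcS.comp (c1 s)).mul hbox).aestronglyMeasurable)
    (hcomp _ (hcS.comp (c1 0))) ((hcd.comp (c1 0)).mul hbox).aestronglyMeasurable
    (.of_forall fun z s hs => by
      by_cases hz : a < ‖z‖
      · simp [(ha _ hz).2.2]
      · rw [norm_mul, norm_mul]
        refine mul_le_mul_of_nonneg_right ?_ (norm_nonneg _)
        refine (hM (z.1, z.2 + s) ?_).trans (le_abs_self M)
        rw [mem_closedBall_zero_iff, Prod.norm_def]
        have hs' : ‖s‖ < 1 := by simpa using hs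
        have h1 := norm_fst_le z
        have h2 := norm_snd_le z
        have h3 := norm_add_le z.2 s
        push Not at hz
        exact max_le (by dsimp only; linarith) (by dsimp only; linarith))
    (hcomp _ continuous_const).norm
    (.of_forall fun z s _ => ((hasDerivAt_S hv z.1 (z.2 + s)).comp_const_add z.2 s).mul_const _)
  have h0 : ∀ s : ℝ, ∫ z : E3 × ℝ, S v z.1 (z.2 + s) * box φ z = 0 := fun s => by
    have := integral_S_mul_box hv.continuous hφ hs (-s)
    simpa [sub_neg_eq_add] using this
  have h1 := key.2
  simp only [h0] at h1
  simpa using h1.unique (hasDerivAt_const _ _)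

/-! ### Waves generated by a decaying source and scattering. -/

/-- A source inside the light cone with integrable decay in time. -/
structure DecayingSource (R B q : ℝ) (G : E3 → ℝ → ℝ) : Prop where
  continuous : Continuous fun z : E3 × ℝ => G z.1 z.2
  one_lt : 1 < q
  bound : ∀ y s, 0 ≤ s → |G y s| ≤ B * (s + 1) ^ (-(2 + q))
  support : ∀ y s, 0 ≤ s → s + R < ‖y‖ → G y s = 0

/-- The wave generated by the source at all later times. -/
def totalWave (G : E3 → ℝ → ℝ) (x : E3) (t : ℝ) : ℝ :=
  ∫ s in Ioi (0 : ℝ), S (fun y => G y s) x (t - s)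

namespace DecayingSource

variable {R B q : ℝ} {G : E3 → ℝ → ℝ}

theorem nonneg (h : DecayingSource R B q G) : 0 ≤ B := by
  simpa using (abs_nonneg _).trans (h.bound 0 0 le_rfl)

theorem continuous_slice (h : DecayingSource R B q G) (s : ℝ) : Continuous fun y => G y s :=
  h.continuous.comp (by fun_prop : Continuous fun y : E3 => (y, s))

theorem continuous_S_source (h : DecayingSource R B q G) :
    Continuous fun p : (E3 × ℝ) × ℝ => S (fun y => G y p.2) p.1.1 (p.1.2 - p.2) :=
  continuous_S (X := (E3 × ℝ) × ℝ) (G := fun p y => G y p.2)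
    (h.continuous.comp (by fun_prop : Continuous fun r : ((E3 × ℝ) × ℝ) × E3 => (r.2, r.1.2)))
    (x := fun p => p.1.1) (τ := fun p => p.1.2 - p.2) (by fun_prop) (by fun_prop)

theorem abs_S_source_le (h : DecayingSource R B q G) {x : E3} {t s k : ℝ} (hs : 0 ≤ s)
    (hk : |t - s| ≤ k * (s + 1)) :
    |S (fun y => G y s) x (t - s)| ≤ k * (B * (s + 1) ^ (-(1 + q))) := by
  have h1 : 0 < s + 1 := by linarith
  have h2 : 0 ≤ B * (s + 1) ^ (-(2 + q)) := mul_nonneg h.nonneg (Real.rpow_nonneg h1.le _)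
  have h3 : (s + 1) * (s + 1) ^ (-(2 + q)) = (s + 1) ^ (-(1 + q)) := by
    rw [← Real.rpow_one_add' h1.le (by linarith [h.one_lt])]
    congr 1; ring
  calc _ ≤ |t - s| * (B * (s + 1) ^ (-(2 + q))) := abs_S_le fun ω => h.bound _ _ hs
    _ ≤ k * (s + 1) * (B * (s + 1) ^ (-(2 + q))) := by gcongr
    _ = _ := by rw [← h3]; ring

theorem integrableOn_rpow (h : DecayingSource R B q G) (k : ℝ) :
    IntegrableOn (fun s : ℝ => k * (B * (s + 1) ^ (-(1 + q)))) (Ioi 0) :=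
  ((integrableOn_add_rpow_Ioi_of_lt (by linarith [h.one_lt]) (by norm_num)).const_mul B).const_mul k

theorem abs_sub_le_mul {t s k : ℝ} (hs : 0 ≤ s) (hk : |t| ≤ k) : |t - s| ≤ (k + 1) * (s + 1) := by
  have h1 := abs_sub t s
  rw [abs_of_nonneg hs] at h1
  have h2 : 0 ≤ k * s := mul_nonneg ((abs_nonneg t).trans hk) hs
  linarith

theorem continuous_totalWave (h : DecayingSource R B q G) :
    Continuous fun z : E3 × ℝ => totalWave G z.1 z.2 := by
  refine continuous_iff_continuousAt.2 fun z₀ => ?_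
  have hev : ∀ᶠ z : E3 × ℝ in 𝓝 z₀, |z.2| < |z₀.2| + 1 :=
    (by fun_prop : Continuous fun z : E3 × ℝ => |z.2|).continuousAt.eventually_lt_const (by simp)
  refine continuousAt_of_dominated (F := fun (z : E3 × ℝ) s => S (fun y => G y s) z.1 (z.2 - s))
    (.of_forall fun z => ?_) (hev.mono fun z hz => ?_) (h.integrableOn_rpow (|z₀.2| + 1 + 1))
    (.of_forall fun s => ?_)
  · exact (h.continuous_S_source.comp
      (by fun_prop : Continuous fun s : ℝ => (z, s))).aestronglyMeasurable
  · exact (ae_restrict_mem measurableSet_Ioi).mono fun s hs =>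
      h.abs_S_source_le (le_of_lt hs) (abs_sub_le_mul (le_of_lt hs) hz.le)
  · exact (h.continuous_S_source.comp
      (by fun_prop : Continuous fun z : E3 × ℝ => (z, s))).continuousAt

theorem integrableOn_S_source (h : DecayingSource R B q G) (x : E3) (t : ℝ) :
    IntegrableOn (fun s => S (fun y => G y s) x (t - s)) (Ioi 0) := by
  refine (h.integrableOn_rpow (|t| + 1)).mono' ((h.continuous_S_source.comp
    (by fun_prop : Continuous fun s : ℝ => ((x, t), s))).aestronglyMeasurable) ?_
  exact (ae_restrict_mem measurableSet_Ioi).mono fun s hs =>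
    h.abs_S_source_le (le_of_lt hs) (abs_sub_le_mul (le_of_lt hs) le_rfl)

/-- Each slice generates a free wave on all of space-time, and the superposition converges
absolutely against `box φ`, so the integrals may be interchanged. -/
theorem integral_totalWave_mul_box (h : DecayingSource R B q G) {φ : E3 × ℝ → ℝ}
    (hφ : ContDiff ℝ 2 φ) (hs : HasCompactSupport φ) :
    ∫ z : E3 × ℝ, totalWave G z.1 z.2 * box φ z = 0 := by
  obtain ⟨a, ha⟩ := exists_support_bound hs
  have hbox := continuous_box hφ
  let K : E3 × ℝ → ℝ → ℝ := fun z s => S (fun y => G y s) z.1 (z.2 - s) * box φ z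
  have i1 : Integrable fun z : E3 × ℝ => (‖z‖ + 1) * |box φ z| := by
    refine (by fun_prop : Continuous fun z : E3 × ℝ =>
      (‖z‖ + 1) * |box φ z|).integrable_of_hasCompactSupport
      (HasCompactSupport.intro (isCompact_closedBall (0 : E3 × ℝ) a) fun z hz => ?_)
    rw [mem_closedBall_zero_iff, not_le] at hz
    simp [(ha _ hz).2.2]
  have iK : Integrable (Function.uncurry K)
      ((volume : Measure (E3 × ℝ)).prod (volume.restrict (Ioi 0))) := by
    refine (i1.mul_prod (h.integrableOn_rpow 1)).mono' (h.continuous_S_source.mul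
      (hbox.comp continuous_fst)).aestronglyMeasurable ?_
    have h0 : ∀ᵐ p ∂((volume : Measure (E3 × ℝ)).prod (volume.restrict (Ioi (0 : ℝ)))),
        p.2 ∈ Ioi (0 : ℝ) :=
      Measure.quasiMeasurePreserving_snd.ae (ae_restrict_mem measurableSet_Ioi)
    refine h0.mono fun p hp => ?_
    rw [Real.norm_eq_abs, Function.uncurry, abs_mul]
    have h1 := h.abs_S_source_le (x := p.1.1) (le_of_lt hp)
      (abs_sub_le_mul (t := p.1.2) (le_of_lt hp) (norm_snd_le p.1))
    calc _ ≤ (‖p.1‖ + 1) * (B * (p.2 + 1) ^ (-(1 + q))) * |box φ p.1| := by gcongr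
      _ = _ := by ring
  calc _ = ∫ z, ∫ s in Ioi (0 : ℝ), K z s := by
        simp only [totalWave, K, integral_mul_const]
    _ = ∫ s in Ioi (0 : ℝ), ∫ z, K z s := integral_integral_swap iK
    _ = 0 := integral_eq_zero_of_ae (.of_forall fun s =>
        integral_S_mul_box (h.continuous_slice s) hφ hs s)

/-- The wave generated after time `t` decays faster than `(1 + t + |x|)⁻¹`. -/
theorem abs_totalWave_sub_le (h : DecayingSource R B q G) (hR : 0 ≤ R) (x : E3) {t : ℝ}
    (ht : 0 ≤ t) :
    (1 + t + ‖x‖) * |(∫ s in (0 : ℝ)..t, S (fun y => G y s) x (t - s)) - totalWave G x t| ≤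
      ∫ s in Ioi t, (2 + R) * B * (s + 1) ^ (-q) := by
  have hi := h.integrableOn_S_source x t
  have hi' := hi.mono_set (Ioi_subset_Ioi ht)
  have h1 := intervalIntegral.integral_interval_add_Ioi hi hi'
  have h2 : (∫ s in (0 : ℝ)..t, S (fun y => G y s) x (t - s)) - totalWave G x t =
      -∫ s in Ioi t, S (fun y => G y s) x (t - s) := by
    rw [totalWave, ← h1]; ring
  have hp : 0 ≤ 1 + t + ‖x‖ := by positivity
  rw [h2, abs_neg]
  calc _ = ‖∫ s in Ioi t, (1 + t + ‖x‖) * S (fun y => G y s) x (t - s)‖ := by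
        rw [integral_const_mul, norm_mul, Real.norm_of_nonneg hp, Real.norm_eq_abs]
    _ ≤ _ := by
      refine norm_integral_le_of_norm_le ((integrableOn_add_rpow_Ioi_of_lt
        (by linarith [h.one_lt]) (by linarith)).const_mul _)
        ((ae_restrict_mem measurableSet_Ioi).mono fun s hs => ?_)
      have hst : t < s := hs
      have hs1 : 0 < s + 1 := by linarith
      have hB := h.nonneg
      rw [norm_mul, Real.norm_of_nonneg hp, Real.norm_eq_abs]
      -- If `S` does not vanish, the support of the source forces `‖x‖ ≤ (s - t) + (s + R)`, hence
      -- this inequality. The weight thus costs one further power of `s + 1`, and `(s + 1)^(-q)` is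
      -- still integrable.
      by_cases hc : 1 + t + ‖x‖ ≤ (2 + R) * (s + 1)
      · have h3 : |S (fun y => G y s) x (t - s)| ≤ 1 * (B * (s + 1) ^ (-(1 + q))) :=
          h.abs_S_source_le (by linarith) (by rw [abs_of_neg] <;> linarith)
        have h4 : (s + 1) * (s + 1) ^ (-(1 + q)) = (s + 1) ^ (-q) := by
          rw [← Real.rpow_one_add' hs1.le (by linarith [h.one_lt])]
          congr 1; ring
        calc _ ≤ (2 + R) * (s + 1) * (1 * (B * (s + 1) ^ (-(1 + q)))) := by gcongr
          _ = _ := by rw [← h4]; ring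
      · rw [S_eq_zero fun ω => ?_, abs_zero, mul_zero]
        · positivity
        · refine h.support _ _ (by linarith) ?_
          push Not at hc
          have h5 : ‖(t - s) • (ω : E3)‖ = s - t := by
            rw [norm_smul, Real.norm_eq_abs, abs_of_neg (by linarith)]; simp
          have h6 := norm_sub_le (x + (t - s) • (ω : E3)) ((t - s) • (ω : E3))
          rw [add_sub_cancel_right, h5] at h6
          nlinarith

theorem tendsto_tail (h : DecayingSource R B q G) :
    Tendsto (fun t : ℝ => ∫ s in Ioi t, (2 + R) * B * (s + 1) ^ (-q)) atTop (𝓝 0) := by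
  have hi : IntegrableOn (fun s : ℝ => (2 + R) * B * (s + 1) ^ (-q)) (Ioi 0) :=
    (integrableOn_add_rpow_Ioi_of_lt (by linarith [h.one_lt]) (by norm_num)).const_mul _
  have h1 := (intervalIntegral_tendsto_integral_Ioi 0 hi tendsto_id).const_sub
    (∫ s in Ioi (0 : ℝ), (2 + R) * B * (s + 1) ^ (-q))
  rw [sub_self] at h1
  refine h1.congr' ((eventually_ge_atTop 0).mono fun t ht => ?_)
  rw [← intervalIntegral.integral_interval_add_Ioi hi (hi.mono_set (Ioi_subset_Ioi ht)),
    id, add_sub_cancel_left]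

end DecayingSource

theorem isFreeWave_of_box {w : E3 → ℝ → ℝ} (hw : Continuous fun z : E3 × ℝ => w z.1 z.2)
    (h : ∀ φ : E3 × ℝ → ℝ, ContDiff ℝ 2 φ → HasCompactSupport φ →
      ∫ z : E3 × ℝ, w z.1 z.2 * box φ z = 0) : IsFreeWave w := by
  refine ⟨hw.continuousOn, fun φ hφ hs _ => ?_⟩
  have hφ2 : ContDiff ℝ 2 φ := mod_cast contDiff_infty.1 hφ 2
  rw [← h φ hφ2 hs]
  refine integral_congr_ae (.of_forall fun z => ?_)
  simp only [iteratedDeriv_two_snd hφ2, laplacian_fst hφ2, box]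

/-- The free wave with the given data plus the wave generated by the source at all times. -/
theorem isFreeWave_add {R B q : ℝ} {G : E3 → ℝ → ℝ} (h : DecayingSource R B q G) {v₀ v : E3 → ℝ}
    (h₀ : ContDiff ℝ 1 v₀) (hv : Continuous v) :
    IsFreeWave fun x t => dS v₀ x t + S v x t + totalWave G x t := by
  have c1 := continuous_dS h₀
  have c2 := continuous_S_snd hv
  have c3 := h.continuous_totalWave
  refine isFreeWave_of_box ((c1.add c2).add c3) fun φ hφ hs => ?_
  have hi : ∀ F : E3 × ℝ → ℝ, Continuous F → Integrable fun z => F z * box φ z := by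
    obtain ⟨a, ha⟩ := exists_support_bound hs
    intro F hF
    refine (hF.mul (continuous_box hφ)).integrable_of_hasCompactSupport
      (HasCompactSupport.intro (isCompact_closedBall (0 : E3 × ℝ) a) fun z hz => ?_)
    rw [mem_closedBall_zero_iff, not_le] at hz
    simp [(ha _ hz).2.2]
  simp only [add_mul]
  have h12 : Integrable fun z : E3 × ℝ => dS v₀ z.1 z.2 * box φ z + S v z.1 z.2 * box φ z :=
    (hi _ c1).add (hi _ c2)
  rw [integral_add h12 (hi _ c3), integral_add (hi _ c1) (hi _ c2),
    integral_dS_mul_box h₀ hφ hs, h.integral_totalWave_mul_box hφ hs]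
  simpa using integral_S_mul_box hv hφ hs 0

/-- The Lipschitz estimate is applied against the zero function. Then `N(τ₊) ≥ τ₊^q` and `N(τ₋) ≥ 1`
turn the weights into a power of `τ₊`, which is at least `(s + 1) / R`. -/
theorem exists_decayingSource {γ R A : ℝ} (hγ₀ : 0 < γ) (hγ : γ < 3) (hR : 1 ≤ R) (hA : 0 ≤ A)
    {u : E3 → ℝ → ℝ} (hu : Continuous fun z : E3 × ℝ => u z.1 z.2) (hX : InX γ R A u)
    (hs : ∀ y s, max s 0 + R < ‖y‖ → u y s = 0) :
    ∃ B, DecayingSource R B (1 + min γ 1) (source γ u) := by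
  obtain ⟨C, hC, hb⟩ := nonlinear_bound hγ₀ hγ hR
  have hR0 : 0 < R := by linarith
  have hN := isWeight_weightN hγ₀
  set q := 1 + min γ 1
  have hsupp : ∀ y s, 0 ≤ s → s + R < ‖y‖ → source γ u y s = 0 := fun y s h0 hy => by
    simp [source, cubic, hX.support y s h0 hy]
  refine ⟨C * (A ^ 2 * A) * R ^ (2 + q), continuous_source hγ₀ hγ hu hs, hN.one_lt,
    fun y s h0 => ?_, hsupp⟩
  have hs1 : 0 < s + 1 := by linarith
  by_cases hy : s + R < ‖y‖
  · rw [hsupp y s h0 hy, abs_zero]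
    positivity
  push Not at hy
  have hzero : InX γ R A fun _ _ => 0 :=
    ⟨fun y s h0 hy => by
      have := one_le_wt hγ₀ hR h0 hy
      simp only [abs_zero]; positivity, fun _ _ _ _ => rfl⟩
  have h1 := hb u (fun _ _ => 0) A A hA hA
    (fun s _ => hu.comp (by fun_prop : Continuous fun y : E3 => (y, s)))
    (fun _ _ => continuous_const) hX hzero (by simpa using hX) y s h0 hy
  rw [mul_zero, sub_zero] at h1
  have h2 : (s + 1) / R ≤ tauPlus R ‖y‖ s := by
    exact div_le_div_of_nonneg_right (by linarith [norm_nonneg y]) hR0.le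
  have h3 : 1 ≤ tauPlus R ‖y‖ s := by
    rw [tauPlus, le_div_iff₀ hR0]; linarith [norm_nonneg y]
  have h4 := hN.lower _ h3
  have h5 := hN.one_le (one_le_tauMinus hR hy)
  have h6 : ((s + 1) / R) ^ (2 + q) ≤ tauPlus R ‖y‖ s ^ 2 * weightN γ (tauPlus R ‖y‖ s) *
      weightN γ (tauMinus R ‖y‖ s) := by
    have hq := hN.one_lt
    calc ((s + 1) / R) ^ (2 + q) ≤ tauPlus R ‖y‖ s ^ (2 + q) := by gcongr
      _ = tauPlus R ‖y‖ s ^ 2 * tauPlus R ‖y‖ s ^ q := by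
        rw [Real.rpow_add (by linarith), Real.rpow_two]
      _ ≤ tauPlus R ‖y‖ s ^ 2 * weightN γ (tauPlus R ‖y‖ s) * 1 := by rw [mul_one]; gcongr
      _ ≤ _ := by
        have : 0 ≤ weightN γ (tauPlus R ‖y‖ s) := by linarith [hN.one_le h3]
        gcongr
  have h7 : 0 < ((s + 1) / R) ^ (2 + q) := by positivity
  rw [source, max_eq_left h0, cubic]
  refine h1.trans ((div_le_div_of_nonneg_left (by positivity) h7 h6).trans_eq ?_)
  rw [Real.div_rpow hs1.le hR0.le, Real.rpow_neg hs1.le, div_div_eq_mul_div, div_eq_mul_inv]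

/-! ### Properties of the solution and the final assembly. -/

theorem IsSolution.congr {γ : ℝ} {v₀ v₁ : E3 → ℝ} {T : ℝ≥0∞} {u w : E3 → ℝ → ℝ}
    (hu : IsSolution γ v₀ v₁ T u) (h : ∀ y s, 0 ≤ s → w y s = u y s) :
    IsSolution γ v₀ v₁ T w where
  continuousOn := hu.continuousOn.congr fun z hz => h z.1 z.2 hz.1
  integrable z hz := by
    simp only [fun y => h y z.2 hz.1]
    exact hu.integrable z hz
  locallyBounded K hK hKs := by
    obtain ⟨C, hC⟩ := hu.locallyBounded K hK hKs
    exact ⟨C, fun z hz => by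
      rw [conv_congr fun y => h y z.2 (hKs hz).1]
      exact hC z hz⟩
  equation z hz := by
    rw [h z.1 z.2 hz.1, hu.equation z hz]
    congr 1
    exact duhamel_congr hz.1 (fun y s hs => (cubic_congr (fun y => h y s hs.1) y).symm) z.1

theorem isSolution_top {γ R : ℝ} (hγ₀ : 0 < γ) (hγ : γ < 3) {v₀ v₁ : E3 → ℝ} {u : E3 → ℝ → ℝ}
    (hu : Continuous fun z : E3 × ℝ => u z.1 z.2)
    (hs : ∀ y s, max s 0 + R < ‖y‖ → u y s = 0)
    (he : ∀ x t, 0 ≤ t → u x t = freePart v₀ v₁ x t + duhamel (cubic γ u) x t) :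
    IsSolution γ v₀ v₁ ⊤ u where
  continuousOn := hu.continuousOn
  integrable z _ := integrable_conv hγ₀ hγ (f := fun y => u y z.2 ^ 2)
    ((hu.comp (by fun_prop : Continuous fun y : E3 => (y, z.2))).pow 2) (a := max z.2 0 + R)
    (fun y hy => by
      by_contra hn
      exact hy (by simp [hs y z.2 (not_le.1 hn)])) z.1
  locallyBounded K hK _ := by
    have h := continuous_conv hγ₀ hγ hu (ρ := fun s => max s 0 + R) (by fun_prop)
      (fun y t h => by by_contra hn; exact h (hs y t (not_le.1 hn)))
    obtain ⟨C, hC⟩ := hK.exists_bound_of_continuousOn h.continuousOn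
    exact ⟨C, fun z hz => (le_abs_self _).trans (hC z hz)⟩
  equation z hz := he z.1 z.2 hz.1

theorem InX.memX {γ R A : ℝ} (hγ₀ : 0 < γ) (hR : 1 ≤ R) {u : E3 → ℝ → ℝ}
    (hu : Continuous fun z : E3 × ℝ => u z.1 z.2) (hX : InX γ R A u) : MemX γ R ⊤ u where
  continuousOn := hu.continuousOn
  norm_lt_top := by
    refine lt_of_le_of_lt (iSup₂_le fun z hz => ENNReal.ofReal_le_ofReal (q := max A 0) ?_)
      ENNReal.ofReal_lt_top
    by_cases hy : ‖z.1‖ ≤ z.2 + R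
    · have h1 := hX.bound z.1 z.2 hz.1 hy
      have h2 := one_le_wt hγ₀ hR hz.1 hy
      rw [le_div_iff₀' (by linarith)] at h1
      exact h1.trans (le_max_left _ _)
    · simp [hX.support z.1 z.2 hz.1 (not_le.1 hy)]
  support z hz h := by
    by_contra hn
    exact h (hX.support z.1 z.2 hz.1 (not_le.1 hn))

/-- Since `R τ₊ = t + ‖x‖ + 2R` dominates `1 + t + ‖x‖` and `N(τ₋) ≥ 1`, the weight contains the
required decay up to the factor `R`. -/
theorem InX.decay {γ R A : ℝ} (hγ₀ : 0 < γ) (hR : 1 ≤ R) (hA : 0 ≤ A) {u : E3 → ℝ → ℝ}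
    (hX : InX γ R A u) {t : ℝ} (ht : 0 ≤ t) (x : E3) : (1 + t + ‖x‖) * |u x t| ≤ R * A := by
  have hR0 : 0 < R := by linarith
  by_cases hy : ‖x‖ ≤ t + R
  · have h1 := hX.bound x t ht hy
    have h2 := one_le_wt hγ₀ hR ht hy
    rw [le_div_iff₀' (by linarith)] at h1
    have h3 : (1 + t + ‖x‖) ≤ R * wt γ R x t := by
      have h4 : R * tauPlus R ‖x‖ t = t + ‖x‖ + 2 * R := by rw [tauPlus]; field_simp
      have h5 := (isWeight_weightN hγ₀).one_le (one_le_tauMinus hR hy)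
      have h6 : 0 ≤ R * tauPlus R ‖x‖ t := by rw [h4]; positivity
      calc _ ≤ R * tauPlus R ‖x‖ t * 1 := by rw [h4]; linarith
        _ ≤ R * tauPlus R ‖x‖ t * weightN γ (tauMinus R ‖x‖ t) := by gcongr
        _ = _ := by rw [wt]; ring
    calc _ ≤ R * wt γ R x t * |u x t| := by gcongr
      _ = R * (wt γ R x t * |u x t|) := by ring
      _ ≤ R * A := by gcongr
  · rw [hX.support x t ht (not_le.1 hy), abs_zero, mul_zero]
    positivity

/-- The solution approaches a free wave. -/
theorem exists_isFreeWave_tendsto {γ R ε A : ℝ} (hγ₀ : 0 < γ) (hγ : γ < 3) (hR : 1 ≤ R)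
    (hA : 0 ≤ A) {v₀ v₁ : E3 → ℝ} (hd : SmallData R ε v₀ v₁) {u : E3 → ℝ → ℝ}
    (hu : Continuous fun z : E3 × ℝ => u z.1 z.2) (hX : InX γ R A u)
    (hs : ∀ y s, max s 0 + R < ‖y‖ → u y s = 0)
    (he : ∀ x t, 0 ≤ t → u x t = freePart v₀ v₁ x t + duhamel (cubic γ u) x t) :
    ∃ w : E3 → ℝ → ℝ, IsFreeWave w ∧ Tendsto (fun t : ℝ => ⨆ x : E3,
      ENNReal.ofReal ((1 + t + ‖x‖) * |u x t - w x t|)) atTop (𝓝 0) := by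
  obtain ⟨B, hG⟩ := exists_decayingSource hγ₀ hγ hR hA hu hX hs
  -- The candidate for `u⁺` extends the Duhamel integral from `[0, t]` to all `s > 0`; the free
  -- parts cancel in the difference, which leaves the tail.
  refine ⟨_, isFreeWave_add hG hd.contDiff₀ (v := fun y => v₀ y + v₁ y)
    (hd.contDiff₀.continuous.add hd.continuous₁), ?_⟩
  have h0 := (ENNReal.continuous_ofReal.tendsto 0).comp (hG.tendsto_tail)
  rw [ENNReal.ofReal_zero] at h0
  refine tendsto_of_tendsto_of_tendsto_of_le_of_le' tendsto_const_nhds h0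
    (.of_forall fun t => zero_le) ((eventually_ge_atTop 0).mono fun t ht =>
      iSup_le fun x => ENNReal.ofReal_le_ofReal ?_)
  have h1 := hG.abs_totalWave_sub_le (by linarith) x ht
  rw [he x t ht, freePart_eq hd.contDiff₀ x ht, duhamel_cubic_eq γ u x ht]
  refine (congrArg (fun r => (1 + t + ‖x‖) * |r|) ?_).trans_le h1
  ring

end CubicConvWave

end

theorem theorem2p3 (γ R : ℝ) (hγ₀ : 0 < γ) (hγ₃ : γ < 3) (hR : 1 ≤ R) :
    ∃ ε₀ : ℝ, 0 < ε₀ ∧ ∃ C : ℝ, 0 < C ∧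
      ∀ ε : ℝ, 0 < ε → ε ≤ ε₀ →
      ∀ v₀ v₁ : CubicConvWave.E3 → ℝ,
        ContDiff ℝ 2 v₀ → ContDiff ℝ 1 v₁ →
        tsupport v₀ ⊆ Metric.closedBall 0 R → tsupport v₁ ⊆ Metric.closedBall 0 R →
        CubicConvWave.dataNorm v₀ v₁ ≤ ENNReal.ofReal ε →
        CubicConvWave.lifespan γ v₀ v₁ = ⊤ ∧
        ∃ u : CubicConvWave.E3 → ℝ → ℝ,
          CubicConvWave.IsSolution γ v₀ v₁ ⊤ u ∧
          CubicConvWave.MemX γ R ⊤ u ∧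
          (∀ (T : ℝ≥0∞) (w : CubicConvWave.E3 → ℝ → ℝ), 0 < T →
            CubicConvWave.IsSolution γ v₀ v₁ T w →
            ∀ z ∈ CubicConvWave.slab T, w z.1 z.2 = u z.1 z.2) ∧
          (∃ uPlus : CubicConvWave.E3 → ℝ → ℝ, CubicConvWave.IsFreeWave uPlus ∧
            Tendsto (fun t : ℝ => ⨆ x : CubicConvWave.E3,
              ENNReal.ofReal ((1 + t + ‖x‖) * |u x t - uPlus x t|)) atTop (𝓝 0)) ∧
          CubicConvWave.IsOriginalSolution γ v₀ v₁ ⊤ (fun x t => u x t / (1 + t)) ∧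
          (∀ t : ℝ, 0 ≤ t → ∀ x : CubicConvWave.E3,
            (1 + t + ‖x‖) * |u x t / (1 + t)| ≤ C * ε * (1 + t)⁻¹) := by
  obtain ⟨ε₀, hε₀, C, hC, hfix⟩ := CubicConvWave.exists_fixedPoint hγ₀ hγ₃ hR
  refine ⟨ε₀, hε₀, R * C, by positivity, fun ε hε hεε v₀ v₁ h₀ h₁ hs₀ hs₁ hn => ?_⟩
  have hd := CubicConvWave.smallData_of_dataNorm hε.le h₀ h₁ hs₀ hs₁ hn
  obtain ⟨u, hu, hX, hs, he⟩ := hfix ε v₀ v₁ hε hεε hd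
  have hA : 0 ≤ C * ε := by positivity
  have hsol := CubicConvWave.isSolution_top hγ₀ hγ₃ hu hs he
  have huniq : ∀ (T : ℝ≥0∞) (w : CubicConvWave.E3 → ℝ → ℝ),
      CubicConvWave.IsSolution γ v₀ v₁ T w →
      ∀ z ∈ CubicConvWave.slab T, w z.1 z.2 = u z.1 z.2 := fun T w hw =>
    (hsol.mono le_top).unique hγ₀ hγ₃ hd hw
  -- The value `⊤` itself belongs to the set whose supremum is the lifespan.
  refine ⟨top_unique (le_sSup ⟨ENNReal.zero_lt_top, u, hsol, huniq ⊤⟩), u, hsol,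
    hX.memX hγ₀ hR hu, fun T w _ => huniq T w,
    CubicConvWave.exists_isFreeWave_tendsto hγ₀ hγ₃ hR hA hd hu hX hs he, ?_, fun t ht x => ?_⟩
  · exact hsol.congr fun y s h => mul_div_cancel₀ _ (by linarith)
  · rw [abs_div, abs_of_pos (by linarith : 0 < 1 + t), ← mul_div_assoc, div_eq_mul_inv]
    have := hX.decay hγ₀ hR hA ht x
    rw [← mul_assoc] at this
    gcongr
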